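/- **Octahedral packings.** An *octahedral configuration* consists of six oriented generalized circles (circles or lines) in the Riemann sphere, with pairwise disjoint interiors, labelled $\mathcal C_a,\mathcal C_b,\mathcal C_c,\mathcal C_d,\mathcal C_e,\mathcal C_f$, such that opposite circles (the pairs $a,f$; $b,e$; $c,d$) are disjoint and all other pairs are tangent; thus the tangency graph is the octahedral graph. The curvature of a circle of radius $r$ is $1/r$ if its interior is bounded and $-1/r$ otherwise; a line has curvature $0$. For each of the eight faces (triples of pairwise tangent circles) the dual circle is the circle orthogonal to the three circles. The Apollonian group is generated by the reflections in the eight dual circles; the packing $\mathcal A$ is the orbit of the six circles under this group, and a *sextuple* of $\mathcal A$ is the image of the configuration under an element of the group, relabelled by any automorphism of the octahedral graph. $\mathcal A$ is *integral* if all its curvatures are integers, and *primitive* if moreover their greatest common divisor is $1$. An integral packing is of type $(0,1,2)$, respectively $(2,4,7)$, mod $8$ if it has a sextuple whose curvatures $(a,b,c,d,e,f)$ are congruent to $(1,0,2,0,2,1)$, respectively $(7,2,4,2,4,7)$, mod $8$. **The invariant.** For a sextuple with curvatures $(a,b,c,d,e,f)$ let $$Q_\alpha(x,y)=(a+c)x^2+(-2a-2b-c+d)xy+2(a+b)y^2,\qquad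 Q_\beta(x,y)=\tfrac12 Q_\alpha(x,y).$$ For a circle $\mathcal C\in\mathcal A$ of curvature $a\ne0$, choose a sextuple in which $\mathcal C=\mathcal C_a$, and an integer $\rho$ coprime to $a$ that is of the form $Q_\alpha(x,y)$ with $x$ odd or $Q_\beta(x,y)$ with $x$ even, for some integers $x,y$ with $y\ge0$ and $\gcd(x,y)=1$. With the Kronecker symbol, set $$\chi_2(\mathcal C)=\begin{cases}\left(\frac{\rho}{a/2}\right)& a\equiv2 \pmod 8,\\[2pt] \left(\frac{-\rho}{a}\right)& a\equiv4\pmod 8,\\[2pt] \left(\frac{\rho}{a}\right)&\text{otherwise.}\end{cases}$$ **Theorem.** Let $\mathcal A$ be a primitive integral octahedral packing of type $(0,1,2)$ or $(2,4,7)$ mod $8$. Then for each circle $\mathcal C\in\mathcal A$ of nonzero curvature, $\chi_2(\mathcal C)$ is well-defined (a sextuple and a $\rho$ as above exist, and the value does not depend on their choice), and it has the same value $\chi_2(\mathcal A)\in\{1,-1\}$ for all these circles. If $\chi_2(\mathcal A)=-1$, then no integer of the form $n^2$ or $2n^2$ with $n\in\mathbb Z$ occurs as a curvature in $\mathcal A$.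 In particular, the Local-Global Conjecture is then false for $\mathcal A$: it is not true that every sufficiently large integer which, for each $m\ge1$, is congruent modulo $m$ to some curvature in $\mathcal A$ is itself a curvature in $\mathcal A$. -/

import Mathlib

/-- An oriented generalized circle (circle or line) in `ℂ`, in inversive coordinates: `curvature` is
the signed curvature, `cocurvature` the curvature of the image under reflection in the unit circle,
and `(h₁, h₂)` is the curvature times the center; for a line (`curvature = 0`) it is a unit normal
vector. -/
@[ext]
structure OrientedCircle where
  cocurvature : ℝ
  curvature : ℝ
  h₁ : ℝ
  h₂ : ℝ
  quad_eq : h₁ ^ 2 + h₂ ^ 2 - curvature * cocurvature = 1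

namespace OrientedCircle

/-- The inversive inner product. If the circles meet it is the dot product of their oriented unit
normal vectors at a common point; if they are disjoint, it has absolute value greater than `1`. -/
noncomputable def inner (C D : OrientedCircle) : ℝ :=
  C.h₁ * D.h₁ + C.h₂ * D.h₂ - (C.curvature * D.cocurvature + C.cocurvature * D.curvature) / 2

/-- The interior. With center `p` and radius `r`, it is the open disc `|z - p| < r` for positive
curvature `1 / r`, the exterior `|z - p| > r` for negative curvature `-1 / r`, and the open
half-plane into which `(h₁, h₂)` points for a line. -/
def interior (C : OrientedCircle) : Set ℂ :=
  {z | C.curvature * (z.re ^ 2 + z.im ^ 2) - 2 * (C.h₁ * z.re + C.h₂ * z.im) + C.cocurvature < 0}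

/-- The same circle with the opposite orientation. -/
def reverse (C : OrientedCircle) : OrientedCircle where
  cocurvature := -C.cocurvature
  curvature := -C.curvature
  h₁ := -C.h₁
  h₂ := -C.h₂
  quad_eq := by linarith [C.quad_eq]

/-- Two different circles that are tangent and have opposite unit normal vectors at the point of
tangency (for parallel lines this point is `∞`). -/
def ExternallyTangent (C D : OrientedCircle) : Prop :=
  C.inner D = -1 ∧ D ≠ C.reverse

/-- Two circles without common point in the Riemann sphere, whose interiors (or whose exteriors) are
disjoint. -/
def ExternallyDisjoint (C D : OrientedCircle) : Prop :=
  C.inner D < -1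

/-- Two circles that intersect at right angles. -/
def Orthogonal (C D : OrientedCircle) : Prop :=
  C.inner D = 0

/-- The image of `C` under reflection (inversion) in `D`, namely `C - 2 ⟨C, D⟩ D`. -/
noncomputable def reflectFun (D C : OrientedCircle) : OrientedCircle where
  cocurvature := C.cocurvature - 2 * C.inner D * D.cocurvature
  curvature := C.curvature - 2 * C.inner D * D.curvature
  h₁ := C.h₁ - 2 * C.inner D * D.h₁
  h₂ := C.h₂ - 2 * C.inner D * D.h₂
  quad_eq := by
    have hC := C.quad_eq
    have hD := D.quad_eq
    have key : C.inner D =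
      C.h₁ * D.h₁ + C.h₂ * D.h₂
        - (C.curvature * D.cocurvature + C.cocurvature * D.curvature) / 2 := rfl
    linear_combination hC + 4 * (C.inner D) ^ 2 * hD + 4 * C.inner D * key

theorem reflectFun_reflectFun (D C : OrientedCircle) : reflectFun D (reflectFun D C) = C := by
  have hD := D.quad_eq
  have key : (reflectFun D C).inner D = -C.inner D := by
    simp only [inner, reflectFun]
    linear_combination (-2) * (C.h₁ * D.h₁ + C.h₂ * D.h₂
        - (C.curvature * D.cocurvature + C.cocurvature * D.curvature) / 2) * hD
  have e (D C : OrientedCircle) : (reflectFun D C).cocurvature =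
      C.cocurvature - 2 * C.inner D * D.cocurvature ∧
      (reflectFun D C).curvature = C.curvature - 2 * C.inner D * D.curvature ∧
      (reflectFun D C).h₁ = C.h₁ - 2 * C.inner D * D.h₁ ∧
      (reflectFun D C).h₂ = C.h₂ - 2 * C.inner D * D.h₂ := ⟨rfl, rfl, rfl, rfl⟩
  obtain ⟨a₁, a₂, a₃, a₄⟩ := e D (reflectFun D C)
  obtain ⟨b₁, b₂, b₃, b₄⟩ := e D C
  ext
  · rw [a₁, key, b₁]; ring
  · rw [a₂, key, b₂]; ring
  · rw [a₃, key, b₃]; ring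
  · rw [a₄, key, b₄]; ring

/-- Reflection in `D`, as a permutation of the oriented circles. -/
noncomputable def reflection (D : OrientedCircle) : Equiv.Perm OrientedCircle where
  toFun := reflectFun D
  invFun := reflectFun D
  left_inv := reflectFun_reflectFun D
  right_inv := reflectFun_reflectFun D

end OrientedCircle

/-- Adjacency in the octahedral graph on the vertices `0, …, 5` (written `a, b, c, d, e, f`): the
three pairs of opposite vertices are `{a, f}`, `{b, e}`, `{c, d}`, that is, `{i, Fin.rev i}`. -/
def OctAdj (i j : Fin 6) : Prop :=
  j ≠ i ∧ j ≠ Fin.rev i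

/-- A base configuration: six circles, oriented so that their interiors are disjoint, pairwise
tangent or disjoint, with octahedral tangency graph. -/
structure OctahedralConfiguration where
  circle : Fin 6 → OrientedCircle
  tangent : ∀ i j, OctAdj i j → (circle i).ExternallyTangent (circle j)
  disjoint : ∀ i, (circle i).ExternallyDisjoint (circle (Fin.rev i))
  interiors : ∀ i j, i ≠ j → Disjoint (circle i).interior (circle j).interior

/-- The Kronecker symbol `(a / b)` for `b ≠ 0`: the product of `(a / -1)` if `b < 0`, of `(a / 2)`
(the character `χ₈`) to the power of the exponent of `2` in `b`, and of the Jacobi symbol of `a`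
over the odd part of `|b|`. -/
def kroneckerSymbol (a b : ℤ) : ℤ :=
  (if b < 0 ∧ a < 0 then -1 else 1) * ZMod.χ₈ (a : ZMod 8) ^ padicValNat 2 b.natAbs *
    jacobiSym a (b.natAbs / 2 ^ padicValNat 2 b.natAbs)

/-- The quadratic form `Q_α` attached to the curvatures `s = (a, b, c, d, e, f)`. -/
def octQα (s : Fin 6 → ℤ) (x y : ℤ) : ℚ :=
  (s 0 + s 2) * x ^ 2 + (-2 * s 0 - 2 * s 1 - s 2 + s 3) * x * y + 2 * (s 0 + s 1) * y ^ 2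

/-- The quadratic form `Q_β` attached to the curvatures `s = (a, b, c, d, e, f)`. -/
def octQβ (s : Fin 6 → ℤ) (x y : ℤ) : ℚ :=
  (s 0 + s 2) / 2 * x ^ 2 + (-2 * s 0 - 2 * s 1 - s 2 + s 3) / 2 * x * y + (s 0 + s 1) * y ^ 2

/-- `ρ` is represented by `Q_α` at a primitive `(x, y)` with `y ≥ 0` and `x` odd, or by `Q_β` at a
primitive `(x, y)` with `y ≥ 0` and `x` even. -/
def OctRepresents (s : Fin 6 → ℤ) (ρ : ℤ) : Prop :=
  ∃ x y : ℤ, 0 ≤ y ∧ Int.gcd x y = 1 ∧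
    ((Odd x ∧ (ρ : ℚ) = octQα s x y) ∨ (Even x ∧ (ρ : ℚ) = octQβ s x y))

/-- The symbol defining `χ₂` of a circle of curvature `a`, computed with `ρ`. -/
def octSymbol (a ρ : ℤ) : ℤ :=
  if a % 8 = 2 then kroneckerSymbol ρ (a / 2)
  else if a % 8 = 4 then kroneckerSymbol (-ρ) a
  else kroneckerSymbol ρ a

namespace OctahedralConfiguration

/-- The dual circles: for each face of the octahedron (triple of pairwise adjacent vertices), the
circle orthogonal to the three corresponding base circles. It is unique up to orientation, on which
the reflection does not depend. -/
def dualCircles (A : OctahedralConfiguration) : Set OrientedCircle :=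
  {D | ∃ i j k, OctAdj i j ∧ OctAdj j k ∧ OctAdj i k ∧
    D.Orthogonal (A.circle i) ∧ D.Orthogonal (A.circle j) ∧ D.Orthogonal (A.circle k)}

/-- The Apollonian group, generated by the reflections in the dual circles. -/
def apollonianGroup (A : OctahedralConfiguration) : Subgroup (Equiv.Perm OrientedCircle) :=
  Subgroup.closure (OrientedCircle.reflection '' A.dualCircles)

/-- The octahedral packing: the orbit of the base circles under the Apollonian group. -/
def packing (A : OctahedralConfiguration) : Set OrientedCircle :=
  {C | ∃ g ∈ A.apollonianGroup, ∃ i, C = g (A.circle i)}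

/-- `S` is a sextuple of the packing: the image of the base configuration under an element of the
Apollonian group, labelled by `a, …, f` through any automorphism of the octahedral graph. -/
def IsSextuple (A : OctahedralConfiguration) (S : Fin 6 → OrientedCircle) : Prop :=
  ∃ g ∈ A.apollonianGroup, ∃ σ : Equiv.Perm (Fin 6),
    (∀ i j, OctAdj (σ i) (σ j) ↔ OctAdj i j) ∧ ∀ i, S i = g (A.circle (σ i))

/-- All curvatures of the packing are integers. -/
def IsIntegral (A : OctahedralConfiguration) : Prop :=
  ∀ C ∈ A.packing, ∃ k : ℤ, C.curvature = k

/-- The integers that occur as curvatures in the packing. -/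
def curvatures (A : OctahedralConfiguration) : Set ℤ :=
  {k | ∃ C ∈ A.packing, C.curvature = k}

/-- The greatest common divisor of all (integer) curvatures is `1`. -/
def IsPrimitive (A : OctahedralConfiguration) : Prop :=
  ∀ d : ℤ, (∀ k ∈ A.curvatures, d ∣ k) → IsUnit d

/-- The packing is of the type of the residues `t` mod `8`: it has a sextuple whose curvatures are
congruent to `t` mod `8`, in a suitable labelling. -/
def HasType (A : OctahedralConfiguration) (t : Fin 6 → ZMod 8) : Prop :=
  ∃ (S : Fin 6 → OrientedCircle) (s : Fin 6 → ℤ), A.IsSextuple S ∧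
    (∀ i, (S i).curvature = s i) ∧ ∀ i, (s i : ZMod 8) = t i

/-- All the values of `χ₂` at the circle `C` that are obtained from a sextuple of the packing with
first circle `C` and from an integer `ρ` represented by its forms and coprime to the curvature of
`C`. That `χ₂ (C)` is well-defined with value `ε` means that this set is `{ε}`. -/
def chi₂Values (A : OctahedralConfiguration) (C : OrientedCircle) : Set ℤ :=
  {ε | ∃ (S : Fin 6 → OrientedCircle) (s : Fin 6 → ℤ) (ρ : ℤ), A.IsSextuple S ∧ S 0 = C ∧
    (∀ i, (S i).curvature = s i) ∧ IsCoprime ρ (s 0) ∧ OctRepresents s ρ ∧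
    ε = octSymbol (s 0) ρ}

/-- `ε` is the quadratic invariant `χ₂` of the packing: `χ₂ (C)` is well-defined and equal to `ε`
for each circle `C` of nonzero curvature. -/
def IsChi₂ (A : OctahedralConfiguration) (ε : ℤ) : Prop :=
  ∀ C ∈ A.packing, C.curvature ≠ 0 → A.chi₂Values C = {ε}

/-- `n` satisfies the modular restrictions of the packing: it is congruent to some curvature modulo
each positive integer. -/
def Admissible (A : OctahedralConfiguration) (n : ℤ) : Prop :=
  ∀ m : ℕ, 0 < m → ∃ k ∈ A.curvatures, k ≡ n [ZMOD m]

/-- The Local-Global Conjecture for the packing: every sufficiently large integer subject to the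
modular restrictions is a curvature. -/
def LocalGlobal (A : OctahedralConfiguration) : Prop :=
  ∃ N : ℤ, ∀ n : ℤ, N ≤ n → A.Admissible n → n ∈ A.curvatures

end OctahedralConfiguration

/-!
Inversive coordinates turn circles into vectors of inner square `1` in a space of signature
`(3, 1)`. In an octahedral configuration the three differences of opposite circles are orthogonal to
each other and to the three sums of opposite circles; as they span a positive definite space, these
sums coincide (`OctahedralConfiguration.isOctFrame`). All relations between the circles of a
sextuple, and the effect of a reflection in a dual circle, follow from this. A statement that
survives relabelling and the reflection in one face holds for all sextuples as soon as it holds for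
one of them (`IsSextuple.induction`). In this way the residues modulo `8`, the lattice spanned by
the sextuple, primitivity, and the positivity of the sum of opposite curvatures are propagated.

For a circle of curvature `a`, the form `Q_α` is `A x² + 2 B x y + 2 C y²` with `2 A C - B² = 2 a²`,
so that the product of two of its values is `X² + 2 a² Y²`. Hence the represented numbers coprime to
`a` fall into one square class modulo each prime that divides `a`, up to a factor of `2` between
`Q_α` and `Q_β` that the residues modulo `8` render harmless (`OctTuple.octSymbol_eq`). The
represented numbers are the positive curvatures of the primitive isotropic vectors orthogonal to the
circle in the lattice of the packing. This description does not mention the sextuple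
(`octRepresents_iff_lattice`), so the invariant depends on the circle only.

Two tangent circles of coprime curvatures `a` odd and `b` even have the represented number `a + b`
in common, and their symbols agree by quadratic reciprocity (`octSymbol_reciprocity`). If the
curvatures are not coprime, the circles are connected by common neighbours with coprime curvatures:
the common neighbours of two tangent circles have as curvatures the values of a quadratic
polynomial, to which the Chinese remainder theorem applies (`exists_coprime_neighbour`). Consecutive
sextuples share a circle of odd curvature, so the invariant is constant (`exists_isChi₂`).

At a circle of curvature `n²` or `2 n²` with `n ≠ 0` the symbol is visibly `1`. A line is tangent to
a circle whose curvature is an odd square, so it forces the invariant `1` as well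
(`eq_one_of_mem_curvatures`).

If the invariant is `-1`, the Local-Global Conjecture fails at infinitely many integers `2 k²`. For a
face with curvatures `a` odd, `b` even and coprime to `a`, rotations about its edges give a
polynomial family of curvatures, which near each prime contains the neighbours of the circle `a` and
those of the circle `b`. If the odd part of `a b (a - b)` divides the odd number `k`, then at each
prime one of the two forms represents `2 k² + a` or `2 k² + b` by Hensel's lemma, and the Chinese
remainder theorem shows that `2 k²` is admissible (`admissible_two_mul_sq`).
-/


/-! ### The inversive form on `ℝ⁴` -/

namespace OrientedCircle

/-- The inversive coordinates of a circle as a vector of `ℝ⁴`. -/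
def vec (C : OrientedCircle) : Fin 4 → ℝ := ![C.cocurvature, C.curvature, C.h₁, C.h₂]

/-- The symmetric bilinear form of signature `(3, 1)` on `ℝ⁴` that restricts to the inversive inner
product of circles. -/
noncomputable def ip (u v : Fin 4 → ℝ) : ℝ :=
  u 2 * v 2 + u 3 * v 3 - (u 1 * v 0 + u 0 * v 1) / 2

theorem ip_vec (C D : OrientedCircle) : ip C.vec D.vec = C.inner D := rfl

theorem ip_comm (u v : Fin 4 → ℝ) : ip u v = ip v u := by simp only [ip]; ring

theorem ip_add_left (u v w : Fin 4 → ℝ) : ip (u + v) w = ip u w + ip v w := by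
  simp only [ip, Pi.add_apply]; ring

theorem ip_sub_left (u v w : Fin 4 → ℝ) : ip (u - v) w = ip u w - ip v w := by
  simp only [ip, Pi.sub_apply]; ring

theorem ip_smul_left (c : ℝ) (u w : Fin 4 → ℝ) : ip (c • u) w = c * ip u w := by
  simp only [ip, Pi.smul_apply, smul_eq_mul]; ring

theorem ip_add_right (u v w : Fin 4 → ℝ) : ip w (u + v) = ip w u + ip w v := by
  simp only [ip, Pi.add_apply]; ring

theorem ip_sub_right (u v w : Fin 4 → ℝ) : ip w (u - v) = ip w u - ip w v := by
  simp only [ip, Pi.sub_apply]; ring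

theorem ip_smul_right (c : ℝ) (u w : Fin 4 → ℝ) : ip w (c • u) = c * ip w u := by
  simp only [ip, Pi.smul_apply, smul_eq_mul]; ring

theorem inner_comm' (C D : OrientedCircle) : C.inner D = D.inner C := ip_comm C.vec D.vec

theorem inner_self (C : OrientedCircle) : C.inner C = 1 := by
  have := C.quad_eq
  simp only [inner]
  linarith

theorem vec_injective : Function.Injective vec := by
  intro C D h
  have h0 := congrFun h 0
  have h1 := congrFun h 1
  have h2 := congrFun h 2
  have h3 := congrFun h 3
  simp only [vec, Matrix.cons_val] at h0 h1 h2 h3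
  ext <;> assumption

/-- A vector orthogonal to four pairwise orthogonal non-isotropic vectors of `ℝ⁴` vanishes. -/
theorem eq_zero_of_orthogonal (e : Fin 4 → Fin 4 → ℝ) (he : ∀ i j, i ≠ j → ip (e i) (e j) = 0)
    (hn : ∀ i, ip (e i) (e i) ≠ 0) (w : Fin 4 → ℝ) (hw : ∀ i, ip (e i) w = 0) : w = 0 := by
  set G : Matrix (Fin 4) (Fin 4) ℝ :=
    !![0, -(1 / 2), 0, 0; -(1 / 2), 0, 0, 0; 0, 0, 1, 0; 0, 0, 0, 1] with hG
  have key (u v : Fin 4 → ℝ) : u ⬝ᵥ (G.mulVec v) = ip u v := by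
    simp [hG, Matrix.mulVec, dotProduct, Fin.sum_univ_four, ip]
    ring
  have hprod : (Matrix.of e) * G * (Matrix.of e).transpose =
      Matrix.diagonal fun i => ip (e i) (e i) := by
    ext i j
    have : ((Matrix.of e) * G * (Matrix.of e).transpose) i j = ip (e i) (e j) := by
      rw [Matrix.mul_assoc, ← key]
      simp only [Matrix.mul_apply, dotProduct, Matrix.mulVec, Matrix.of_apply,
        Matrix.transpose_apply]
    rw [this]
    by_cases h : i = j
    · subst h; simp
    · rw [Matrix.diagonal_apply_ne _ h, he i j h]
  have hdet : ((Matrix.of e) * G).det ≠ 0 := by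
    intro h0
    have := congrArg Matrix.det hprod
    rw [Matrix.det_mul, h0, zero_mul, Matrix.det_diagonal] at this
    exact (Finset.prod_ne_zero_iff.2 fun i _ => hn i) this.symm
  refine Matrix.eq_zero_of_mulVec_eq_zero hdet ?_
  rw [← Matrix.mulVec_mulVec]
  funext i
  have := hw i
  rw [← key] at this
  simpa [Matrix.mulVec] using this

theorem vec_reflection (D C : OrientedCircle) :
    (reflection D C).vec = C.vec - (2 * C.inner D) • D.vec := by
  funext i
  fin_cases i <;> simp [vec, reflection, reflectFun]

theorem inner_reflection (D C C' : OrientedCircle) :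
    (reflection D C).inner (reflection D C') = C.inner C' := by
  have hD := inner_self D
  rw [← ip_vec, vec_reflection, vec_reflection, ip_sub_left, ip_sub_right, ip_sub_right,
    ip_smul_left, ip_smul_right, ip_smul_left, ip_smul_right, ip_vec, ip_vec, ip_vec, ip_vec, hD,
    inner_comm' D C']
  ring

theorem reflection_inv (D : OrientedCircle) : (reflection D)⁻¹ = reflection D := by
  rw [inv_eq_iff_mul_eq_one]
  ext1 C
  exact reflectFun_reflectFun D C

end OrientedCircle

open OrientedCircle

/-! ### Octahedral frames -/

instance : DecidableRel OctAdj := fun _ _ => inferInstanceAs (Decidable (_ ∧ _))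

/-- Automorphisms of the octahedral graph. -/
def IsOctAut (σ : Equiv.Perm (Fin 6)) : Prop :=
  ∀ i j, OctAdj (σ i) (σ j) ↔ OctAdj i j

theorem octAdj_symm {i j : Fin 6} (h : OctAdj i j) : OctAdj j i := by
  revert i j; decide

theorem IsOctAut.rev {σ : Equiv.Perm (Fin 6)} (hσ : IsOctAut σ) (i : Fin 6) :
    σ (Fin.rev i) = Fin.rev (σ i) := by
  by_contra h
  have h1 : OctAdj (σ i) (σ (Fin.rev i)) :=
    ⟨fun h' => (by decide : ∀ i : Fin 6, Fin.rev i ≠ i) i (σ.injective h'), h⟩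
  exact ((hσ _ _).1 h1).2 rfl

theorem IsOctAut.mul {σ τ : Equiv.Perm (Fin 6)} (hσ : IsOctAut σ) (hτ : IsOctAut τ) :
    IsOctAut (σ * τ) := fun i j => (hσ _ _).trans (hτ i j)

theorem IsOctAut.inv {σ : Equiv.Perm (Fin 6)} (hσ : IsOctAut σ) : IsOctAut σ⁻¹ := fun i j => by
  rw [← hσ]; simp

theorem isOctAut_one : IsOctAut 1 := fun _ _ => Iff.rfl

/-- Each flag of pairwise adjacent vertices is the image of the flag `0, 1, 2`. -/
theorem exists_octAut {i j k : Fin 6} (hij : OctAdj i j) (hjk : OctAdj j k) (hik : OctAdj i k) :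
    ∃ σ, IsOctAut σ ∧ σ 0 = i ∧ σ 1 = j ∧ σ 2 = k := by
  have inj : ∀ i j k, OctAdj i j → OctAdj j k → OctAdj i k →
      Function.Injective ![i, j, k, Fin.rev k, Fin.rev j, Fin.rev i] := by decide
  have aut : ∀ i j k, OctAdj i j → OctAdj j k → OctAdj i k → ∀ l m : Fin 6,
      (OctAdj (![i, j, k, Fin.rev k, Fin.rev j, Fin.rev i] l)
        (![i, j, k, Fin.rev k, Fin.rev j, Fin.rev i] m) ↔ OctAdj l m) := by decide
  exact ⟨Equiv.ofBijective _ (Finite.injective_iff_bijective.1 (inj i j k hij hjk hik)),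
    aut i j k hij hjk hik, rfl, rfl, rfl⟩

/-- The vector relations between the six circles of an octahedral configuration. -/
structure IsOctFrame (S : Fin 6 → OrientedCircle) : Prop where
  adj : ∀ i j, OctAdj i j → (S i).inner (S j) = -1
  opp : ∀ i, (S i).inner (S (Fin.rev i)) = -3
  sum : ∀ i, (S i).vec + (S (Fin.rev i)).vec = (S 0).vec + (S 5).vec

/-- The orthogonality relations of the six circles force the opposite pairs to have equal sums: the
differences of opposite circles span a positive definite space, whose orthogonal complement is a
line that contains the three sums. -/
theorem OctahedralConfiguration.isOctFrame (A : OctahedralConfiguration) : IsOctFrame A.circle := by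
  have hadj (i j : Fin 6) (h : OctAdj i j) : (A.circle i).inner (A.circle j) = -1 :=
    (A.tangent i j h).1
  have hd (i : Fin 6) : (A.circle i).inner (A.circle (Fin.rev i)) < -1 := A.disjoint i
  have hself (i : Fin 6) : (A.circle i).inner (A.circle i) = 1 := inner_self _
  have main (i j k : Fin 6) (hij : OctAdj i j) (hjk : OctAdj j k) (hik : OctAdj i k) :
      (A.circle i).vec + (A.circle (Fin.rev i)).vec =
        (A.circle j).vec + (A.circle (Fin.rev j)).vec := by
    have aux : ∀ i j : Fin 6, OctAdj i j → OctAdj i (Fin.rev j) ∧ OctAdj (Fin.rev i) j ∧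
        OctAdj (Fin.rev i) (Fin.rev j) ∧ OctAdj j i ∧ OctAdj j (Fin.rev i) ∧
        OctAdj (Fin.rev j) i ∧ OctAdj (Fin.rev j) (Fin.rev i) := by decide
    obtain ⟨a1, a2, a3, a4, a5, a6, a7⟩ := aux _ _ hij
    obtain ⟨b1, b2, b3, b4, b5, b6, b7⟩ := aux _ _ hjk
    obtain ⟨c1, c2, c3, c4, c5, c6, c7⟩ := aux _ _ hik
    have hs (i : Fin 6) : (A.circle (Fin.rev i)).inner (A.circle i) =
      (A.circle i).inner (A.circle (Fin.rev i)) := inner_comm' _ _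
    have di := hd i
    have dj := hd j
    have dk := hd k
    rw [← sub_eq_zero]
    refine eq_zero_of_orthogonal ![(A.circle i).vec - (A.circle (Fin.rev i)).vec,
      (A.circle j).vec - (A.circle (Fin.rev j)).vec, (A.circle k).vec - (A.circle (Fin.rev k)).vec,
      (A.circle k).vec + (A.circle (Fin.rev k)).vec] ?_ ?_ _ ?_
    · intro p q hpq
      fin_cases p <;> fin_cases q <;> first | exact absurd rfl hpq | skip
      all_goals
        simp [ip_add_left, ip_add_right, ip_sub_left, ip_sub_right, ip_vec, *] <;> ring
    · intro p
      fin_cases p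
      all_goals
        simp [ip_add_left, ip_add_right, ip_sub_left, ip_sub_right, ip_vec, hself, hs]
        intro h
        linarith
    · intro p
      fin_cases p
      all_goals
        simp [ip_add_left, ip_add_right, ip_sub_left, ip_sub_right, ip_vec, *]
  have hsum (i : Fin 6) : (A.circle i).vec + (A.circle (Fin.rev i)).vec =
      (A.circle 0).vec + (A.circle 5).vec := by
    have e1 := main 0 1 2 (by decide) (by decide) (by decide)
    have e2 := main 0 2 1 (by decide) (by decide) (by decide)
    have r0 : Fin.rev (0 : Fin 6) = 5 := rfl
    have r1 : Fin.rev (1 : Fin 6) = 4 := rfl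
    have r2 : Fin.rev (2 : Fin 6) = 3 := rfl
    have r3 : Fin.rev (3 : Fin 6) = 2 := rfl
    have r4 : Fin.rev (4 : Fin 6) = 1 := rfl
    have r5 : Fin.rev (5 : Fin 6) = 0 := rfl
    rw [r0, r1] at e1
    rw [r0, r2] at e2
    fin_cases i
    · rfl
    · exact e1.symm
    · exact e2.symm
    · exact (add_comm _ _).trans e2.symm
    · exact (add_comm _ _).trans e1.symm
    · exact add_comm _ _
  refine ⟨hadj, fun i => ?_, hsum⟩
  obtain ⟨j, hj⟩ : ∃ j, OctAdj i j := by revert i; decide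
  have hj' : OctAdj i (Fin.rev j) ∧ OctAdj (Fin.rev i) j ∧ OctAdj (Fin.rev i) (Fin.rev j) := by
    revert i j; decide
  -- The inner square of `S i + S (rev i)` is its inner product with `S j + S (rev j)`.
  have h1 : ip ((A.circle i).vec + (A.circle (Fin.rev i)).vec)
      ((A.circle i).vec + (A.circle (Fin.rev i)).vec) = ip ((A.circle i).vec +
      (A.circle (Fin.rev i)).vec) ((A.circle j).vec + (A.circle (Fin.rev j)).vec) := by
    rw [hsum j, hsum i]
  simp only [ip_add_left, ip_add_right, ip_vec, hself, hadj _ _ hj, hadj _ _ hj'.1,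
    hadj _ _ hj'.2.1, hadj _ _ hj'.2.2, inner_comm' (A.circle (Fin.rev i)) (A.circle i)] at h1
  linarith

namespace IsOctFrame

variable {S : Fin 6 → OrientedCircle}

theorem comp (h : IsOctFrame S) {σ : Equiv.Perm (Fin 6)} (hσ : IsOctAut σ) :
    IsOctFrame (S ∘ σ) where
  adj i j hij := h.adj _ _ ((hσ i j).2 hij)
  opp i := by simp only [Function.comp, hσ.rev, h.opp]
  sum i := by
    have h5 : σ 5 = Fin.rev (σ 0) := hσ.rev 0
    simp only [Function.comp, hσ.rev, h5, h.sum]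

theorem vec3 (h : IsOctFrame S) : (S 3).vec = (S 0).vec + (S 5).vec - (S 2).vec :=
  eq_sub_of_add_eq' (h.sum 2)

theorem vec4 (h : IsOctFrame S) : (S 4).vec = (S 0).vec + (S 5).vec - (S 1).vec :=
  eq_sub_of_add_eq' (h.sum 1)

theorem inner_eq (h : IsOctFrame S) (i j : Fin 6) :
    (S i).inner (S j) = if j = i then 1 else if j = Fin.rev i then -3 else -1 := by
  split_ifs with h1 h2
  · rw [h1, inner_self]
  · rw [h2, h.opp]
  · exact h.adj i j ⟨h1, h2⟩

/-- The circles of a frame span `ℝ⁴`. -/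
theorem eq_zero (h : IsOctFrame S) {w : Fin 4 → ℝ} (h0 : ip (S 0).vec w = 0)
    (h1 : ip (S 1).vec w = 0) (h2 : ip (S 2).vec w = 0) (h5 : ip (S 5).vec w = 0) : w = 0 := by
  refine eq_zero_of_orthogonal ![(S 0).vec - (S 5).vec, (S 1).vec - (S 4).vec,
      (S 2).vec - (S 3).vec, (S 0).vec + (S 5).vec] ?_ ?_ _ ?_
  · intro p q hpq
    fin_cases p <;> fin_cases q <;> first | exact absurd rfl hpq | skip
    all_goals
      simp [ip_add_left, ip_add_right, ip_sub_left, ip_sub_right, ip_vec, h.inner_eq] <;> norm_num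
  · intro p
    fin_cases p
    all_goals
      simp [ip_add_left, ip_add_right, ip_sub_left, ip_sub_right, ip_vec, h.inner_eq]
      norm_num
  · intro p
    fin_cases p
    all_goals
      simp [ip_add_left, ip_sub_left, h.vec3, h.vec4, h0, h1, h2, h5]

/-- The vector orthogonal to the face `0, 1, 2` of a frame, of inner square `8`. -/
def normal (S : Fin 6 → OrientedCircle) : Fin 4 → ℝ :=
  (2 : ℝ) • ((S 0).vec + (S 1).vec + (S 2).vec) - ((S 0).vec + (S 5).vec)

theorem ip_normal (h : IsOctFrame S) (i : Fin 6) :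
    ip (S i).vec (normal S) = if i = 0 ∨ i = 1 ∨ i = 2 then 0 else -8 := by
  rw [normal]
  fin_cases i <;>
    simp [ip_sub_right, ip_add_right, ip_smul_right, ip_vec, h.inner_eq] <;>
    norm_num [Fin.ext_iff]

theorem ip_normal_self (h : IsOctFrame S) : ip (normal S) (normal S) = 8 := by
  nth_rewrite 1 [normal]
  simp only [ip_sub_left, ip_add_left, ip_smul_left, h.ip_normal]
  norm_num [Fin.ext_iff]

/-- The reflection in a circle orthogonal to the face `0, 1, 2` of a frame. -/
theorem vec_reflection (h : IsOctFrame S) {D : OrientedCircle} (h0 : D.Orthogonal (S 0))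
    (h1 : D.Orthogonal (S 1)) (h2 : D.Orthogonal (S 2)) (i : Fin 6) :
    (reflection D (S i)).vec =
      (S i).vec + (if i = 0 ∨ i = 1 ∨ i = 2 then (0 : ℝ) else 2) • normal S := by
  set c := ip D.vec (normal S) / 8 with hc
  have hp (i : Fin 6) : ip D.vec (S i).vec = c * ip (normal S) (S i).vec := by
    rw [Orthogonal, ← ip_vec] at h0 h1 h2
    have h8 : ip D.vec (normal S) = 8 * c := by rw [hc]; ring
    have h5 : ip D.vec (S 5).vec = -8 * c := by
      rw [normal, ip_sub_right, ip_smul_right, ip_add_right, ip_add_right, ip_add_right, h0, h1,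
        h2] at h8
      linarith
    rw [ip_comm (normal S), h.ip_normal]
    fin_cases i
    · simpa using h0
    · simpa using h1
    · simpa using h2
    · change ip D.vec (S 3).vec = _
      rw [h.vec3, ip_sub_right, ip_add_right, h0, h2, h5]; simp [Fin.ext_iff]; ring
    · change ip D.vec (S 4).vec = _
      rw [h.vec4, ip_sub_right, ip_add_right, h0, h1, h5]; simp [Fin.ext_iff]; ring
    · change ip D.vec (S 5).vec = _
      rw [h5]; simp [Fin.ext_iff]; ring
  have hD : D.vec = c • normal S := by
    have e (i : Fin 6) : ip (S i).vec (D.vec - c • normal S) = 0 := by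
      rw [ip_sub_right, ip_smul_right, ip_comm _ D.vec, hp, ip_comm (normal S), sub_self]
    exact sub_eq_zero.1 (h.eq_zero (e 0) (e 1) (e 2) (e 5))
  have hc8 : 8 * c ^ 2 = 1 := by
    have := inner_self D
    rw [← ip_vec, hD, ip_smul_left, ip_smul_right, h.ip_normal_self] at this
    linarith
  rw [OrientedCircle.vec_reflection, ← ip_vec, hD, ip_smul_right, h.ip_normal, smul_smul]
  split_ifs with hi
  · simp
  · rw [sub_eq_add_neg, ← neg_smul]
    congr 2
    linarith

theorem exists_dual (h : IsOctFrame S) : ∃ D : OrientedCircle,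
    D.Orthogonal (S 0) ∧ D.Orthogonal (S 1) ∧ D.Orthogonal (S 2) := by
  have h8 := h.ip_normal_self
  set e := normal S with he
  set r : ℝ := (√8)⁻¹ with hr
  have hr2 : r ^ 2 = 1 / 8 := by rw [hr, inv_pow, Real.sq_sqrt (by norm_num)]; norm_num
  let D : OrientedCircle :=
    ⟨r * e 0, r * e 1, r * e 2, r * e 3, by
      simp only [ip] at h8
      linear_combination r ^ 2 * h8 + 8 * hr2⟩
  have hD : D.vec = r • e := by
    funext i
    fin_cases i <;> simp [vec, D]
  have key (i : Fin 6) (hi : i = 0 ∨ i = 1 ∨ i = 2) : D.Orthogonal (S i) := by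
    rw [Orthogonal, inner_comm', ← ip_vec, hD, ip_smul_right, he, h.ip_normal, if_pos hi, mul_zero]
  exact ⟨D, key 0 (by simp), key 1 (by simp), key 2 (by simp)⟩

end IsOctFrame

/-! ### Sextuples and the induction over them -/

/-- `S'` arises from `S` by reflection in the dual circle of the face `0, 1, 2`. -/
def OctStep (S S' : Fin 6 → OrientedCircle) : Prop :=
  ∀ i, (S' i).vec =
    (S i).vec + (if i = 0 ∨ i = 1 ∨ i = 2 then (0 : ℝ) else 2) • IsOctFrame.normal S

theorem OctStep.eq_of_mem {S S' : Fin 6 → OrientedCircle} (h : OctStep S S') {i : Fin 6}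
    (hi : i = 0 ∨ i = 1 ∨ i = 2) : S' i = S i :=
  vec_injective (by rw [h i, if_pos hi, zero_smul, add_zero])

theorem OctStep.vec_of_notMem {S S' : Fin 6 → OrientedCircle} (h : OctStep S S') {i : Fin 6}
    (hi : ¬(i = 0 ∨ i = 1 ∨ i = 2)) : (S' i).vec = (S i).vec + (2 : ℝ) • IsOctFrame.normal S := by
  rw [h i, if_neg hi]

namespace OctahedralConfiguration

variable {A : OctahedralConfiguration}

theorem exists_linear {g : Equiv.Perm OrientedCircle} (hg : g ∈ A.apollonianGroup) :
    ∃ L : (Fin 4 → ℝ) →ₗ[ℝ] (Fin 4 → ℝ), ∀ C, (g C).vec = L C.vec := by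
  induction hg using Subgroup.closure_induction'' with
  | mem g hg =>
    obtain ⟨D, -, rfl⟩ := hg
    refine ⟨{ toFun := fun u => u - (2 * ip u D.vec) • D.vec, map_add' := ?_, map_smul' := ?_ },
      fun C => vec_reflection D C⟩
    · intro u v
      rw [ip_add_left]; module
    · intro c u
      rw [ip_smul_left]; simp only [RingHom.id_apply]; module
  | inv_mem g hg =>
    obtain ⟨D, -, rfl⟩ := hg
    rw [reflection_inv]
    refine ⟨{ toFun := fun u => u - (2 * ip u D.vec) • D.vec, map_add' := ?_, map_smul' := ?_ },
      fun C => vec_reflection D C⟩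
    · intro u v
      rw [ip_add_left]; module
    · intro c u
      rw [ip_smul_left]; simp only [RingHom.id_apply]; module
  | one => exact ⟨LinearMap.id, fun C => rfl⟩
  | mul g h _ _ ihg ihh =>
    obtain ⟨L, hL⟩ := ihg
    obtain ⟨L', hL'⟩ := ihh
    exact ⟨L ∘ₗ L', fun C => by simp [hL, hL']⟩

theorem inner_map {g : Equiv.Perm OrientedCircle} (hg : g ∈ A.apollonianGroup)
    (C D : OrientedCircle) : (g C).inner (g D) = C.inner D := by
  induction hg using Subgroup.closure_induction'' generalizing C D with
  | mem g hg =>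
    obtain ⟨E, -, rfl⟩ := hg
    exact inner_reflection E C D
  | inv_mem g hg =>
    obtain ⟨E, -, rfl⟩ := hg
    rw [reflection_inv]
    exact inner_reflection E C D
  | one => rfl
  | mul g h _ _ ihg ihh => exact (ihg _ _).trans (ihh _ _)

theorem isSextuple_base : A.IsSextuple A.circle :=
  ⟨1, one_mem _, 1, isOctAut_one, fun _ => rfl⟩

theorem IsSextuple.comp {S : Fin 6 → OrientedCircle} (h : A.IsSextuple S)
    {σ : Equiv.Perm (Fin 6)} (hσ : IsOctAut σ) : A.IsSextuple (S ∘ σ) := by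
  obtain ⟨g, hg, τ, hτ, e⟩ := h
  exact ⟨g, hg, τ * σ, IsOctAut.mul hτ hσ, fun i => e (σ i)⟩

theorem IsSextuple.isOctFrame {S : Fin 6 → OrientedCircle} (h : A.IsSextuple S) :
    IsOctFrame S := by
  obtain ⟨g, hg, τ, hτ, e⟩ := h
  have hb := A.isOctFrame.comp hτ
  obtain ⟨L, hL⟩ := exists_linear hg
  refine ⟨fun i j hij => ?_, fun i => ?_, fun i => ?_⟩
  · rw [e, e, inner_map hg]; exact hb.adj i j hij
  · rw [e, e, inner_map hg]; exact hb.opp i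
  · simp only [e, hL, ← map_add]
    exact congrArg L (hb.sum i)

theorem IsSextuple.mem_packing {S : Fin 6 → OrientedCircle} (h : A.IsSextuple S) (i : Fin 6) :
    S i ∈ A.packing := by
  obtain ⟨g, hg, τ, -, e⟩ := h
  exact ⟨g, hg, τ i, e i⟩

theorem exists_isSextuple {C : OrientedCircle} (h : C ∈ A.packing) :
    ∃ S, A.IsSextuple S ∧ S 0 = C := by
  obtain ⟨g, hg, i, rfl⟩ := h
  obtain ⟨j, k, hij, hjk, hik⟩ : ∃ j k, OctAdj i j ∧ OctAdj j k ∧ OctAdj i k := by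
    revert i; decide
  obtain ⟨σ, hσ, h0, -⟩ := exists_octAut hij hjk hik
  exact ⟨fun i => g (A.circle (σ i)), ⟨g, hg, σ, hσ, fun _ => rfl⟩, by simp only [h0]⟩

/-- If `D` is dual to the face `0, 1, 2` of the relabelled base configuration, then the images of
this configuration under `g` and under `g` after the reflection in `D` differ by a step. -/
theorem octStep_of_orthogonal {g : Equiv.Perm OrientedCircle} (hg : g ∈ A.apollonianGroup)
    {σ : Equiv.Perm (Fin 6)} (hσ : IsOctAut σ) {D : OrientedCircle}
    (h0 : D.Orthogonal (A.circle (σ 0))) (h1 : D.Orthogonal (A.circle (σ 1)))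
    (h2 : D.Orthogonal (A.circle (σ 2))) :
    OctStep (fun i => g (A.circle (σ i))) fun i => g (reflection D (A.circle (σ i))) := by
  obtain ⟨L, hL⟩ := exists_linear hg
  intro i
  have := (A.isOctFrame.comp hσ).vec_reflection h0 h1 h2 i
  simp only [Function.comp] at this
  rw [hL, this, map_add, map_smul, hL]
  simp only [IsOctFrame.normal, Function.comp, hL, map_sub, map_add, map_smul]

theorem mem_dualCircles {σ : Equiv.Perm (Fin 6)} (hσ : IsOctAut σ) {D : OrientedCircle}
    (h0 : D.Orthogonal (A.circle (σ 0))) (h1 : D.Orthogonal (A.circle (σ 1)))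
    (h2 : D.Orthogonal (A.circle (σ 2))) : D ∈ A.dualCircles :=
  ⟨_, _, _, (hσ 0 1).2 (by decide), (hσ 1 2).2 (by decide), (hσ 0 2).2 (by decide), h0, h1, h2⟩

theorem IsSextuple.exists_step {S : Fin 6 → OrientedCircle} (h : A.IsSextuple S) :
    ∃ S', A.IsSextuple S' ∧ OctStep S S' := by
  obtain ⟨g, hg, σ, hσ, e⟩ := h
  obtain ⟨D, h0, h1, h2⟩ := (A.isOctFrame.comp hσ).exists_dual
  have hS : S = fun i => g (A.circle (σ i)) := funext e
  refine ⟨fun i => g (reflection D (A.circle (σ i))), ⟨g * reflection D, mul_mem hg ?_, σ, hσ,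
    fun i => rfl⟩, hS ▸ octStep_of_orthogonal hg hσ h0 h1 h2⟩
  exact Subgroup.subset_closure ⟨D, mem_dualCircles hσ h0 h1 h2, rfl⟩

/-- A property of one sextuple that is inherited under relabelling and under reflection in the dual
circle of the first face holds for all sextuples. -/
theorem IsSextuple.induction {P : (Fin 6 → OrientedCircle) → Prop}
    (hcomp : ∀ S σ, A.IsSextuple S → IsOctAut σ → P S → P (S ∘ σ))
    (hstep : ∀ S S', A.IsSextuple S → A.IsSextuple S' → OctStep S S' → P S → P S')
    {S₀ : Fin 6 → OrientedCircle} (h₀ : A.IsSextuple S₀) (hP : P S₀)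
    {S : Fin 6 → OrientedCircle} (h : A.IsSextuple S) : P S := by
  obtain ⟨g₀, hg₀, σ₀, hσ₀, e₀⟩ := h₀
  obtain ⟨g, hg, σ, hσ, e⟩ := h
  have sext {g : Equiv.Perm OrientedCircle} (hg : g ∈ A.apollonianGroup) :
      A.IsSextuple fun i => g (A.circle i) := ⟨g, hg, 1, isOctAut_one, fun _ => rfl⟩
  have start : P fun i => g₀ (A.circle i) := by
    have := hcomp S₀ σ₀⁻¹ ⟨g₀, hg₀, σ₀, hσ₀, e₀⟩ (IsOctAut.inv hσ₀) hP
    convert this using 2 with i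
    simp [e₀]
  have refl (k : Equiv.Perm OrientedCircle) (hk : k ∈ A.apollonianGroup) (D : OrientedCircle)
      (hD : D ∈ A.dualCircles) (hPk : P fun i => k (A.circle i)) :
      P fun i => k (reflection D (A.circle i)) := by
    have hD' := hD
    obtain ⟨i, j, l, hij, hjl, hil, hi, hj, hl⟩ := hD'
    obtain ⟨τ, hτ, rfl, rfl, rfl⟩ := exists_octAut hij hjl hil
    have hkD : k * reflection D ∈ A.apollonianGroup :=
      mul_mem hk (Subgroup.subset_closure ⟨D, hD, rfl⟩)
    have h1 := hcomp _ τ (sext hk) hτ hPk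
    have h2 := hstep _ _ ((sext hk).comp hτ) ((sext hkD).comp hτ)
      (octStep_of_orthogonal hk hτ hi hj hl) h1
    have h3 := hcomp _ τ⁻¹ ((sext hkD).comp hτ) hτ.inv h2
    convert h3 using 2 with i
    simp
  have key (k : Equiv.Perm OrientedCircle) (hk : k ∈ A.apollonianGroup) :
      P fun i => (g₀ * k) (A.circle i) := by
    induction hk using Subgroup.closure_induction_right with
    | one => simpa using start
    | mul_right x hx y hy ih =>
      obtain ⟨D, hD, rfl⟩ := hy
      exact refl (g₀ * x) (mul_mem hg₀ hx) D hD ih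
    | mul_inv_cancel x hx y hy ih =>
      obtain ⟨D, hD, rfl⟩ := hy
      rw [reflection_inv]
      exact refl (g₀ * x) (mul_mem hg₀ hx) D hD ih
  have h1 := key (g₀⁻¹ * g) (mul_mem (inv_mem hg₀) hg)
  rw [mul_inv_cancel_left] at h1
  have h2 := hcomp _ σ (sext hg) hσ h1
  convert h2 using 1
  exact funext e

end OctahedralConfiguration

/-! ### Curvatures of a frame -/

theorem curvature_eq_vec (C : OrientedCircle) : C.curvature = C.vec 1 := rfl

namespace IsOctFrame

variable {S : Fin 6 → OrientedCircle}

theorem curvature_sum (h : IsOctFrame S) (i : Fin 6) :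
    (S i).curvature + (S (Fin.rev i)).curvature = (S 0).curvature + (S 5).curvature :=
  congrFun (h.sum i) 1

/-- The curvature is the inner product with an isotropic vector; expanding this vector in the
orthogonal basis attached to the frame gives the analogue of the Descartes equation. -/
theorem curvature_sq (h : IsOctFrame S) :
    ((S 0).curvature - (S 5).curvature) ^ 2 + ((S 1).curvature - (S 4).curvature) ^ 2 +
      ((S 2).curvature - (S 3).curvature) ^ 2 =
      2 * ((S 0).curvature + (S 5).curvature) ^ 2 := by
  set n : Fin 4 → ℝ := ![-2, 0, 0, 0] with hn
  have hcurv (C : OrientedCircle) : ip C.vec n = C.curvature := by simp [ip, vec, hn]; ring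
  have s1 : (S 1).curvature + (S 4).curvature = (S 0).curvature + (S 5).curvature :=
    h.curvature_sum 1
  have s2 : (S 2).curvature + (S 3).curvature = (S 0).curvature + (S 5).curvature :=
    h.curvature_sum 2
  set v : Fin 4 → ℝ :=
    (((S 0).curvature - (S 5).curvature) / 8) • ((S 0).vec - (S 5).vec) +
    (((S 1).curvature - (S 4).curvature) / 8) • ((S 1).vec - (S 4).vec) +
    (((S 2).curvature - (S 3).curvature) / 8) • ((S 2).vec - (S 3).vec) -
    (((S 0).curvature + (S 5).curvature) / 4) • ((S 0).vec + (S 5).vec) with hv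
  have e : n - v = 0 := by
    apply h.eq_zero
    all_goals
      rw [ip_sub_right, hcurv, hv]
      simp [ip_add_right, ip_sub_right, ip_smul_right, ip_vec, h.inner_eq, Fin.ext_iff]
      linarith
  have h0 : ip v n = 0 := by
    rw [← sub_eq_zero.1 e]; simp [ip, hn]
  rw [hv] at h0
  simp only [ip_add_left, ip_sub_left, ip_smul_left, hcurv] at h0
  linarith

end IsOctFrame

/-- The relations between the curvatures of a sextuple. -/
structure OctCurvatures (s : Fin 6 → ℤ) : Prop where
  sum₁ : s 1 + s 4 = s 0 + s 5
  sum₂ : s 2 + s 3 = s 0 + s 5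
  sq : (s 0 - s 5) ^ 2 + (s 1 - s 4) ^ 2 + (s 2 - s 3) ^ 2 = 2 * (s 0 + s 5) ^ 2

theorem IsOctFrame.octCurvatures {S : Fin 6 → OrientedCircle} (h : IsOctFrame S) {s : Fin 6 → ℤ}
    (hs : ∀ i, (S i).curvature = s i) : OctCurvatures s := by
  have h1 := h.curvature_sum 1
  have h2 := h.curvature_sum 2
  have h3 := h.curvature_sq
  simp only [hs] at h1 h2 h3
  exact ⟨by exact_mod_cast h1, by exact_mod_cast h2, by exact_mod_cast h3⟩

/-- The change of the curvatures under a step. -/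
theorem OctStep.curvature {S S' : Fin 6 → OrientedCircle} (h : OctStep S S') {s s' : Fin 6 → ℤ}
    (hs : ∀ i, (S i).curvature = s i) (hs' : ∀ i, (S' i).curvature = s' i) (i : Fin 6) :
    s' i = s i + (if i = 0 ∨ i = 1 ∨ i = 2 then 0 else 2) *
      (2 * (s 0 + s 1 + s 2) - (s 0 + s 5)) := by
  have h1 := congrFun (h i) 1
  have hn : IsOctFrame.normal S 1 = 2 * (s 0 + s 1 + s 2) - (s 0 + s 5) := by
    simp only [IsOctFrame.normal, Pi.sub_apply, Pi.smul_apply, Pi.add_apply, ← curvature_eq_vec,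
      hs, smul_eq_mul]
  simp only [Pi.add_apply, Pi.smul_apply, ← curvature_eq_vec, hs, hs', hn, smul_eq_mul] at h1
  have : (s' i : ℝ) = ((s i + (if i = 0 ∨ i = 1 ∨ i = 2 then 0 else 2) *
      (2 * (s 0 + s 1 + s 2) - (s 0 + s 5)) : ℤ) : ℝ) := by
    rw [h1]; push_cast; rfl
  exact_mod_cast this

namespace OctahedralConfiguration

variable {A : OctahedralConfiguration}

theorem IsSextuple.exists_curvature (hint : A.IsIntegral) {S : Fin 6 → OrientedCircle}
    (h : A.IsSextuple S) : ∃ s : Fin 6 → ℤ, ∀ i, (S i).curvature = s i :=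
  Classical.skolem.1 fun i => hint _ (h.mem_packing i)

end OctahedralConfiguration

/-! ### Residues modulo eight -/

/-- The curvatures modulo `8` of the sextuples of the packings of type `(0, 1, 2)` or
`(2, 4, 7)`. -/
structure OctResidues (s : Fin 6 → ℤ) : Prop where
  res : (∀ i, (s i % 8 = 0 ∨ s i % 8 = 1 ∨ s i % 8 = 2) ∧ (s i + s (Fin.rev i)) % 8 = 2) ∨
    (∀ i, (s i % 8 = 2 ∨ s i % 8 = 4 ∨ s i % 8 = 7) ∧ (s i + s (Fin.rev i)) % 8 = 6)
  odd : ∃ i, s i % 2 = 1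
  adj : ∀ i j, OctAdj i j → s i % 2 = 0 ∨ s j % 2 = 0

theorem OctResidues.comp {s : Fin 6 → ℤ} (h : OctResidues s) {σ : Equiv.Perm (Fin 6)}
    (hσ : IsOctAut σ) : OctResidues (s ∘ σ) where
  res := by
    simp only [Function.comp, hσ.rev]
    exact h.res.imp (fun h i => h (σ i)) fun h i => h (σ i)
  odd := by
    obtain ⟨i, hi⟩ := h.odd
    exact ⟨σ⁻¹ i, by simpa using hi⟩
  adj i j hij := h.adj _ _ ((hσ i j).2 hij)

/-- Each face of a sextuple contains exactly one odd curvature. -/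
theorem OctResidues.face_odd {s : Fin 6 → ℤ} (h : OctResidues s) :
    (s 0 + s 1 + s 2) % 2 = 1 := by
  have a1 := h.adj 0 1 (by decide)
  have a2 := h.adj 0 2 (by decide)
  have a3 := h.adj 1 2 (by decide)
  have r3 : Fin.rev (3 : Fin 6) = 2 := rfl
  have r4 : Fin.rev (4 : Fin 6) = 1 := rfl
  have r5 : Fin.rev (5 : Fin 6) = 0 := rfl
  have key (i : Fin 6) : (s i + s (Fin.rev i)) % 2 = 0 := by
    rcases h.res with h | h <;> have := (h i).2 <;> omega
  obtain ⟨i, hi⟩ := h.odd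
  have k3 := key 3
  have k4 := key 4
  have k5 := key 5
  rw [r3] at k3
  rw [r4] at k4
  rw [r5] at k5
  fin_cases i <;> simp only [Fin.reduceFinMk, Fin.zero_eta, Fin.mk_one] at hi <;> omega

theorem OctResidues.congr {s s' : Fin 6 → ℤ} (h : OctResidues s) (hs : ∀ i, s' i % 8 = s i % 8) :
    OctResidues s' where
  res := by
    refine h.res.imp (fun h i => ?_) fun h i => ?_
    all_goals
      have := h i
      have := hs i
      have := hs (Fin.rev i)
      omega
  odd := by
    obtain ⟨i, hi⟩ := h.odd
    exact ⟨i, by have := hs i; omega⟩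
  adj i j hij := by
    have := h.adj i j hij
    have := hs i
    have := hs j
    omega

namespace OctahedralConfiguration

variable {A : OctahedralConfiguration}

/-- A reflection changes the curvatures by multiples of `8`: the change is `4 (a + b + c) - 2 m` with
`a + b + c` odd and the sum `m` of opposite curvatures congruent to `2` modulo `4`. -/
theorem octResidues (hint : A.IsIntegral)
    (htype : A.HasType ![1, 0, 2, 0, 2, 1] ∨ A.HasType ![7, 2, 4, 2, 4, 7])
    {S : Fin 6 → OrientedCircle} (h : A.IsSextuple S) {s : Fin 6 → ℤ}
    (hs : ∀ i, (S i).curvature = s i) : OctResidues s := by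
  have start : ∃ S₀, A.IsSextuple S₀ ∧
      ∀ s : Fin 6 → ℤ, (∀ i, (S₀ i).curvature = s i) → OctResidues s := by
    have uniq {S : Fin 6 → OrientedCircle} {s s' : Fin 6 → ℤ} (hs : ∀ i, (S i).curvature = s i)
        (hs' : ∀ i, (S i).curvature = s' i) : s' = s :=
      funext fun i => by exact_mod_cast (hs' i).symm.trans (hs i)
    rcases htype with ⟨S, s, hS, hs, ht⟩ | ⟨S, s, hS, hs, ht⟩
    · refine ⟨S, hS, fun s' hs' => ?_⟩
      rw [uniq hs hs']
      have ht' (i : Fin 6) : s i % 8 = (![1, 0, 2, 0, 2, 1] : Fin 6 → ℤ) i := by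
        have hi : (s i : ZMod 8) = (((![1, 0, 2, 0, 2, 1] : Fin 6 → ℤ) i : ℤ) : ZMod 8) := by
          rw [ht i]; fin_cases i <;> rfl
        rw [ZMod.intCast_eq_intCast_iff'] at hi
        refine hi.trans ?_
        fin_cases i <;> rfl
      refine OctResidues.congr (s := ![1, 0, 2, 0, 2, 1]) ⟨Or.inl (by decide), by decide, by decide⟩
        fun i => (ht' i).trans ?_
      fin_cases i <;> rfl
    · refine ⟨S, hS, fun s' hs' => ?_⟩
      rw [uniq hs hs']
      have ht' (i : Fin 6) : s i % 8 = (![7, 2, 4, 2, 4, 7] : Fin 6 → ℤ) i := by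
        have hi : (s i : ZMod 8) = (((![7, 2, 4, 2, 4, 7] : Fin 6 → ℤ) i : ℤ) : ZMod 8) := by
          rw [ht i]; fin_cases i <;> rfl
        rw [ZMod.intCast_eq_intCast_iff'] at hi
        refine hi.trans ?_
        fin_cases i <;> rfl
      refine OctResidues.congr (s := ![7, 2, 4, 2, 4, 7]) ⟨Or.inr (by decide), by decide, by decide⟩
        fun i => (ht' i).trans ?_
      fin_cases i <;> rfl
  obtain ⟨S₀, h₀, hP⟩ := start
  refine IsSextuple.induction
    (P := fun S => ∀ s : Fin 6 → ℤ, (∀ i, (S i).curvature = s i) → OctResidues s)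
    ?_ ?_ h₀ hP h s hs
  · intro S σ _ hσ hP s hs
    have := (hP (s ∘ σ.symm) fun i => by simpa using hs (σ.symm i)).comp hσ
    convert this using 1
    funext i
    simp
  · intro S S' hS hS' hst hP s' hs'
    obtain ⟨s, hs⟩ := hS.exists_curvature hint
    have hr := hP s hs
    refine hr.congr fun i => ?_
    rw [hst.curvature hs hs' i]
    have h1 := hr.face_odd
    have h2 : (s 0 + s 5) % 4 = 2 := by
      rcases hr.res with h | h <;> have := (h 0).2 <;>
        (rw [show Fin.rev (0 : Fin 6) = 5 from rfl] at this) <;> omega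
    split_ifs <;> omega

/-! ### Primitivity and positivity -/

theorem exists_not_dvd (hint : A.IsIntegral) (hprim : A.IsPrimitive)
    {S : Fin 6 → OrientedCircle} (h : A.IsSextuple S) {s : Fin 6 → ℤ}
    (hs : ∀ i, (S i).curvature = s i) {p : ℤ} (hp : ¬IsUnit p) : ∃ i, ¬p ∣ s i := by
  by_contra! hcon
  refine hp (hprim p ?_)
  rintro k ⟨C, hC, hk⟩
  obtain ⟨T, hT, rfl⟩ := exists_isSextuple hC
  obtain ⟨t, ht⟩ := hT.exists_curvature hint
  suffices H : ∀ t : Fin 6 → ℤ, (∀ i, (T i).curvature = t i) → ∀ i, p ∣ t i by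
    have h0 : (k : ℝ) = t 0 := hk.symm.trans (ht 0)
    have h0' : k = t 0 := by exact_mod_cast h0
    exact h0' ▸ H t ht 0
  refine IsSextuple.induction
    (P := fun T => ∀ t : Fin 6 → ℤ, (∀ i, (T i).curvature = t i) → ∀ i, p ∣ t i) ?_ ?_ h ?_ hT
  · intro S σ _ hσ hP s hs i
    have := hP (s ∘ σ.symm) (fun i => by simpa using hs (σ.symm i)) (σ i)
    simpa using this
  · intro S S' hS hS' hst hP s' hs' i
    obtain ⟨s, hs⟩ := hS.exists_curvature hint
    have hr := hP s hs
    rw [hst.curvature hs hs' i]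
    exact (hr i).add (Dvd.dvd.mul_left (((((hr 0).add (hr 1)).add (hr 2)).mul_left 2).sub
      ((hr 0).add (hr 5))) _)
  · intro t ht i
    have : (t i : ℝ) = s i := (ht i).symm.trans (hs i)
    have : t i = s i := by exact_mod_cast this
    exact this ▸ hcon i

/-- The interior of a circle of negative curvature contains all large real numbers. -/
theorem _root_.OrientedCircle.exists_mem_interior {C : OrientedCircle} (hC : C.curvature < 0) :
    ∃ R : ℝ, ∀ x : ℝ, R ≤ x → (x : ℂ) ∈ C.interior := by
  refine ⟨1 + (2 * |C.h₁| + |C.cocurvature|) / (-C.curvature), fun x hx => ?_⟩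
  simp only [OrientedCircle.interior, Set.mem_ofPred_eq, Complex.ofReal_re, Complex.ofReal_im]
  have hk : 0 < -C.curvature := by linarith
  have h1 : 1 ≤ x := le_trans (by
    have : 0 ≤ (2 * |C.h₁| + |C.cocurvature|) / (-C.curvature) := by positivity
    linarith) hx
  have h2 : (2 * |C.h₁| + |C.cocurvature|) < -C.curvature * x := by
    rw [← div_lt_iff₀' hk]; linarith
  have h3 := neg_abs_le C.h₁
  have h4 := le_abs_self C.cocurvature
  have h5 : |C.cocurvature| ≤ |C.cocurvature| * x := le_mul_of_one_le_right (abs_nonneg _) h1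
  have h6 : -C.h₁ * x ≤ |C.h₁| * x := mul_le_mul_of_nonneg_right (by linarith) (by linarith)
  nlinarith

theorem curvature_sum_base_nonneg :
    0 ≤ (A.circle 0).curvature + (A.circle 5).curvature := by
  by_contra! hneg
  have hF := A.isOctFrame
  have hsq := hF.curvature_sq
  -- One of the three opposite pairs consists of two circles of negative curvature.
  obtain ⟨i, hi, hi'⟩ : ∃ i, (A.circle i).curvature < 0 ∧
      (A.circle (Fin.rev i)).curvature < 0 := by
    have aux {x y M : ℝ} (hM : M < 0) (hxy : x + y = M) (h : (x - y) ^ 2 < M ^ 2) :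
        x < 0 ∧ y < 0 := by
      have := abs_lt_of_sq_lt_sq' (a := x - y) (b := -M) (by rw [neg_sq]; exact h) (by linarith)
      constructor <;> linarith [this.1, this.2]
    set M := (A.circle 0).curvature + (A.circle 5).curvature with hM
    have hM2 : 0 < M ^ 2 := sq_pos_of_neg hneg
    by_cases h0 : ((A.circle 0).curvature - (A.circle 5).curvature) ^ 2 < M ^ 2
    · exact ⟨0, aux hneg (hF.curvature_sum 0) h0⟩
    by_cases h1 : ((A.circle 1).curvature - (A.circle 4).curvature) ^ 2 < M ^ 2
    · exact ⟨1, aux hneg (hF.curvature_sum 1) h1⟩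
    by_cases h2 : ((A.circle 2).curvature - (A.circle 3).curvature) ^ 2 < M ^ 2
    · exact ⟨2, aux hneg (hF.curvature_sum 2) h2⟩
    · exfalso; linarith
  obtain ⟨R, hR⟩ := exists_mem_interior hi
  obtain ⟨R', hR'⟩ := exists_mem_interior hi'
  refine Set.disjoint_left.1 (A.interiors i (Fin.rev i)
    ((by decide : ∀ i : Fin 6, i ≠ Fin.rev i) i))
    (hR _ (le_max_left R R')) (hR' _ (le_max_right R R'))

/-- Opposite circles of a sextuple have a positive sum of curvatures. -/
theorem curvature_sum_pos (hint : A.IsIntegral)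
    (htype : A.HasType ![1, 0, 2, 0, 2, 1] ∨ A.HasType ![7, 2, 4, 2, 4, 7])
    {S : Fin 6 → OrientedCircle} (h : A.IsSextuple S) {s : Fin 6 → ℤ}
    (hs : ∀ i, (S i).curvature = s i) : 0 < s 0 + s 5 := by
  suffices H : 0 < (S 0).curvature + (S 5).curvature by
    rw [hs, hs] at H; exact_mod_cast H
  refine IsSextuple.induction (P := fun S => 0 < (S 0).curvature + (S 5).curvature) ?_ ?_
    isSextuple_base ?_ h
  · intro S σ hS hσ hP
    have h5 : σ 5 = Fin.rev (σ 0) := hσ.rev 0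
    simpa only [Function.comp, h5, hS.isOctFrame.curvature_sum] using hP
  · intro S S' hS hS' hst hP
    have h0 : S' 0 = S 0 := hst.eq_of_mem (by simp)
    have h5 := congrFun (hst.vec_of_notMem (i := 5) (by decide)) 1
    simp only [IsOctFrame.normal, Pi.sub_apply, Pi.smul_apply, Pi.add_apply, ← curvature_eq_vec,
      smul_eq_mul] at h5
    have hsq := hS.isOctFrame.curvature_sq
    have s1 : (S 1).curvature + (S 4).curvature = (S 0).curvature + (S 5).curvature :=
      hS.isOctFrame.curvature_sum 1
    have s2 : (S 2).curvature + (S 3).curvature = (S 0).curvature + (S 5).curvature :=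
      hS.isOctFrame.curvature_sum 2
    rw [h0, h5]
    -- With `x, y, z` the differences of opposite curvatures and `m` the sum, the new sum is
    -- `5 m + 2 (x + y + z)`, and `(x + y + z) ^ 2 ≤ 3 (x ^ 2 + y ^ 2 + z ^ 2) = 6 m ^ 2`.
    have aux {x y z m : ℝ} (hm : 0 < m) (h : x ^ 2 + y ^ 2 + z ^ 2 = 2 * m ^ 2) :
        0 < 5 * m + 2 * (x + y + z) := by
      by_contra! hcon
      nlinarith [sq_nonneg (x - y), sq_nonneg (y - z), sq_nonneg (x - z)]
    have := aux hP hsq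
    linarith
  · refine lt_of_le_of_ne curvature_sum_base_nonneg fun h0 => ?_
    have hF := A.isOctFrame
    have hsq := hF.curvature_sq
    obtain ⟨s, hs⟩ := (isSextuple_base (A := A)).exists_curvature hint
    obtain ⟨i, hi⟩ := (octResidues hint htype isSextuple_base hs).odd
    rw [← h0] at hsq
    have e0 : (A.circle 0).curvature - (A.circle 5).curvature = 0 := by
      apply pow_eq_zero_iff (n := 2) (by norm_num) |>.1; nlinarith
    have e1 : (A.circle 1).curvature - (A.circle 4).curvature = 0 := by
      apply pow_eq_zero_iff (n := 2) (by norm_num) |>.1; nlinarith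
    have e2 : (A.circle 2).curvature - (A.circle 3).curvature = 0 := by
      apply pow_eq_zero_iff (n := 2) (by norm_num) |>.1; nlinarith
    have s1 : (A.circle 1).curvature + (A.circle 4).curvature = _ := hF.curvature_sum 1
    have s2 : (A.circle 2).curvature + (A.circle 3).curvature = _ := hF.curvature_sum 2
    have hz : (A.circle i).curvature = 0 := by
      fin_cases i <;> simp only [Fin.reduceFinMk, Fin.zero_eta, Fin.mk_one] <;> linarith
    rw [hs] at hz
    have : s i = 0 := by exact_mod_cast hz
    omega

end OctahedralConfiguration

/-! ### The quadratic forms of a sextuple -/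

/-- The integral binary quadratic form `A x² + 2 B x y + 2 C y²`. The form `Q_α` of a sextuple is of
this shape with `A = a + c`, `C = a + b` and `B ^ 2 + 2 * a ^ 2 = 2 * A * C`. -/
def octForm (A B C x y : ℤ) : ℤ := A * x ^ 2 + 2 * B * x * y + 2 * C * y ^ 2

/-- The middle coefficient of `Q_α` is even, and the discriminant of `Q_α` is `-8 a²`. -/
theorem OctCurvatures.exists_middle {s : Fin 6 → ℤ} (h : OctCurvatures s) :
    ∃ B, 2 * B = -2 * s 0 - 2 * s 1 - s 2 + s 3 ∧
      B ^ 2 + 2 * s 0 ^ 2 = 2 * (s 0 + s 2) * (s 0 + s 1) := by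
  have h1 := h.sum₁
  have h2 := h.sum₂
  have h3 := h.sq
  have h4 : s 4 = s 2 + s 3 - s 1 := by linarith
  have h5 : s 5 = s 2 + s 3 - s 0 := by linarith
  rw [h4, h5] at h3
  have he : Even (s 3 - s 2) := by
    rw [← Int.even_pow' (n := 2) (by norm_num)]
    refine ⟨2 * (s 0 * (s 2 + s 3) + s 1 * (s 2 + s 3) - s 0 ^ 2 - s 1 ^ 2), ?_⟩
    linear_combination h3
  obtain ⟨k, hk⟩ := he
  refine ⟨k - s 0 - s 1, by linarith, ?_⟩
  have hk' : s 3 = s 2 + 2 * k := by linarith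
  rw [hk'] at h3
  have h6 : 4 * ((k - s 0 - s 1) ^ 2 + 2 * s 0 ^ 2) = 4 * (2 * (s 0 + s 2) * (s 0 + s 1)) := by
    linear_combination h3
  linarith

theorem octRepresents_iff {s : Fin 6 → ℤ} {B : ℤ}
    (hB : 2 * B = -2 * s 0 - 2 * s 1 - s 2 + s 3) (ρ : ℤ) :
    OctRepresents s ρ ↔ ∃ x y : ℤ, IsCoprime x y ∧
      ((Odd x ∧ ρ = octForm (s 0 + s 2) B (s 0 + s 1) x y) ∨
        (Even x ∧ 2 * ρ = octForm (s 0 + s 2) B (s 0 + s 1) x y)) := by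
  have hα (x y : ℤ) : octQα s x y = octForm (s 0 + s 2) B (s 0 + s 1) x y := by
    have hB' : (2 * B : ℚ) = -2 * s 0 - 2 * s 1 - s 2 + s 3 := by exact_mod_cast hB
    simp only [octQα, octForm]
    push_cast
    rw [← hB']
  have hβ (x y : ℤ) : 2 * octQβ s x y = octForm (s 0 + s 2) B (s 0 + s 1) x y := by
    rw [← hα]; simp only [octQα, octQβ]; ring
  have e1 (x y : ℤ) : (ρ : ℚ) = octQα s x y ↔ ρ = octForm (s 0 + s 2) B (s 0 + s 1) x y := by
    rw [hα]; norm_cast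
  have e2 (x y : ℤ) : (ρ : ℚ) = octQβ s x y ↔ 2 * ρ = octForm (s 0 + s 2) B (s 0 + s 1) x y := by
    rw [← mul_right_inj' (two_ne_zero (α := ℚ)), hβ]; norm_cast
  simp only [OctRepresents, e1, e2, ← Int.isCoprime_iff_gcd_eq_one]
  constructor
  · rintro ⟨x, y, -, h⟩
    exact ⟨x, y, h⟩
  · rintro ⟨x, y, h, h'⟩
    rcases le_total 0 y with hy | hy
    · exact ⟨x, y, hy, h, h'⟩
    · refine ⟨-x, -y, by omega, h.neg_neg, ?_⟩
      have : octForm (s 0 + s 2) B (s 0 + s 1) (-x) (-y) =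
        octForm (s 0 + s 2) B (s 0 + s 1) x y := by simp only [octForm]; ring
      rwa [this, odd_neg, even_neg]

/-- Composition of the form with itself: the product of two values is of the form `X² + 2 a² Y²`. -/
theorem octForm_mul {a A B C : ℤ} (h : B ^ 2 + 2 * a ^ 2 = 2 * A * C) (x y z w : ℤ) :
    octForm A B C x y * octForm A B C z w =
      (A * x * z + B * (x * w + y * z) + 2 * C * y * w) ^ 2 + 2 * a ^ 2 * (x * w - y * z) ^ 2 := by
  simp only [octForm]
  linear_combination (-(x * w - y * z) ^ 2) * h

theorem OctCurvatures.add_nonneg {s : Fin 6 → ℤ} (h : OctCurvatures s) (hm : 0 < s 0 + s 5) :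
    0 ≤ s 0 + s 1 ∧ 0 ≤ s 0 + s 2 := by
  have h1 := h.sum₁
  have h2 := h.sum₂
  have h3 := h.sq
  constructor
  · by_contra! hc
    nlinarith [sq_nonneg (s 0 - s 5 - (s 1 - s 4)), sq_nonneg (s 2 - s 3)]
  · by_contra! hc
    nlinarith [sq_nonneg (s 0 - s 5 - (s 2 - s 3)), sq_nonneg (s 1 - s 4)]

theorem OctCurvatures.form_coeff_pos {s : Fin 6 → ℤ} (h : OctCurvatures s) (hm : 0 < s 0 + s 5)
    (h0 : s 0 ≠ 0) : 0 < s 0 + s 1 ∧ 0 < s 0 + s 2 := by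
  obtain ⟨B, -, hB⟩ := h.exists_middle
  obtain ⟨n1, n2⟩ := h.add_nonneg hm
  have hp : 0 < (s 0 + s 2) * (s 0 + s 1) := by
    have : 0 < s 0 ^ 2 := by positivity
    nlinarith [sq_nonneg B]
  constructor
  · exact lt_of_le_of_ne n1 fun h => by rw [← h] at hp; simp at hp
  · exact lt_of_le_of_ne n2 fun h => by rw [← h] at hp; simp at hp

theorem octForm_pos {a A B C : ℤ} (h : B ^ 2 + 2 * a ^ 2 = 2 * A * C) (ha : a ≠ 0) (hA : 0 < A)
    {x y : ℤ} (hxy : IsCoprime x y) : 0 < octForm A B C x y := by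
  have h1 : A * octForm A B C x y = (A * x + B * y) ^ 2 + 2 * a ^ 2 * y ^ 2 := by
    simp only [octForm]; linear_combination (-y ^ 2) * h
  refine pos_of_mul_pos_left (b := A) ?_ hA.le
  rw [mul_comm, h1]
  by_cases hy : y = 0
  · subst hy
    have hx : x ≠ 0 := by rintro rfl; exact not_isCoprime_zero_zero hxy
    have : 0 < (A * x) ^ 2 := by positivity
    simpa using this
  · positivity

/-! ### The lattice of a packing -/

/-- The lattice spanned by the circles of a sextuple. -/
def octLattice (S : Fin 6 → OrientedCircle) : AddSubgroup (Fin 4 → ℝ) :=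
  AddSubgroup.closure (Set.range fun i => (S i).vec)

theorem vec_mem_octLattice (S : Fin 6 → OrientedCircle) (i : Fin 6) :
    (S i).vec ∈ octLattice S := AddSubgroup.subset_closure ⟨i, rfl⟩

theorem normal_mem_octLattice (S : Fin 6 → OrientedCircle) :
    IsOctFrame.normal S ∈ octLattice S := by
  have h := vec_mem_octLattice S
  refine sub_mem ?_ (add_mem (h 0) (h 5))
  rw [two_smul]
  have := add_mem (add_mem (h 0) (h 1)) (h 2)
  exact add_mem this this

theorem octLattice_le_of_step {S S' : Fin 6 → OrientedCircle} (h : OctStep S S') :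
    octLattice S' ≤ octLattice S := by
  refine (AddSubgroup.closure_le _).2 ?_
  rintro _ ⟨i, rfl⟩
  change (S' i).vec ∈ octLattice S
  have := normal_mem_octLattice S
  rw [h i]
  refine add_mem (vec_mem_octLattice S i) ?_
  split_ifs
  · rw [zero_smul]; exact zero_mem _
  · rw [two_smul]; exact add_mem this this

theorem OctStep.symm {S S' : Fin 6 → OrientedCircle} (h : OctStep S S') : OctStep S' S := by
  have hn : IsOctFrame.normal S' = -IsOctFrame.normal S := by
    have h5 := h.vec_of_notMem (i := 5) (by decide)
    rw [IsOctFrame.normal, h.eq_of_mem (i := 0) (by simp), h.eq_of_mem (i := 1) (by simp),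
      h.eq_of_mem (i := 2) (by simp), h5]
    simp only [IsOctFrame.normal]
    module
  intro i
  rw [hn, h i]
  module

theorem OctahedralConfiguration.octLattice_eq {A : OctahedralConfiguration}
    {S S' : Fin 6 → OrientedCircle} (h : A.IsSextuple S) (h' : A.IsSextuple S') :
    octLattice S' = octLattice S := by
  refine IsSextuple.induction (P := fun T => octLattice T = octLattice S) ?_ ?_ h rfl h'
  · intro T σ _ _ hT
    rw [← hT, octLattice, octLattice]
    exact congrArg _ (σ.surjective.range_comp fun i => (T i).vec)
  · intro T T' _ _ hst hT
    rw [← hT]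
    exact le_antisymm (octLattice_le_of_step hst) (octLattice_le_of_step hst.symm)

namespace IsOctFrame

variable {S : Fin 6 → OrientedCircle}

/-- The lattice vector with coordinates `x` with respect to the first circle `v` and the isotropic
vectors `v + w` orthogonal to it, where `w` are the next three circles. -/
noncomputable def latticeVec (S : Fin 6 → OrientedCircle) (x₀ x₁ x₂ x₃ : ℝ) : Fin 4 → ℝ :=
  x₀ • (S 0).vec + x₁ • ((S 0).vec + (S 1).vec) + x₂ • ((S 0).vec + (S 2).vec) +
    x₃ • ((S 0).vec + (S 3).vec)

theorem latticeVec_mem (S : Fin 6 → OrientedCircle) (x₀ x₁ x₂ x₃ : ℤ) :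
    latticeVec S x₀ x₁ x₂ x₃ ∈ octLattice S := by
  have h := vec_mem_octLattice S
  have hz (x : ℤ) {v : Fin 4 → ℝ} (hv : v ∈ octLattice S) : (x : ℝ) • v ∈ octLattice S := by
    rw [Int.cast_smul_eq_zsmul]; exact zsmul_mem hv x
  exact add_mem (add_mem (add_mem (hz _ (h 0)) (hz _ (add_mem (h 0) (h 1))))
    (hz _ (add_mem (h 0) (h 2)))) (hz _ (add_mem (h 0) (h 3)))

theorem exists_latticeVec (h : IsOctFrame S) {u : Fin 4 → ℝ} (hu : u ∈ octLattice S) :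
    ∃ x₀ x₁ x₂ x₃ : ℤ, u = latticeVec S x₀ x₁ x₂ x₃ := by
  induction hu using AddSubgroup.closure_induction with
  | mem u hu =>
    have h5 : (S 5).vec = (S 2).vec + (S 3).vec - (S 0).vec := by rw [h.vec3]; abel
    have h4 : (S 4).vec = (S 2).vec + (S 3).vec - (S 1).vec := by rw [h.vec4, h5]; abel
    obtain ⟨i, rfl⟩ := hu
    fin_cases i
    · exact ⟨1, 0, 0, 0, by simp [latticeVec]⟩
    · exact ⟨-1, 1, 0, 0, by simp [latticeVec]⟩
    · exact ⟨-1, 0, 1, 0, by simp [latticeVec]⟩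
    · exact ⟨-1, 0, 0, 1, by simp [latticeVec]⟩
    · exact ⟨-1, -1, 1, 1, by simp [latticeVec, h4]; module⟩
    · exact ⟨-3, 0, 1, 1, by simp [latticeVec, h5]; module⟩
  | zero => exact ⟨0, 0, 0, 0, by simp [latticeVec]⟩
  | add u v _ _ hu hv =>
    obtain ⟨x₀, x₁, x₂, x₃, rfl⟩ := hu
    obtain ⟨y₀, y₁, y₂, y₃, rfl⟩ := hv
    exact ⟨x₀ + y₀, x₁ + y₁, x₂ + y₂, x₃ + y₃, by simp only [latticeVec]; push_cast; module⟩
  | neg u _ hu =>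
    obtain ⟨x₀, x₁, x₂, x₃, rfl⟩ := hu
    exact ⟨-x₀, -x₁, -x₂, -x₃, by simp only [latticeVec]; push_cast; module⟩

theorem ip_latticeVec (h : IsOctFrame S) (x₀ x₁ x₂ x₃ y₀ y₁ y₂ y₃ : ℝ) :
    ip (latticeVec S x₀ x₁ x₂ x₃) (latticeVec S y₀ y₁ y₂ y₃) = x₀ * y₀ -
      2 * (x₁ * y₂ + x₂ * y₁ + x₁ * y₃ + x₃ * y₁ + 2 * x₂ * y₃ + 2 * x₃ * y₂) := by
  simp only [latticeVec, ip_add_left, ip_add_right, ip_smul_left, ip_smul_right, ip_vec, h.inner_eq]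
  norm_num [Fin.ext_iff]
  ring

theorem latticeVec_one (S : Fin 6 → OrientedCircle) : latticeVec S 1 0 0 0 = (S 0).vec := by
  simp [latticeVec]

theorem latticeVec_inj (h : IsOctFrame S) {x₀ x₁ x₂ x₃ y₀ y₁ y₂ y₃ : ℝ}
    (e : latticeVec S x₀ x₁ x₂ x₃ = latticeVec S y₀ y₁ y₂ y₃) :
    x₁ = y₁ ∧ x₂ = y₂ ∧ x₃ = y₃ := by
  have key (z₁ z₂ z₃ : ℝ) := congrArg (ip (latticeVec S 0 z₁ z₂ z₃)) e
  simp only [h.ip_latticeVec] at key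
  have k1 := key 1 0 0
  have k2 := key 0 1 0
  have k3 := key 0 0 1
  refine ⟨?_, ?_, ?_⟩ <;> linarith

theorem latticeVec_curvature {s : Fin 6 → ℤ} (hs : ∀ i, (S i).curvature = s i)
    (x₀ x₁ x₂ x₃ : ℝ) : latticeVec S x₀ x₁ x₂ x₃ 1 =
      x₀ * s 0 + x₁ * (s 0 + s 1) + x₂ * (s 0 + s 2) + x₃ * (s 0 + s 3) := by
  simp only [latticeVec, Pi.add_apply, Pi.smul_apply, ← curvature_eq_vec, hs, smul_eq_mul]

end IsOctFrame

theorem Int.Prime.dvd_of_sq_dvd_two_mul_sq {p x : ℤ} (hp : Prime p) (h : p ^ 2 ∣ 2 * x ^ 2) :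
    p ∣ x := by
  by_contra hx
  have h1 : IsCoprime (p ^ 2) (x ^ 2) := ((Prime.coprime_iff_not_dvd hp).2 hx).pow
  have h2 : p ^ 2 ∣ 2 := h1.dvd_of_dvd_mul_right h
  have h3 := Int.le_of_dvd (by norm_num) h2
  have h4 : p ≠ 0 := hp.ne_zero
  have h5 : ¬IsUnit p := hp.not_isUnit
  rw [Int.isUnit_iff] at h5
  have : p ≤ -2 ∨ 2 ≤ p := by omega
  rcases this with h | h <;> nlinarith

/-- Coprime integers whose product is a square are, up to a common sign, squares. -/
theorem Int.exists_sq_of_coprime_mul {P R t : ℤ} (h : IsCoprime P R) (e : P * R = t ^ 2) :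
    ∃ ε x y : ℤ, (ε = 1 ∨ ε = -1) ∧ P = ε * x ^ 2 ∧ R = ε * y ^ 2 ∧ t = ε * (x * y) := by
  obtain ⟨x, hx⟩ := Int.sq_of_isCoprime h e
  obtain ⟨y, hy⟩ := Int.sq_of_isCoprime h.symm ((mul_comm _ _).trans e)
  have key : ∃ ε : ℤ, (ε = 1 ∨ ε = -1) ∧ P = ε * x ^ 2 ∧ R = ε * y ^ 2 := by
    rcases hx with hx | hx <;> rcases hy with hy | hy
    · exact ⟨1, by simp, by linarith, by linarith⟩
    · have h0 : (x * y) ^ 2 = 0 := by nlinarith [sq_nonneg t, sq_nonneg (x * y)]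
      rcases mul_eq_zero.1 (pow_eq_zero_iff (n := 2) (by norm_num) |>.1 h0) with h | h
      · exact ⟨-1, by simp, by simp [hx, h], by linarith⟩
      · exact ⟨1, by simp, by linarith, by simp [hy, h]⟩
    · have h0 : (x * y) ^ 2 = 0 := by nlinarith [sq_nonneg t, sq_nonneg (x * y)]
      rcases mul_eq_zero.1 (pow_eq_zero_iff (n := 2) (by norm_num) |>.1 h0) with h | h
      · exact ⟨1, by simp, by simp [hx, h], by linarith⟩
      · exact ⟨-1, by simp, by linarith, by simp [hy, h]⟩
    · exact ⟨-1, by simp, by linarith, by linarith⟩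
  obtain ⟨ε, hε, hP, hR⟩ := key
  have hε2 : ε ^ 2 = 1 := by rcases hε with rfl | rfl <;> norm_num
  have ht : t ^ 2 = (ε * (x * y)) ^ 2 := by
    rw [← e, hP, hR]; ring
  rcases sq_eq_sq_iff_eq_or_eq_neg.1 ht with h' | h'
  · exact ⟨ε, x, y, hε, hP, hR, h'⟩
  · exact ⟨ε, -x, y, hε, by rw [hP]; ring, hR, by rw [h']; ring⟩

/-- The represented numbers in terms of the lattice and the first circle alone: they are the
positive curvatures of the primitive isotropic lattice vectors orthogonal to this circle. -/
theorem octRepresents_iff_lattice {S : Fin 6 → OrientedCircle} (h : IsOctFrame S) {s : Fin 6 → ℤ}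
    (hs : ∀ i, (S i).curvature = s i) (hm : 0 < s 0 + s 5) (h0 : s 0 ≠ 0) (ρ : ℤ) :
    OctRepresents s ρ ↔ 0 < ρ ∧ ∃ u ∈ octLattice S, ip (S 0).vec u = 0 ∧ ip u u = 0 ∧ u 1 = ρ ∧
      ∀ q : ℤ, ∀ w ∈ octLattice S, u = (q : ℝ) • w → IsUnit q := by
  have hc := h.octCurvatures hs
  obtain ⟨B, hB, hdisc⟩ := hc.exists_middle
  obtain ⟨hC, hA⟩ := hc.form_coeff_pos hm h0
  rw [octRepresents_iff hB]
  have hpos {x y : ℤ} (hxy : IsCoprime x y) := octForm_pos hdisc h0 hA hxy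
  -- The isotropic vectors are cut out by a conic, which has the following two parametrizations.
  have conv (x₁ x₂ x₃ : ℤ) (hi : (x₂ + x₃) * (x₁ + 2 * x₃) = 2 * x₃ ^ 2)
      (hu : ∀ q : ℤ, q ∣ x₂ + x₃ → q ∣ x₁ + 2 * x₃ → q ∣ x₃ → IsUnit q)
      (hρ : ρ = x₁ * (s 0 + s 1) + x₂ * (s 0 + s 2) + x₃ * (s 0 + s 3)) :
      ∃ u ∈ octLattice S, ip (S 0).vec u = 0 ∧ ip u u = 0 ∧ u 1 = ρ ∧
        ∀ q : ℤ, ∀ w ∈ octLattice S, u = (q : ℝ) • w → IsUnit q := by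
    refine ⟨_, IsOctFrame.latticeVec_mem S 0 x₁ x₂ x₃, ?_, ?_, ?_, ?_⟩
    · rw [← IsOctFrame.latticeVec_one, h.ip_latticeVec]; push_cast; ring
    · have hi' : ((x₂ + x₃) * (x₁ + 2 * x₃) : ℝ) = 2 * x₃ ^ 2 := by exact_mod_cast hi
      rw [h.ip_latticeVec]; push_cast; linear_combination (-4) * hi'
    · rw [IsOctFrame.latticeVec_curvature hs, hρ]; push_cast; ring
    · intro q w hw e
      obtain ⟨y₀, y₁, y₂, y₃, rfl⟩ := h.exists_latticeVec hw
      have e' : IsOctFrame.latticeVec S (0 : ℤ) x₁ x₂ x₃ =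
          IsOctFrame.latticeVec S (q * y₀) (q * y₁) (q * y₂) (q * y₃) := by
        rw [e]; simp only [IsOctFrame.latticeVec]; module
      obtain ⟨e1, e2, e3⟩ := h.latticeVec_inj e'
      have d1 : q ∣ x₁ := ⟨y₁, by exact_mod_cast e1⟩
      have d2 : q ∣ x₂ := ⟨y₂, by exact_mod_cast e2⟩
      have d3 : q ∣ x₃ := ⟨y₃, by exact_mod_cast e3⟩
      exact hu q (d2.add d3) (d1.add (d3.mul_left 2)) d3
  constructor
  · rintro ⟨x, y, hxy, ⟨hx, hρ⟩ | ⟨⟨z, hz⟩, hρ⟩⟩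
    · refine ⟨hρ ▸ hpos hxy, conv (2 * y ^ 2 - 2 * (x * y)) (x ^ 2 - x * y) (x * y) (by ring) ?_ ?_⟩
      · intro q h1 h2 _
        have h2' : IsCoprime x 2 := Int.isCoprime_two_right.2 hx
        have hco : IsCoprime (x ^ 2) (2 * y ^ 2) := IsCoprime.mul_right h2'.pow_left hxy.pow
        exact hco.isUnit_of_dvd' (by simpa using h1) (by simpa using h2)
      · rw [hρ, octForm]; linear_combination x * y * hB
    · have hz' : x = 2 * z := by omega
      subst hz'
      have h2ρ := hpos hxy
      have hco : IsCoprime (2 * z ^ 2) (y ^ 2) :=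
        IsCoprime.mul_left (IsCoprime.pow_right hxy.of_mul_left_left)
          hxy.of_mul_left_right.pow
      refine ⟨by omega, conv (y ^ 2 - 2 * (z * y)) (2 * z ^ 2 - z * y) (z * y) (by ring) ?_ ?_⟩
      · intro q h1 h2 _
        exact hco.isUnit_of_dvd' (by simpa using h1) (by simpa using h2)
      · have : 2 * ρ = 2 * ((y ^ 2 - 2 * (z * y)) * (s 0 + s 1) +
            (2 * z ^ 2 - z * y) * (s 0 + s 2) + z * y * (s 0 + s 3)) := by
          rw [hρ, octForm]; linear_combination 2 * z * y * hB
        linarith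
  · rintro ⟨hρ, u, hu, hu0, huu, hu1, hprim⟩
    obtain ⟨x₀, x₁, x₂, x₃, rfl⟩ := h.exists_latticeVec hu
    rw [← IsOctFrame.latticeVec_one, h.ip_latticeVec] at hu0
    have hx0 : (x₀ : ℝ) = 0 := by linarith
    rw [h.ip_latticeVec, hx0] at huu
    rw [IsOctFrame.latticeVec_curvature hs, hx0] at hu1
    have hi : (x₂ + x₃) * (x₁ + 2 * x₃) = 2 * x₃ ^ 2 := by
      have : ((x₂ + x₃) * (x₁ + 2 * x₃) : ℝ) = 2 * x₃ ^ 2 := by linarith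
      exact_mod_cast this
    have hρ' : ρ = x₁ * (s 0 + s 1) + x₂ * (s 0 + s 2) + x₃ * (s 0 + s 3) := by
      have : (ρ : ℝ) = x₁ * (s 0 + s 1) + x₂ * (s 0 + s 2) + x₃ * (s 0 + s 3) := by linarith
      exact_mod_cast this
    have hco : IsCoprime (x₂ + x₃) (x₁ + 2 * x₃) := by
      refine isCoprime_of_prime_dvd ?_ ?_
      · rintro ⟨e1, e2⟩
        have e3 : x₃ = 0 := by
          rw [e1] at hi
          exact pow_eq_zero_iff (n := 2) (by norm_num) |>.1 (by linarith)
        have e4 : x₂ = 0 := by omega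
        have e5 : x₁ = 0 := by omega
        subst e3 e4 e5
        rw [hρ'] at hρ
        simp at hρ
      · intro p hp d1 d2
        have d3 : p ∣ x₃ := by
          refine Int.Prime.dvd_of_sq_dvd_two_mul_sq hp ?_
          rw [← hi, sq]
          exact mul_dvd_mul d1 d2
        have d2' : p ∣ x₁ := (dvd_add_left (d3.mul_left 2)).1 d2
        have d1' : p ∣ x₂ := (dvd_add_left d3).1 d1
        obtain ⟨y₁, rfl⟩ := d2'
        obtain ⟨y₂, rfl⟩ := d1'
        obtain ⟨y₃, rfl⟩ := d3
        refine hp.not_isUnit (hprim p _ (IsOctFrame.latticeVec_mem S 0 y₁ y₂ y₃) ?_)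
        rw [hx0]
        simp only [IsOctFrame.latticeVec]
        push_cast
        module
    rcases Int.prime_two.dvd_or_dvd (⟨_, hi⟩ : (2 : ℤ) ∣ (x₂ + x₃) * (x₁ + 2 * x₃)) with
      ⟨P, hP⟩ | ⟨R, hR⟩
    · rw [hP] at hco hi
      obtain ⟨ε, z, y, hε, e1, e2, e3⟩ := Int.exists_sq_of_coprime_mul (t := x₃)
        hco.of_mul_left_right (by linarith)
      have hcop : IsCoprime (2 * z) y := by
        rw [e1, e2] at hco
        have c1 : IsCoprime 2 y := by
          have := hco.of_mul_left_left.of_mul_right_right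
          exact (IsCoprime.pow_right_iff (by norm_num)).1 this
        have c2 : IsCoprime z y :=
          (IsCoprime.pow_iff (by norm_num) (by norm_num)).1
            hco.of_mul_left_right.of_mul_left_right.of_mul_right_right
        exact IsCoprime.mul_left c1 c2
      have hval : 2 * ρ = ε * octForm (s 0 + s 2) B (s 0 + s 1) (2 * z) y := by
        have f1 : x₁ = ε * y ^ 2 - 2 * x₃ := by linarith
        have f2 : x₂ = 2 * (ε * z ^ 2) - x₃ := by linarith
        rw [hρ', f1, f2, e3, octForm]
        linear_combination (-2) * ε * z * y * hB
      refine ⟨2 * z, y, hcop, Or.inr ⟨even_two_mul z, ?_⟩⟩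
      have := hpos hcop
      rcases hε with rfl | rfl
      · linarith
      · exfalso; linarith
    · rw [hR] at hco hi
      obtain ⟨ε, x, y, hε, e1, e2, e3⟩ := Int.exists_sq_of_coprime_mul (t := x₃)
        hco.of_mul_right_right (by linarith)
      rw [e1, e2] at hco
      have hcop : IsCoprime x y :=
        (IsCoprime.pow_iff (by norm_num) (by norm_num)).1
          hco.of_mul_right_right.of_mul_left_right.of_mul_right_right
      have hodd : Odd x := by
        have : IsCoprime x 2 := (IsCoprime.pow_left_iff (by norm_num)).1
          hco.of_mul_right_left.of_mul_left_right
        exact Int.isCoprime_two_right.1 this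
      have hval : ρ = ε * octForm (s 0 + s 2) B (s 0 + s 1) x y := by
        have f1 : x₁ = 2 * (ε * y ^ 2) - 2 * x₃ := by linarith
        have f2 : x₂ = ε * x ^ 2 - x₃ := by linarith
        rw [hρ', f1, f2, e3, octForm]
        linear_combination (-1) * ε * x * y * hB
      refine ⟨x, y, hcop, Or.inl ⟨hodd, ?_⟩⟩
      have := hpos hcop
      rcases hε with rfl | rfl
      · linarith
      · exfalso; linarith

/-- Sextuples of a packing with the same first circle have the same represented numbers. -/
theorem OctahedralConfiguration.octRepresents_congr {A : OctahedralConfiguration}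
    (hint : A.IsIntegral)
    (htype : A.HasType ![1, 0, 2, 0, 2, 1] ∨ A.HasType ![7, 2, 4, 2, 4, 7])
    {S T : Fin 6 → OrientedCircle} (hS : A.IsSextuple S) (hT : A.IsSextuple T) (e : S 0 = T 0)
    {s t : Fin 6 → ℤ} (hs : ∀ i, (S i).curvature = s i) (ht : ∀ i, (T i).curvature = t i)
    (h0 : s 0 ≠ 0) {ρ : ℤ} (hρ : OctRepresents s ρ) : OctRepresents t ρ := by
  have e0 : t 0 = s 0 := by
    have := (ht 0).symm.trans ((congrArg _ e.symm).trans (hs 0))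
    exact_mod_cast this
  rw [octRepresents_iff_lattice hS.isOctFrame hs (curvature_sum_pos hint htype hS hs) h0] at hρ
  rwa [octRepresents_iff_lattice hT.isOctFrame ht (curvature_sum_pos hint htype hT ht) (e0 ▸ h0),
    octLattice_eq hS hT, ← e]

/-! ### Kronecker symbols -/

theorem χ₈_eq_one_or_neg_one {ρ : ℤ} (h : ρ % 2 = 1) :
    ZMod.χ₈ (ρ : ZMod 8) = 1 ∨ ZMod.χ₈ (ρ : ZMod 8) = -1 := by
  rw [ZMod.χ₈_int_eq_if_mod_eight]
  split_ifs <;> simp; omega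

theorem χ₈_eq_of_mul {ρ ρ' : ℤ} (h : (ρ * ρ') % 8 = 1) :
    ZMod.χ₈ (ρ : ZMod 8) = ZMod.χ₈ (ρ' : ZMod 8) := by
  have h1 : ρ % 8 < 8 := Int.emod_lt_of_pos _ (by norm_num)
  have h2 : 0 ≤ ρ % 8 := Int.emod_nonneg _ (by norm_num)
  have h3 : ρ' % 8 < 8 := Int.emod_lt_of_pos _ (by norm_num)
  have h4 : 0 ≤ ρ' % 8 := Int.emod_nonneg _ (by norm_num)
  have key : ρ % 8 = ρ' % 8 := by
    rw [Int.mul_emod] at h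
    generalize ρ % 8 = x at *
    generalize ρ' % 8 = y at *
    interval_cases x <;> interval_cases y <;> omega
  rw [ZMod.χ₈_int_mod_eight ρ, ZMod.χ₈_int_mod_eight ρ', key]

/-- The Kronecker symbol at `2 ^ v * β` with `β` odd. -/
theorem kroneckerSymbol_two_pow_mul (v : ℕ) {β : ℤ} (hβ : β % 2 = 1) (ρ : ℤ) :
    kroneckerSymbol ρ (2 ^ v * β) = (if β < 0 ∧ ρ < 0 then -1 else 1) *
      ZMod.χ₈ (ρ : ZMod 8) ^ v * jacobiSym ρ β.natAbs := by
  have hn : ((2 : ℤ) ^ v * β).natAbs = 2 ^ v * β.natAbs := by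
    rw [Int.natAbs_mul, Int.natAbs_pow]; rfl
  have hodd : ¬2 ∣ β.natAbs := by omega
  have hv : padicValNat 2 (2 ^ v * β.natAbs) = v := by
    rw [padicValNat.mul (by positivity) (by omega), padicValNat.prime_pow,
      padicValNat.eq_zero_of_not_dvd hodd, add_zero]
  have hs : (2 : ℤ) ^ v * β < 0 ↔ β < 0 := by
    constructor
    · intro h; by_contra! h'
      have : (0 : ℤ) ≤ 2 ^ v * β := by positivity
      omega
    · intro h; exact mul_neg_of_pos_of_neg (by positivity) h
  rw [kroneckerSymbol, hn, hv, Nat.mul_div_cancel_left _ (by positivity)]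
  simp only [hs]

theorem kroneckerSymbol_odd {b : ℤ} (hb : b % 2 = 1) (ρ : ℤ) :
    kroneckerSymbol ρ b = (if b < 0 ∧ ρ < 0 then -1 else 1) * jacobiSym ρ b.natAbs := by
  simpa using kroneckerSymbol_two_pow_mul 0 hb ρ

theorem Int.exists_eq_two_pow_mul {b : ℤ} (hb : b ≠ 0) :
    ∃ (v : ℕ) (β : ℤ), β % 2 = 1 ∧ b = 2 ^ v * β := by
  obtain ⟨k, m, hm, h⟩ := Nat.exists_eq_two_pow_mul_odd (Int.natAbs_ne_zero.2 hb)
  have hm' := Nat.odd_iff.1 hm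
  rcases Int.natAbs_eq b with e | e
  · exact ⟨k, m, by omega, by rw [e, h]; push_cast; ring⟩
  · exact ⟨k, -m, by omega, by rw [e, h]; push_cast; ring⟩

theorem Int.isCoprime_iff_natAbs {a b : ℤ} : IsCoprime a b ↔ a.gcd (b.natAbs : ℤ) = 1 := by
  rw [Int.isCoprime_iff_gcd_eq_one, Int.gcd, Int.gcd, Int.natAbs_natCast]

theorem jacobiSym_congr {ρ ρ' : ℤ} {n : ℤ} (h : n ∣ ρ - ρ') :
    jacobiSym ρ n.natAbs = jacobiSym ρ' n.natAbs :=
  jacobiSym.mod_left' (Int.emod_eq_emod_iff_emod_sub_eq_zero.2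
    (Int.emod_eq_zero_of_dvd (Int.natAbs_dvd.2 h)))

theorem eq_of_mul_eq_one_of_sign {x y : ℤ} (hx : x = 1 ∨ x = -1) (h : x * y = 1) : x = y := by
  rcases hx with rfl | rfl <;> omega

/-- Two integers whose product is a square modulo `n` have the same Jacobi symbol. -/
theorem jacobiSym_eq_of_mul {ρ ρ' X n : ℤ} (h : IsCoprime ρ n) (h' : IsCoprime ρ' n)
    (e : n ∣ ρ * ρ' - X ^ 2) : jacobiSym ρ n.natAbs = jacobiSym ρ' n.natAbs := by
  have hX : IsCoprime X n := by
    obtain ⟨k, hk⟩ := e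
    have h1 : IsCoprime (ρ * ρ' + n * (-k)) n := (h.mul_left h').add_mul_left_left _
    rw [show ρ * ρ' + n * (-k) = X ^ 2 by linarith] at h1
    exact (IsCoprime.pow_left_iff (by norm_num)).1 h1
  refine eq_of_mul_eq_one_of_sign
    (jacobiSym.eq_one_or_neg_one (Int.isCoprime_iff_natAbs.1 h)) ?_
  rw [← jacobiSym.mul_left, jacobiSym_congr e, jacobiSym.sq_one' (Int.isCoprime_iff_natAbs.1 hX)]

theorem kroneckerSymbol_eq_one_or_neg_one {ρ b : ℤ} (hb : b ≠ 0) (h : IsCoprime ρ b) :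
    kroneckerSymbol ρ b = 1 ∨ kroneckerSymbol ρ b = -1 := by
  obtain ⟨v, β, hβ, rfl⟩ := Int.exists_eq_two_pow_mul hb
  rw [kroneckerSymbol_two_pow_mul v hβ]
  have h1 : (if β < 0 ∧ ρ < 0 then (-1 : ℤ) else 1) = 1 ∨
      (if β < 0 ∧ ρ < 0 then (-1 : ℤ) else 1) = -1 := by split_ifs <;> simp
  have h2 : ZMod.χ₈ (ρ : ZMod 8) ^ v = 1 ∨ ZMod.χ₈ (ρ : ZMod 8) ^ v = -1 := by
    rcases Nat.eq_zero_or_pos v with rfl | hv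
    · simp
    · have hodd : ρ % 2 = 1 := by
        have := (IsCoprime.pow_right_iff hv).1 h.of_mul_right_left
        exact Int.odd_iff.1 (Int.isCoprime_two_right.1 this)
      rcases χ₈_eq_one_or_neg_one hodd with e | e
      · simp [e]
      · rw [e]; exact neg_one_pow_eq_or ℤ v
  have h3 := jacobiSym.eq_one_or_neg_one (Int.isCoprime_iff_natAbs.1 h.of_mul_right_right)
  rcases h1 with h1 | h1 <;> rcases h2 with h2 | h2 <;> rcases h3 with h3 | h3 <;>
    rw [h1, h2, h3] <;> norm_num

/-- Two positive, or two negative, integers whose product is of the form `X² + 2 a² Y²` have the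
same Kronecker symbol at divisors of `a`. -/
theorem kroneckerSymbol_eq_of_mul {a b ρ ρ' X Y : ℤ} (hb : b ≠ 0) (hba : b ∣ a)
    (hs : ρ < 0 ↔ ρ' < 0) (h : IsCoprime ρ b) (h' : IsCoprime ρ' b)
    (e : ρ * ρ' = X ^ 2 + 2 * a ^ 2 * Y ^ 2) :
    kroneckerSymbol ρ b = kroneckerSymbol ρ' b := by
  obtain ⟨v, β, hβ, rfl⟩ := Int.exists_eq_two_pow_mul hb
  have hJ : jacobiSym ρ β.natAbs = jacobiSym ρ' β.natAbs := by
    refine jacobiSym_eq_of_mul (X := X) h.of_mul_right_right h'.of_mul_right_right ?_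
    have : β ∣ a := (Dvd.intro_left _ rfl).trans hba
    rw [show ρ * ρ' - X ^ 2 = a * (2 * a * Y ^ 2) by rw [e]; ring]
    exact this.mul_right _
  rw [kroneckerSymbol_two_pow_mul v hβ, kroneckerSymbol_two_pow_mul v hβ, hJ]
  simp only [hs]
  rcases Nat.eq_zero_or_pos v with rfl | hv
  · simp
  · have odd {x : ℤ} (h : IsCoprime x (2 ^ v * β)) : x % 2 = 1 := by
      have := (IsCoprime.pow_right_iff hv).1 h.of_mul_right_left
      exact Int.odd_iff.1 (Int.isCoprime_two_right.1 this)
    have h2 : (2 : ℤ) ∣ a := ((dvd_pow_self 2 hv.ne').mul_right β).trans hba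
    have h8 : (ρ * ρ') % 8 = 1 := by
      have o : (ρ * ρ') % 2 = 1 := by rw [Int.mul_emod, odd h, odd h']; rfl
      obtain ⟨c, rfl⟩ := h2
      have e' : ρ * ρ' = X ^ 2 + 8 * (c ^ 2 * Y ^ 2) := by rw [e]; ring
      have hX : Odd X := by
        rw [← Int.odd_pow' (n := 2) (by norm_num), Int.odd_iff]; omega
      have := Int.eight_dvd_sq_sub_one_of_odd hX
      omega
    rw [χ₈_eq_of_mul h8]

theorem kroneckerSymbol_sq {n ρ : ℤ} (hn : n ≠ 0) (h : IsCoprime ρ n) :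
    kroneckerSymbol ρ (n ^ 2) = 1 := by
  obtain ⟨w, γ, hγ, rfl⟩ := Int.exists_eq_two_pow_mul hn
  have hγ2 : (γ ^ 2) % 2 = 1 := by rw [sq, Int.mul_emod, hγ]; rfl
  have hpos : ¬γ ^ 2 < 0 := not_lt.2 (sq_nonneg γ)
  rw [mul_pow, ← pow_mul, kroneckerSymbol_two_pow_mul _ hγ2, if_neg (by tauto), Int.natAbs_pow,
    jacobiSym.pow_right, jacobiSym.sq_one (Int.isCoprime_iff_natAbs.1 h.of_mul_right_right)]
  rcases Nat.eq_zero_or_pos w with rfl | hw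
  · simp
  · have := (IsCoprime.pow_right_iff hw).1 h.of_mul_right_left
    have hodd := Int.odd_iff.1 (Int.isCoprime_two_right.1 this)
    rcases χ₈_eq_one_or_neg_one hodd with e | e <;> rw [e, pow_mul'] <;> simp

theorem kroneckerSymbol_two_mul_sq {n ρ : ℤ} (hn : n ≠ 0) (h : IsCoprime ρ n) (h8 : ρ % 8 = 1) :
    kroneckerSymbol ρ (2 * n ^ 2) = 1 := by
  obtain ⟨w, γ, hγ, rfl⟩ := Int.exists_eq_two_pow_mul hn
  have hγ2 : (γ ^ 2) % 2 = 1 := by rw [sq, Int.mul_emod, hγ]; rfl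
  have hpos : ¬γ ^ 2 < 0 := not_lt.2 (sq_nonneg γ)
  have e : (2 : ℤ) * (2 ^ w * γ) ^ 2 = 2 ^ (w * 2 + 1) * γ ^ 2 := by ring
  rw [e, kroneckerSymbol_two_pow_mul _ hγ2, if_neg (by tauto), Int.natAbs_pow,
    jacobiSym.pow_right, jacobiSym.sq_one (Int.isCoprime_iff_natAbs.1 h.of_mul_right_right),
    ZMod.χ₈_int_mod_eight, h8]
  simp

/-! ### Reciprocity -/

/-- Quadratic reciprocity for integers that are not both negative. -/
theorem jacobiSym_reciprocity {a β : ℤ} (ha : a % 4 = 1) (hβ : β % 2 = 1) (h : 0 ≤ a ∨ 0 ≤ β) :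
    jacobiSym β a.natAbs = jacobiSym a β.natAbs := by
  have hoa : Odd a.natAbs := Nat.odd_iff.2 (by omega)
  have hob : Odd β.natAbs := Nat.odd_iff.2 (by omega)
  have hneg (x : ℤ) (n : ℕ) (hn : Odd n) : jacobiSym (-x) n = ZMod.χ₄ n * jacobiSym x n := by
    rw [neg_eq_neg_one_mul, jacobiSym.mul_left, jacobiSym.at_neg_one hn]
  rcases le_or_gt 0 a with ha0 | ha0
  · have h1 : a.natAbs % 4 = 1 := by omega
    have h2 : jacobiSym β a.natAbs = jacobiSym (β.natAbs : ℤ) a.natAbs := by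
      rcases Int.natAbs_eq β with e | e
      · rw [← e]
      · nth_rewrite 1 [e]
        rw [hneg _ _ hoa, ZMod.χ₄_nat_one_mod_four h1, one_mul]
    have h3 : jacobiSym a β.natAbs = jacobiSym (a.natAbs : ℤ) β.natAbs := by
      rw [Int.natAbs_of_nonneg ha0]
    rw [h2, h3]
    exact (jacobiSym.quadratic_reciprocity_one_mod_four h1 hob).symm
  · have hb0 : 0 ≤ β := by omega
    have h1 : a.natAbs % 4 = 3 := by omega
    have h2 : jacobiSym β a.natAbs = jacobiSym (β.natAbs : ℤ) a.natAbs := by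
      rw [Int.natAbs_of_nonneg hb0]
    have h3 : jacobiSym a β.natAbs =
        ZMod.χ₄ β.natAbs * jacobiSym (a.natAbs : ℤ) β.natAbs := by
      rw [← hneg _ _ hob]; congr 1; omega
    rw [h2, h3]
    rcases (by omega : β.natAbs % 4 = 1 ∨ β.natAbs % 4 = 3) with h4 | h4
    · rw [ZMod.χ₄_nat_one_mod_four h4, one_mul]
      exact jacobiSym.quadratic_reciprocity_one_mod_four h4 hoa
    · rw [ZMod.χ₄_nat_three_mod_four h4, jacobiSym.quadratic_reciprocity_three_mod_four h4 h1,
        neg_one_mul]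

theorem jacobiSym_two {a : ℤ} (ha : a % 8 = 1 ∨ a % 8 = 7) : jacobiSym 2 a.natAbs = 1 := by
  rw [jacobiSym.at_two (Nat.odd_iff.2 (by omega)), ZMod.χ₈_nat_eq_if_mod_eight, if_neg (by omega),
    if_pos (by omega)]

/-- The symbols of two tangent circles with curvatures `a` odd and `b` even, both computed with
`a + b`, agree. If `a` and `b` are not coprime, both sides vanish. -/
theorem octSymbol_reciprocity {a b : ℤ} (hb : b ≠ 0) (hpos : 0 < a + b)
    (hres : (a % 8 = 1 ∧ (b % 8 = 0 ∨ b % 8 = 2)) ∨ (a % 8 = 7 ∧ (b % 8 = 2 ∨ b % 8 = 4))) :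
    octSymbol a (a + b) = octSymbol b (a + b) := by
  have hnonneg : ¬a + b < 0 := by omega
  obtain ⟨v, β, hβ, hbβ⟩ := Int.exists_eq_two_pow_mul hb
  have hβb : β ∣ b := ⟨2 ^ v, by rw [hbβ]; ring⟩
  have hsign : 0 ≤ a ∨ 0 ≤ β := by
    by_contra! hc
    have : b < 0 := by rw [hbβ]; exact mul_neg_of_pos_of_neg (by positivity) hc.2
    omega
  have hL : octSymbol a (a + b) = jacobiSym β a.natAbs := by
    rw [octSymbol, if_neg (by omega), if_neg (by omega), kroneckerSymbol_odd (by omega),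
      if_neg (by tauto), one_mul, jacobiSym_congr (ρ' := b) (by simp), hbβ, jacobiSym.mul_left,
      jacobiSym.pow_left, jacobiSym_two (by omega), one_pow, one_mul]
  have hJ : jacobiSym (a + b) β.natAbs = jacobiSym a β.natAbs :=
    jacobiSym_congr (by simpa using hβb)
  rw [hL]
  rcases (by omega : b % 8 = 2 ∨ b % 8 = 4 ∨ b % 8 = 0) with h | h | h
  · have hv : b / 2 = β := by
      match v, hbβ with
      | 0, hbβ => omega
      | 1, hbβ => omega
      | v + 2, hbβ =>
        have : b = 4 * (2 ^ v * β) := by rw [hbβ]; ring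
        omega
    have h4 : β % 4 = 1 := by omega
    rw [octSymbol, if_pos h, hv, kroneckerSymbol_odd hβ, if_neg (by tauto), one_mul, hJ]
    exact (jacobiSym_reciprocity h4 (by omega) hsign.symm).symm
  · rw [octSymbol, if_neg (by omega), if_pos h, hbβ, kroneckerSymbol_two_pow_mul v hβ]
    have hv : v = 2 := by
      match v, hbβ with
      | 0, hbβ => omega
      | 1, hbβ => omega
      | 2, hbβ => rfl
      | v + 3, hbβ =>
        have : b = 8 * (2 ^ v * β) := by rw [hbβ]; ring
        omega
    have hχ : ZMod.χ₈ ((-(a + 2 ^ v * β) : ℤ) : ZMod 8) ^ v = 1 := by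
      rw [← hbβ]
      rcases χ₈_eq_one_or_neg_one (ρ := -(a + b)) (by omega) with e | e <;> rw [hv, e] <;> rfl
    have hJ' : jacobiSym (-(a + 2 ^ v * β)) β.natAbs = jacobiSym (-a) β.natAbs :=
      jacobiSym_congr ⟨-2 ^ v, by ring⟩
    rw [hχ, hJ', mul_one]
    by_cases hβ0 : β < 0
    · rw [if_pos ⟨hβ0, by rw [← hbβ]; omega⟩]
      have h1 := jacobiSym_reciprocity (a := -a) (β := -β) (by omega) (by omega) (by omega)
      rw [Int.natAbs_neg, Int.natAbs_neg] at h1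
      have h2 : jacobiSym (-β) a.natAbs = -jacobiSym β a.natAbs := by
        rw [neg_eq_neg_one_mul, jacobiSym.mul_left, jacobiSym.at_neg_one
          (Nat.odd_iff.2 (by omega)), ZMod.χ₄_nat_three_mod_four (by omega), neg_one_mul]
      rw [← h1, h2]; ring
    · rw [if_neg (by tauto), one_mul]
      have h1 := jacobiSym_reciprocity (a := -a) (β := β) (by omega) (by omega) (by omega)
      rwa [Int.natAbs_neg] at h1
  · rw [octSymbol, if_neg (by omega), if_neg (by omega)]
    nth_rewrite 2 [hbβ]
    rw [kroneckerSymbol_two_pow_mul v hβ, if_neg (by tauto), hJ, ZMod.χ₈_int_mod_eight,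
      show (a + b) % 8 = 1 by omega]
    simp only [Int.cast_one, map_one, one_pow, one_mul]
    exact jacobiSym_reciprocity (by omega) hβ hsign

/-! ### The invariant of a circle -/

/-- The properties of the curvatures of a sextuple on which the invariant depends. -/
structure OctTuple (s : Fin 6 → ℤ) : Prop where
  curv : OctCurvatures s
  res : OctResidues s
  pos : 0 < s 0 + s 5
  prim : ∀ p : ℤ, ¬IsUnit p → ∃ i, ¬p ∣ s i

theorem Int.isCoprime_of_prime {a b : ℤ} (h : ∀ p : ℕ, p.Prime → (p : ℤ) ∣ a → ¬(p : ℤ) ∣ b) :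
    IsCoprime a b := by
  rw [Int.isCoprime_iff_gcd_eq_one, Int.gcd]
  by_contra hc
  obtain ⟨p, hp, hpd⟩ := Nat.exists_prime_and_dvd hc
  exact h p hp (Int.natCast_dvd.2 (hpd.trans (Nat.gcd_dvd_left _ _)))
    (Int.natCast_dvd.2 (hpd.trans (Nat.gcd_dvd_right _ _)))

namespace OctTuple

variable {s : Fin 6 → ℤ}

theorem pos_of_represents (h : OctTuple s) (h0 : s 0 ≠ 0) {ρ : ℤ} (hρ : OctRepresents s ρ) :
    0 < ρ := by
  obtain ⟨B, hB, hdisc⟩ := h.curv.exists_middle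
  obtain ⟨-, hA⟩ := h.curv.form_coeff_pos h.pos h0
  obtain ⟨x, y, hxy, ⟨-, e⟩ | ⟨-, e⟩⟩ := (octRepresents_iff hB ρ).1 hρ
  · exact e ▸ octForm_pos hdisc h0 hA hxy
  · have := octForm_pos hdisc h0 hA hxy
    omega

/-- The product of two represented numbers is, up to a factor of `2`, of the form `X² + 2 a² Y²`;
the factor occurs if one of the numbers is represented by `Q_α` and the other one by `Q_β`. -/
theorem exists_mul_eq (h : OctTuple s) {ρ ρ' : ℤ} (hρ : OctRepresents s ρ)
    (hρ' : OctRepresents s ρ') : ∃ X Y : ℤ, ρ * ρ' = X ^ 2 + 2 * s 0 ^ 2 * Y ^ 2 ∨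
      2 * (ρ * ρ') = X ^ 2 + 2 * s 0 ^ 2 * Y ^ 2 := by
  obtain ⟨B, hB, hdisc⟩ := h.curv.exists_middle
  rw [octRepresents_iff hB] at hρ hρ'
  obtain ⟨x, y, -, hx⟩ := hρ
  obtain ⟨z, w, -, hz⟩ := hρ'
  have hmul := octForm_mul hdisc x y z w
  rcases hx with ⟨-, e⟩ | ⟨⟨x', ex⟩, e⟩ <;> rcases hz with ⟨-, e'⟩ | ⟨⟨z', ez⟩, e'⟩ <;>
    rw [← e, ← e'] at hmul
  · exact ⟨_, _, Or.inl hmul⟩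
  · exact ⟨_, _, Or.inr ((by ring : _ = _).trans hmul)⟩
  · exact ⟨_, _, Or.inr ((by ring : _ = _).trans hmul)⟩
  · refine ⟨2 * (s 0 + s 2) * x' * z' + B * (x' * w + y * z') + (s 0 + s 1) * y * w,
      x' * w - y * z', Or.inl ?_⟩
    subst ex ez
    have h4 : 4 * (ρ * ρ') = 4 * ((2 * (s 0 + s 2) * x' * z' + B * (x' * w + y * z') +
        (s 0 + s 1) * y * w) ^ 2 + 2 * s 0 ^ 2 * (x' * w - y * z') ^ 2) := by
      linear_combination hmul
    linarith

theorem exists_mul_eq_of_even (h : OctTuple s) (h2 : s 0 % 2 = 0) {ρ ρ' : ℤ}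
    (hρ : OctRepresents s ρ) (hρ' : OctRepresents s ρ') (ho : ρ % 2 = 1) (ho' : ρ' % 2 = 1) :
    ∃ X Y : ℤ, ρ * ρ' = X ^ 2 + 2 * s 0 ^ 2 * Y ^ 2 := by
  obtain ⟨X, Y, e | e⟩ := h.exists_mul_eq hρ hρ'
  · exact ⟨X, Y, e⟩
  · exfalso
    have hX : Even X := by
      rw [← Int.even_pow' (n := 2) (by norm_num)]
      exact ⟨ρ * ρ' - s 0 ^ 2 * Y ^ 2, by linarith⟩
    obtain ⟨X', rfl⟩ := hX
    obtain ⟨a, ha⟩ := Int.dvd_of_emod_eq_zero h2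
    have hodd : (ρ * ρ') % 2 = 1 := by rw [Int.mul_emod, ho, ho']; rfl
    have : ρ * ρ' = 2 * (X' ^ 2 + 2 * a ^ 2 * Y ^ 2) := by rw [ha] at e; linarith
    omega

end OctTuple

theorem octSymbol_eq_of_mul {a ρ ρ' X Y : ℤ} (ha : a ≠ 0) (hρ : 0 < ρ) (hρ' : 0 < ρ')
    (h : IsCoprime ρ a) (h' : IsCoprime ρ' a) (e : ρ * ρ' = X ^ 2 + 2 * a ^ 2 * Y ^ 2) :
    octSymbol a ρ = octSymbol a ρ' := by
  rw [octSymbol, octSymbol]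
  split_ifs with h2 h4
  · have hd : a / 2 ∣ a := ⟨2, by omega⟩
    exact kroneckerSymbol_eq_of_mul (by omega) hd (by omega) (h.of_isCoprime_of_dvd_right hd)
      (h'.of_isCoprime_of_dvd_right hd) e
  · exact kroneckerSymbol_eq_of_mul ha dvd_rfl (by omega) h.neg_left h'.neg_left
      ((neg_mul_neg ρ ρ').trans e)
  · exact kroneckerSymbol_eq_of_mul ha dvd_rfl (by omega) h h' e

theorem octSymbol_eq_one_or_neg_one {a ρ : ℤ} (ha : a ≠ 0) (h : IsCoprime ρ a) :
    octSymbol a ρ = 1 ∨ octSymbol a ρ = -1 := by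
  rw [octSymbol]
  split_ifs with h2 h4
  · have hd : a / 2 ∣ a := ⟨2, by omega⟩
    exact kroneckerSymbol_eq_one_or_neg_one (by omega) (h.of_isCoprime_of_dvd_right hd)
  · exact kroneckerSymbol_eq_one_or_neg_one ha h.neg_left
  · exact kroneckerSymbol_eq_one_or_neg_one ha h

namespace OctTuple

variable {s : Fin 6 → ℤ}

/-- The symbol of a circle does not depend on the represented number. In the case of a factor of `2`
this uses that `2` has symbol `1` over the odd curvatures. -/
theorem octSymbol_eq (h : OctTuple s) (h0 : s 0 ≠ 0) {ρ ρ' : ℤ} (hρ : OctRepresents s ρ)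
    (hρ' : OctRepresents s ρ') (hc : IsCoprime ρ (s 0)) (hc' : IsCoprime ρ' (s 0)) :
    octSymbol (s 0) ρ = octSymbol (s 0) ρ' := by
  have p := h.pos_of_represents h0 hρ
  have p' := h.pos_of_represents h0 hρ'
  rcases Int.emod_two_eq_zero_or_one (s 0) with h2 | h2
  · have odd {ρ : ℤ} (hc : IsCoprime ρ (s 0)) : ρ % 2 = 1 :=
      Int.odd_iff.1 (Int.isCoprime_two_right.1
        (hc.of_isCoprime_of_dvd_right (Int.dvd_of_emod_eq_zero h2)))
    obtain ⟨X, Y, e⟩ := h.exists_mul_eq_of_even h2 hρ hρ' (odd hc) (odd hc')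
    exact octSymbol_eq_of_mul h0 p p' hc hc' e
  · obtain ⟨X, Y, e | e⟩ := h.exists_mul_eq hρ hρ'
    · exact octSymbol_eq_of_mul h0 p p' hc hc' e
    · have h8 : s 0 % 8 = 1 ∨ s 0 % 8 = 7 := by
        rcases h.res.res with h | h <;> have := (h 0).1 <;> omega
      have h2c : IsCoprime 2 (s 0) := Int.isCoprime_two_left.2 (Int.odd_iff.2 h2)
      have key : jacobiSym (2 * ρ) (s 0).natAbs = jacobiSym ρ' (s 0).natAbs :=
        jacobiSym_eq_of_mul (X := X) (h2c.mul_left hc) hc'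
          ⟨2 * s 0 * Y ^ 2, by linear_combination e⟩
      rw [jacobiSym.mul_left, jacobiSym_two h8, one_mul] at key
      rw [octSymbol, octSymbol, if_neg (by omega), if_neg (by omega), if_neg (by omega),
        if_neg (by omega), kroneckerSymbol_odd h2, kroneckerSymbol_odd h2, key, if_neg (by omega),
        if_neg (by omega)]

theorem not_dvd (h : OctTuple s) {p : ℤ} (hp : Prime p) (h0 : p ∣ s 0) (h1 : p ∣ s 1)
    (h2 : p ∣ s 2) : ¬p ∣ s 3 := by
  intro h3
  have h5 : s 5 = s 2 + s 3 - s 0 := by linarith [h.curv.sum₂]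
  have h4 : s 4 = s 2 + s 3 - s 1 := by linarith [h.curv.sum₁, h.curv.sum₂]
  obtain ⟨i, hi⟩ := h.prim p hp.not_isUnit
  fin_cases i
  · exact hi h0
  · exact hi h1
  · exact hi h2
  · exact hi h3
  · exact hi (h4 ▸ (h2.add h3).sub h1)
  · exact hi (h5 ▸ (h2.add h3).sub h0)

/-- An odd prime does not divide all the coefficients of the form together with the curvature of the
first circle. -/
theorem not_dvd_coeff (h : OctTuple s) {B : ℤ} (hB : 2 * B = -2 * s 0 - 2 * s 1 - s 2 + s 3)
    {p : ℤ} (hp : Prime p) (h0 : p ∣ s 0) (hA : p ∣ s 0 + s 2) (hC : p ∣ s 0 + s 1) :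
    ¬p ∣ B := by
  intro hpB
  have h1 : p ∣ s 1 := (dvd_add_right h0).1 hC
  have h2 : p ∣ s 2 := (dvd_add_right h0).1 hA
  refine h.not_dvd hp h0 h1 h2 ?_
  rw [show s 3 = 2 * B + 2 * (s 0 + s 1) + s 2 by linarith]
  exact ((hpB.mul_left 2).add (hC.mul_left 2)).add h2

/-- The form represents a number coprime to the curvature `a` of the first circle: evaluate it at
`(x, y)`, where `x` is the product of the primes that divide `a` and the first coefficient, and `y`
is the product of the other prime divisors of `a`. -/
theorem exists_represents (h : OctTuple s) (h0 : s 0 ≠ 0) :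
    ∃ ρ, OctRepresents s ρ ∧ IsCoprime ρ (s 0) := by
  classical
  obtain ⟨B, hB, hdisc⟩ := h.curv.exists_middle
  set A := s 0 + s 2 with hA
  set C := s 0 + s 1 with hC
  set P := (s 0).natAbs.primeFactors with hP
  have memP {p : ℕ} (hp : p.Prime) (hpa : (p : ℤ) ∣ s 0) : p ∈ P :=
    Nat.mem_primeFactors.2 ⟨hp, Int.natCast_dvd.1 hpa, Int.natAbs_ne_zero.2 h0⟩
  set x : ℕ := ∏ p ∈ P.filter (fun p : ℕ => (p : ℤ) ∣ A), p with hx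
  set y : ℕ := ∏ p ∈ P.filter (fun p : ℕ => ¬(p : ℤ) ∣ A), p with hy
  have hxy : Nat.Coprime x y := by
    refine Nat.Coprime.prod_left fun p hp => Nat.Coprime.prod_right fun q hq => ?_
    rw [Finset.mem_filter] at hp hq
    refine (Nat.coprime_primes (Nat.prime_of_mem_primeFactors hp.1)
      (Nat.prime_of_mem_primeFactors hq.1)).2 ?_
    rintro rfl
    exact hq.2 hp.2
  have hxy' : IsCoprime (x : ℤ) (y : ℤ) := Nat.isCoprime_iff_coprime.2 hxy
  have not_both {p : ℕ} (hp : p.Prime) (h1 : (p : ℤ) ∣ x) (h2 : (p : ℤ) ∣ y) : False :=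
    (Nat.prime_iff_prime_int.1 hp).not_isUnit (hxy'.isUnit_of_dvd' h1 h2)
  have dvdx {p : ℕ} (hp : p.Prime) (hpa : (p : ℤ) ∣ s 0) (hpA : (p : ℤ) ∣ A) : (p : ℤ) ∣ x :=
    Int.natCast_dvd_natCast.2
      (Finset.dvd_prod_of_mem (fun p : ℕ => p) (Finset.mem_filter.2 ⟨memP hp hpa, hpA⟩))
  have dvdy {p : ℕ} (hp : p.Prime) (hpa : (p : ℤ) ∣ s 0) (hpA : ¬(p : ℤ) ∣ A) : (p : ℤ) ∣ y :=
    Int.natCast_dvd_natCast.2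
      (Finset.dvd_prod_of_mem (fun p : ℕ => p) (Finset.mem_filter.2 ⟨memP hp hpa, hpA⟩))
  have even_x (hx2 : Even (x : ℤ)) : (2 : ℤ) ∣ s 0 ∧ (2 : ℤ) ∣ A := by
    have h2 : 2 ∣ x := by exact_mod_cast even_iff_two_dvd.1 hx2
    obtain ⟨p, hp, hp2⟩ := (Nat.prime_two.prime.dvd_finsetProd_iff _).1 h2
    rw [Finset.mem_filter] at hp
    have hpp := Nat.prime_of_mem_primeFactors hp.1
    have : p = 2 := ((Nat.prime_dvd_prime_iff_eq Nat.prime_two hpp).1 hp2).symm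
    subst this
    exact ⟨Int.natCast_dvd.2 (Nat.dvd_of_mem_primeFactors hp.1), by exact_mod_cast hp.2⟩
  -- At an odd prime divisor of `a` the form does not vanish.
  have odd_prime {p : ℕ} (hp : p.Prime) (hp2 : p ≠ 2) (hpa : (p : ℤ) ∣ s 0) :
      ¬(p : ℤ) ∣ octForm A B C x y := by
    have hpi := Nat.prime_iff_prime_int.1 hp
    intro hd
    by_cases hpA : (p : ℤ) ∣ A
    · have hpx := dvdx hp hpa hpA
      have hpB : (p : ℤ) ∣ B := by
        refine hpi.dvd_of_dvd_pow (n := 2) ?_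
        rw [show B ^ 2 = A * (2 * C) - s 0 * (2 * s 0) by linarith]
        exact (hpA.mul_right _).sub (hpa.mul_right _)
      have hpC : ¬(p : ℤ) ∣ C := fun hpC => h.not_dvd_coeff hB hpi hpa hpA hpC hpB
      have h3 : (p : ℤ) ∣ 2 * C * y ^ 2 := by
        rw [show 2 * C * (y : ℤ) ^ 2 = octForm A B C x y - x * (A * x + 2 * B * y) by
          rw [octForm]; ring]
        exact hd.sub (hpx.mul_right _)
      rcases hpi.dvd_or_dvd h3 with h4 | h4
      · rcases hpi.dvd_or_dvd h4 with h5 | h5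
        · exact hp2 ((Nat.prime_dvd_prime_iff_eq hp Nat.prime_two).1 (by exact_mod_cast h5))
        · exact hpC h5
      · exact not_both hp hpx (hpi.dvd_of_dvd_pow h4)
    · have hpy := dvdy hp hpa hpA
      have h3 : (p : ℤ) ∣ A * x ^ 2 := by
        rw [show A * (x : ℤ) ^ 2 = octForm A B C x y - y * (2 * B * x + 2 * C * y) by
          rw [octForm]; ring]
        exact hd.sub (hpy.mul_right _)
      rcases hpi.dvd_or_dvd h3 with h4 | h4
      · exact hpA h4
      · exact not_both hp (hpi.dvd_of_dvd_pow h4) hpy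
  rcases Int.even_or_odd (x : ℤ) with hx2 | hx2
  · obtain ⟨ha2, hA2⟩ := even_x hx2
    obtain ⟨x', hx'⟩ := hx2
    have hface := h.res.face_odd
    have hC2 : C % 2 = 1 := by omega
    have hy2 : (y : ℤ) % 2 = 1 := by
      rcases Int.emod_two_eq_zero_or_one (y : ℤ) with h2 | h2
      · exact (not_both Nat.prime_two (by push_cast; omega) (by push_cast; omega)).elim
      · exact h2
    have hB2 : Even B := by
      rw [← Int.even_pow' (n := 2) (by norm_num)]
      exact ⟨A * C - s 0 ^ 2, by linarith⟩
    obtain ⟨B', hB'⟩ := hB2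
    set ρ := 2 * (A * x' ^ 2 + 2 * B' * x' * y) + C * y ^ 2 with hρ
    have e : 2 * ρ = octForm A B C x y := by
      rw [octForm, hx', hB', hρ]; ring
    refine ⟨ρ, (octRepresents_iff hB ρ).2 ⟨x, y, hxy', Or.inr ⟨⟨x', hx'⟩, e⟩⟩, IsCoprime.symm
      (Int.isCoprime_of_prime fun p hp hpa hpρ => ?_)⟩
    by_cases hp2 : p = 2
    · subst hp2
      have : (C * (y : ℤ) ^ 2) % 2 = 1 := by
        rw [sq, Int.mul_emod, Int.mul_emod (y : ℤ), hC2, hy2]; rfl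
      push_cast at hpρ
      omega
    · exact odd_prime hp hp2 hpa (e ▸ hpρ.mul_left 2)
  · refine ⟨octForm A B C x y, (octRepresents_iff hB _).2 ⟨x, y, hxy', Or.inl ⟨hx2, rfl⟩⟩,
      IsCoprime.symm (Int.isCoprime_of_prime fun p hp hpa hpρ => ?_)⟩
    by_cases hp2 : p = 2
    · subst hp2
      have hA2 : ¬(2 : ℤ) ∣ A := fun hA2 => by
        have := dvdx Nat.prime_two hpa (by exact_mod_cast hA2)
        rw [Int.odd_iff] at hx2
        push_cast at this
        omega
      have h3 : (2 : ℤ) ∣ A * x ^ 2 := by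
        rw [show A * (x : ℤ) ^ 2 = octForm A B C x y - 2 * (B * x * y + C * y ^ 2) by
          rw [octForm]; ring]
        exact (by exact_mod_cast hpρ : (2 : ℤ) ∣ octForm A B C x y).sub (Dvd.intro _ rfl)
      rcases Int.prime_two.dvd_or_dvd h3 with h4 | h4
      · exact hA2 h4
      · have := Int.prime_two.dvd_of_dvd_pow h4
        rw [Int.odd_iff] at hx2
        omega
    · exact odd_prime hp hp2 hpa hpρ

/-- The curvatures of the circles tangent to the first one give represented numbers. -/
theorem represents_add₁ (h : OctTuple s) : OctRepresents s (s 0 + s 1) := by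
  obtain ⟨B, hB, -⟩ := h.curv.exists_middle
  refine (octRepresents_iff hB _).2 ⟨0, 1, isCoprime_one_right, Or.inr ⟨Even.zero, ?_⟩⟩
  rw [octForm]; ring

theorem represents_add₂ (h : OctTuple s) : OctRepresents s (s 0 + s 2) := by
  obtain ⟨B, hB, -⟩ := h.curv.exists_middle
  refine (octRepresents_iff hB _).2 ⟨1, 0, isCoprime_one_left, Or.inl ⟨odd_one, ?_⟩⟩
  rw [octForm]; ring

end OctTuple

namespace OctahedralConfiguration

variable {A : OctahedralConfiguration}

theorem IsSextuple.octTuple (hint : A.IsIntegral) (hprim : A.IsPrimitive)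
    (htype : A.HasType ![1, 0, 2, 0, 2, 1] ∨ A.HasType ![7, 2, 4, 2, 4, 7])
    {S : Fin 6 → OrientedCircle} (h : A.IsSextuple S) {s : Fin 6 → ℤ}
    (hs : ∀ i, (S i).curvature = s i) : OctTuple s :=
  ⟨h.isOctFrame.octCurvatures hs, octResidues hint htype h hs, curvature_sum_pos hint htype h hs,
    fun _ hp => exists_not_dvd hint hprim h hs hp⟩

/-- The invariant of the first circle of a sextuple is computed by any represented number coprime
to its curvature. -/
theorem chi₂Values_eq (hint : A.IsIntegral) (hprim : A.IsPrimitive)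
    (htype : A.HasType ![1, 0, 2, 0, 2, 1] ∨ A.HasType ![7, 2, 4, 2, 4, 7])
    {S : Fin 6 → OrientedCircle} (h : A.IsSextuple S) {s : Fin 6 → ℤ}
    (hs : ∀ i, (S i).curvature = s i) (h0 : s 0 ≠ 0) {ρ : ℤ} (hρ : OctRepresents s ρ)
    (hc : IsCoprime ρ (s 0)) : A.chi₂Values (S 0) = {octSymbol (s 0) ρ} := by
  ext ε
  rw [Set.mem_singleton_iff]
  constructor
  · rintro ⟨T, t, ρ', hT, hT0, ht, hc', hρ', rfl⟩
    have e0 : t 0 = s 0 := by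
      have := (ht 0).symm.trans ((congrArg _ hT0).trans (hs 0))
      exact_mod_cast this
    have := octRepresents_congr hint htype hT h hT0 ht hs (e0 ▸ h0) hρ'
    rw [e0] at hc' ⊢
    exact (h.octTuple hint hprim htype hs).octSymbol_eq h0 this hρ hc' hc
  · rintro rfl
    exact ⟨S, s, ρ, h, rfl, hs, hc, hρ, rfl⟩

theorem exists_chi₂Values_eq (hint : A.IsIntegral) (hprim : A.IsPrimitive)
    (htype : A.HasType ![1, 0, 2, 0, 2, 1] ∨ A.HasType ![7, 2, 4, 2, 4, 7])
    {C : OrientedCircle} (hC : C ∈ A.packing) (h0 : C.curvature ≠ 0) :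
    ∃ ε : ℤ, (ε = 1 ∨ ε = -1) ∧ A.chi₂Values C = {ε} := by
  obtain ⟨S, hS, rfl⟩ := exists_isSextuple hC
  obtain ⟨s, hs⟩ := hS.exists_curvature hint
  have h0' : s 0 ≠ 0 := fun h => h0 (by rw [hs, h, Int.cast_zero])
  obtain ⟨ρ, hρ, hc⟩ := (hS.octTuple hint hprim htype hs).exists_represents h0'
  exact ⟨_, octSymbol_eq_one_or_neg_one h0' hc, chi₂Values_eq hint hprim htype hS hs h0' hρ hc⟩

end OctahedralConfiguration

/-! ### Rotation about two tangent circles -/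

theorem Int.exists_dvd_sub_dvd_sub {a b : ℤ} (h : IsCoprime a b) (x y : ℤ) :
    ∃ z, a ∣ z - x ∧ b ∣ z - y := by
  obtain ⟨u, v, e⟩ := h
  exact ⟨x * (v * b) + y * (u * a), ⟨u * (y - x), by linear_combination x * e⟩,
    ⟨v * (x - y), by linear_combination y * e⟩⟩

/-- If each prime of a finite set fails to divide some value of `q`, then some value of `q` is
divisible by none of these primes. -/
theorem Int.exists_forall_not_dvd {q : ℤ → ℤ} (hq : ∀ m a b : ℤ, m ∣ a - b → m ∣ q a - q b)
    (P : Finset ℕ) (hP : ∀ p ∈ P, p.Prime) (h : ∀ p ∈ P, ∃ n, ¬(p : ℤ) ∣ q n) :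
    ∃ n, ∀ p ∈ P, ¬(p : ℤ) ∣ q n := by
  classical
  induction P using Finset.induction_on with
  | empty => exact ⟨0, by simp⟩
  | insert p P hp ih =>
    obtain ⟨n₁, h₁⟩ := ih (fun p hp => hP p (Finset.mem_insert_of_mem hp))
      fun p hp => h p (Finset.mem_insert_of_mem hp)
    obtain ⟨n₂, h₂⟩ := h p (Finset.mem_insert_self p P)
    have hco : IsCoprime ((∏ r ∈ P, r : ℕ) : ℤ) (p : ℤ) := by
      refine Nat.isCoprime_iff_coprime.2 (Nat.Coprime.prod_left fun r hr => ?_)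
      refine (Nat.coprime_primes (hP r (Finset.mem_insert_of_mem hr))
        (hP p (Finset.mem_insert_self p P))).2 ?_
      rintro rfl
      exact hp hr
    obtain ⟨n, e₁, e₂⟩ := Int.exists_dvd_sub_dvd_sub hco n₁ n₂
    refine ⟨n, fun r hr => ?_⟩
    rcases Finset.mem_insert.1 hr with rfl | hr
    · intro hd
      exact h₂ (by simpa using hd.sub (hq _ _ _ e₂))
    · intro hd
      refine h₁ r hr ?_
      have : (r : ℤ) ∣ ((∏ r ∈ P, r : ℕ) : ℤ) :=
        Int.natCast_dvd_natCast.2 (Finset.dvd_prod_of_mem (fun r : ℕ => r) hr)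
      simpa using hd.sub (hq _ _ _ (this.trans e₁))

theorem isOctAut_swap : IsOctAut (Equiv.swap 2 3) := by
  unfold IsOctAut; decide

namespace OctahedralConfiguration

variable {A : OctahedralConfiguration}

theorem IsSextuple.exists_rotate_one (hint : A.IsIntegral) {S : Fin 6 → OrientedCircle}
    (h : A.IsSextuple S) {s : Fin 6 → ℤ} (hs : ∀ i, (S i).curvature = s i) :
    ∃ (T : Fin 6 → OrientedCircle) (t : Fin 6 → ℤ), A.IsSextuple T ∧ (∀ i, (T i).curvature = t i) ∧
      T 0 = S 0 ∧ T 1 = S 1 ∧ t 2 = s 3 ∧ t 3 = 4 * (s 0 + s 1) + 2 * s 3 - s 2 := by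
  obtain ⟨T, hT, hst⟩ := (h.comp isOctAut_swap).exists_step
  obtain ⟨t, ht⟩ := hT.exists_curvature hint
  have hc := hst.curvature (s := s ∘ Equiv.swap 2 3) (fun i => hs _) ht
  have c2 : t 2 = s 3 + 0 * (2 * (s 0 + s 1 + s 3) - (s 0 + s 5)) := hc 2
  have c3 : t 3 = s 2 + 2 * (2 * (s 0 + s 1 + s 3) - (s 0 + s 5)) := hc 3
  have h2 := (h.isOctFrame.octCurvatures hs).sum₂
  exact ⟨T, t, hT, ht, hst.eq_of_mem (by simp), hst.eq_of_mem (by simp), by linarith, by linarith⟩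

/-- The circles tangent to two tangent circles `S 0` and `S 1` of a packing form a sequence, in
which any two consecutive circles complete a sextuple. -/
theorem IsSextuple.exists_rotate (hint : A.IsIntegral) {S : Fin 6 → OrientedCircle}
    (h : A.IsSextuple S) {s : Fin 6 → ℤ} (hs : ∀ i, (S i).curvature = s i) {B : ℤ}
    (hB : 2 * B = -2 * s 0 - 2 * s 1 - s 2 + s 3) (n : ℤ) :
    ∃ (T : Fin 6 → OrientedCircle) (t : Fin 6 → ℤ), A.IsSextuple T ∧ (∀ i, (T i).curvature = t i) ∧
      T 0 = S 0 ∧ T 1 = S 1 ∧ t 2 = s 2 + 2 * B * n + 2 * (s 0 + s 1) * n ^ 2 ∧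
      t 3 = s 2 + 2 * B * (n + 1) + 2 * (s 0 + s 1) * (n + 1) ^ 2 := by
  have nat (S : Fin 6 → OrientedCircle) (h : A.IsSextuple S) (s : Fin 6 → ℤ)
      (hs : ∀ i, (S i).curvature = s i) (B : ℤ) (hB : 2 * B = -2 * s 0 - 2 * s 1 - s 2 + s 3)
      (n : ℕ) : ∃ (T : Fin 6 → OrientedCircle) (t : Fin 6 → ℤ), A.IsSextuple T ∧
      (∀ i, (T i).curvature = t i) ∧ T 0 = S 0 ∧ T 1 = S 1 ∧
      t 2 = s 2 + 2 * B * n + 2 * (s 0 + s 1) * n ^ 2 ∧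
      t 3 = s 2 + 2 * B * (n + 1) + 2 * (s 0 + s 1) * (n + 1) ^ 2 := by
    induction n with
    | zero => exact ⟨S, s, h, hs, rfl, rfl, by simp, by push_cast; linarith⟩
    | succ n ih =>
      obtain ⟨T, t, hT, ht, e0, e1, e2, e3⟩ := ih
      obtain ⟨U, u, hU, hu, f0, f1, f2, f3⟩ := hT.exists_rotate_one hint ht
      have t0 : t 0 = s 0 := by
        have := (ht 0).symm.trans ((congrArg _ e0).trans (hs 0))
        exact_mod_cast this
      have t1 : t 1 = s 1 := by
        have := (ht 1).symm.trans ((congrArg _ e1).trans (hs 1))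
        exact_mod_cast this
      refine ⟨U, u, hU, hu, f0.trans e0, f1.trans e1, ?_, ?_⟩
      · rw [f2, e3]; push_cast; ring
      · rw [f3, e2, e3, t0, t1]; push_cast; ring
  rcases Int.eq_nat_or_neg n with ⟨k, rfl | rfl⟩
  · exact nat S h s hs B hB k
  · -- Interchanging the third and fourth circle reverses the sequence.
    obtain ⟨T, t, hT, ht, e0, e1, e2, e3⟩ := nat (S ∘ Equiv.swap 2 3) (h.comp isOctAut_swap)
      (s ∘ Equiv.swap 2 3) (fun i => hs _) (-B - 2 * (s 0 + s 1)) (by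
        change _ = -2 * s 0 - 2 * s 1 - s 3 + s 2
        linarith) k
    change t 2 = s 3 + _ + 2 * (s 0 + s 1) * _ at e2
    change t 3 = s 3 + _ + 2 * (s 0 + s 1) * _ at e3
    have h3 : s 3 = s 2 + 2 * B + 2 * (s 0 + s 1) := by linarith
    refine ⟨T ∘ Equiv.swap 2 3, t ∘ Equiv.swap 2 3, hT.comp isOctAut_swap, fun i => ht _, e0, e1,
      ?_, ?_⟩
    · change t 3 = _
      rw [e3, h3]; ring
    · change t 2 = _
      rw [e2, h3]; ring

/-- Two tangent circles can be completed to a face whose third circle has a curvature of prescribed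
parity that is divisible by no odd prime divisor of the curvatures of the two circles. -/
theorem IsSextuple.exists_coprime_neighbour (hint : A.IsIntegral) (hprim : A.IsPrimitive)
    (htype : A.HasType ![1, 0, 2, 0, 2, 1] ∨ A.HasType ![7, 2, 4, 2, 4, 7])
    {S : Fin 6 → OrientedCircle} (h : A.IsSextuple S)
    {s : Fin 6 → ℤ} (hs : ∀ i, (S i).curvature = s i) {i j k : Fin 6} (hij : OctAdj i j)
    (hjk : OctAdj j k) (hik : OctAdj i k) (hi : s i ≠ 0) (hj : s j ≠ 0) :
    ∃ (T : Fin 6 → OrientedCircle) (t : Fin 6 → ℤ), A.IsSextuple T ∧ (∀ i, (T i).curvature = t i) ∧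
      T i = S i ∧ T j = S j ∧ t k % 2 = s k % 2 ∧
      ∀ p : ℕ, p.Prime → p ≠ 2 → ((p : ℤ) ∣ s i ∨ (p : ℤ) ∣ s j) → ¬(p : ℤ) ∣ t k := by
  obtain ⟨σ, hσ, rfl, rfl, rfl⟩ := exists_octAut hij hjk hik
  have hS' := h.comp hσ
  have hs' (i : Fin 6) : ((S ∘ σ) i).curvature = (s ∘ σ) i := hs (σ i)
  have htup := hS'.octTuple hint hprim htype hs'
  obtain ⟨B, hB, -⟩ := htup.curv.exists_middle
  set s' := s ∘ σ
  obtain ⟨n, hn⟩ := Int.exists_forall_not_dvd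
    (q := fun n => s' 2 + 2 * B * n + 2 * (s' 0 + s' 1) * n ^ 2)
    (fun m a b hab => by
      rw [show s' 2 + 2 * B * a + 2 * (s' 0 + s' 1) * a ^ 2 -
        (s' 2 + 2 * B * b + 2 * (s' 0 + s' 1) * b ^ 2) =
        (a - b) * (2 * B + 2 * (s' 0 + s' 1) * (a + b)) by ring]
      exact hab.mul_right _)
    (((s' 0 * s' 1).natAbs.primeFactors).erase 2)
    (fun p hp => Nat.prime_of_mem_primeFactors (Finset.mem_of_mem_erase hp))
    (fun p hp => by
      by_contra! hcon
      have hp2 := Finset.ne_of_mem_erase hp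
      have hp' := Finset.mem_of_mem_erase hp
      have hpp := Nat.prime_iff_prime_int.1 (Nat.prime_of_mem_primeFactors hp')
      have hpd := Int.natCast_dvd.2 (Nat.dvd_of_mem_primeFactors hp')
      have d0 : (p : ℤ) ∣ s' 2 := by simpa using hcon 0
      have d1 : (p : ℤ) ∣ s' 3 := by
        have := hcon 1
        rwa [show s' 2 + 2 * B * 1 + 2 * (s' 0 + s' 1) * 1 ^ 2 = s' 3 by linarith] at this
      have dC : (p : ℤ) ∣ s' 0 + s' 1 := by
        have h4 : (p : ℤ) ∣ 2 ^ 2 * (s' 0 + s' 1) := by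
          have := ((hcon 1).add (hcon (-1))).sub (d0.mul_left 2)
          rwa [show s' 2 + 2 * B * 1 + 2 * (s' 0 + s' 1) * 1 ^ 2 + (s' 2 + 2 * B * (-1) +
            2 * (s' 0 + s' 1) * (-1) ^ 2) - 2 * s' 2 = 2 ^ 2 * (s' 0 + s' 1) by ring] at this
        rcases hpp.dvd_or_dvd h4 with h5 | h5
        · have := hpp.dvd_of_dvd_pow h5
          exact (hp2 ((Nat.prime_dvd_prime_iff_eq (Nat.prime_of_mem_primeFactors hp')
            Nat.prime_two).1 (by exact_mod_cast this))).elim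
        · exact h5
      rcases hpp.dvd_or_dvd hpd with h0 | h1
      · exact htup.not_dvd hpp h0 ((dvd_add_right h0).1 dC) d0 d1
      · exact htup.not_dvd hpp ((dvd_add_left h1).1 dC) h1 d0 d1)
  obtain ⟨T, t, hT, ht, e0, e1, e2, -⟩ := hS'.exists_rotate hint hs' hB n
  refine ⟨T ∘ σ.symm, t ∘ σ.symm, hT.comp hσ.inv, fun i => ht _, by simpa using e0, by simpa using e1,
    ?_, ?_⟩
  · simp only [Function.comp, Equiv.symm_apply_apply, e2]
    change (s' 2 + _ + _) % 2 = s' 2 % 2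
    rw [show s' 2 + 2 * B * n + 2 * (s' 0 + s' 1) * n ^ 2 =
      s' 2 + 2 * (B * n + (s' 0 + s' 1) * n ^ 2) by ring]
    omega
  · intro p hp hp2 hd
    simp only [Function.comp, Equiv.symm_apply_apply, e2]
    refine hn p (Finset.mem_erase.2 ⟨hp2, Nat.mem_primeFactors.2 ⟨hp, ?_, ?_⟩⟩)
    · exact Int.natCast_dvd.1 (hd.elim (fun h => h.mul_right _) fun h => h.mul_left _)
    · exact Int.natAbs_ne_zero.2 (mul_ne_zero hi hj)

/-! ### Propagation of the invariant -/

theorem chi₂Values_eq_of_isCoprime (hint : A.IsIntegral) (hprim : A.IsPrimitive)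
    (htype : A.HasType ![1, 0, 2, 0, 2, 1] ∨ A.HasType ![7, 2, 4, 2, 4, 7])
    {S : Fin 6 → OrientedCircle} (h : A.IsSextuple S)
    {s : Fin 6 → ℤ} (hs : ∀ i, (S i).curvature = s i) {i j : Fin 6} (hij : OctAdj i j)
    (hi : s i % 2 = 1) (hj : s j ≠ 0) (hc : IsCoprime (s i) (s j)) :
    A.chi₂Values (S i) = A.chi₂Values (S j) := by
  obtain ⟨k, hjk, hik⟩ : ∃ k, OctAdj j k ∧ OctAdj i k := by
    clear hi hj hc; revert i j; decide
  have first {i j k : Fin 6} (hij : OctAdj i j) (hjk : OctAdj j k) (hik : OctAdj i k)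
      (hi : s i ≠ 0) (hc : IsCoprime (s i) (s j)) :
      A.chi₂Values (S i) = {octSymbol (s i) (s i + s j)} ∧ 0 < s i + s j := by
    obtain ⟨σ, hσ, rfl, rfl, rfl⟩ := exists_octAut hij hjk hik
    have hS' := h.comp hσ
    have hs' (i : Fin 6) : ((S ∘ σ) i).curvature = (s ∘ σ) i := hs (σ i)
    have htup := hS'.octTuple hint hprim htype hs'
    exact ⟨chi₂Values_eq hint hprim htype hS' hs' hi htup.represents_add₁
      (by simpa [add_comm] using hc.symm.add_mul_left_left 1),
      htup.pos_of_represents hi htup.represents_add₁⟩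
  have hres := octResidues hint htype h hs
  obtain ⟨e1, hpos⟩ := first hij hjk hik (by omega) hc
  obtain ⟨e2, -⟩ := first (octAdj_symm hij) hik hjk hj hc.symm
  rw [e1, e2, add_comm (s j), octSymbol_reciprocity hj hpos]
  have := hres.adj i j hij
  rcases hres.res with h | h <;> have := (h i).1 <;> have := (h j).1 <;> omega

/-- Tangent circles of odd curvature and of even nonzero curvature have the same invariant. If the
curvatures are not coprime, the two circles are connected by a chain of tangent circles with coprime
curvatures. -/
theorem chi₂Values_eq_of_octAdj (hint : A.IsIntegral) (hprim : A.IsPrimitive)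
    (htype : A.HasType ![1, 0, 2, 0, 2, 1] ∨ A.HasType ![7, 2, 4, 2, 4, 7])
    {S : Fin 6 → OrientedCircle} (h : A.IsSextuple S)
    {s : Fin 6 → ℤ} (hs : ∀ i, (S i).curvature = s i) {i j : Fin 6} (hij : OctAdj i j)
    (hi : s i % 2 = 1) (hj : s j ≠ 0) : A.chi₂Values (S i) = A.chi₂Values (S j) := by
  by_cases hc : IsCoprime (s i) (s j)
  · exact chi₂Values_eq_of_isCoprime hint hprim htype h hs hij hi hj hc
  obtain ⟨k, hjk, hik⟩ : ∃ k, OctAdj j k ∧ OctAdj i k := by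
    clear hi hj hc; revert i j; decide
  have hi0 : s i ≠ 0 := by omega
  have curv_eq {S T : Fin 6 → OrientedCircle} {s t : Fin 6 → ℤ} (hs : ∀ i, (S i).curvature = s i)
      (ht : ∀ i, (T i).curvature = t i) {i : Fin 6} (e : T i = S i) : t i = s i := by
    have := (ht i).symm.trans ((congrArg _ e).trans (hs i))
    exact_mod_cast this
  obtain ⟨T, t, hT, ht, Ti, Tj, par, cop⟩ :=
    h.exists_coprime_neighbour hint hprim htype hs hij hjk hik hi0 hj
  have ti := curv_eq hs ht Ti
  have tj := curv_eq hs ht Tj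
  have hcik : IsCoprime (t i) (t k) := by
    refine Int.isCoprime_of_prime fun p hp hpi => ?_
    rw [ti] at hpi
    refine cop p hp ?_ (Or.inl hpi)
    rintro rfl
    push_cast at hpi
    omega
  have htk : t k ≠ 0 := by
    intro h0
    rw [h0, isCoprime_zero_right, ti] at hcik
    obtain ⟨r, hr⟩ := hcik.exists_left_inv
    exact hc ⟨r, 0, by rw [hr]; simp⟩
  have e1 := chi₂Values_eq_of_isCoprime hint hprim htype hT ht hik (ti ▸ hi) htk hcik
  obtain ⟨U, u, hU, hu, Uj, Uk, par', cop'⟩ :=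
    hT.exists_coprime_neighbour hint hprim htype ht hjk (octAdj_symm hik) (octAdj_symm hij)
      (tj ▸ hj) htk
  have uj := curv_eq ht hu Uj
  have uk := curv_eq ht hu Uk
  have hui : u i % 2 = 1 := by rw [par', ti, hi]
  have hc' {l : Fin 6} (hl : ∀ p : ℕ, p.Prime → p ≠ 2 → (p : ℤ) ∣ u l → ¬(p : ℤ) ∣ u i) :
      IsCoprime (u i) (u l) := by
    refine Int.isCoprime_of_prime fun p hp hpi hpl => ?_
    refine hl p hp ?_ hpl hpi
    rintro rfl
    push_cast at hpi
    omega
  have e2 := chi₂Values_eq_of_isCoprime hint hprim htype hU hu hij hui (uj ▸ tj ▸ hj)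
    (hc' fun p hp hp2 hd => cop' p hp hp2 (Or.inl (uj ▸ hd)))
  have e3 := chi₂Values_eq_of_isCoprime hint hprim htype hU hu hik hui (uk ▸ htk)
    (hc' fun p hp hp2 hd => cop' p hp hp2 (Or.inr (uk ▸ hd)))
  rw [← Ti, ← Tj, e1, ← Uj, ← Uk, ← e2, ← e3]

theorem exists_chi₂Values_eq_sextuple (hint : A.IsIntegral) (hprim : A.IsPrimitive)
    (htype : A.HasType ![1, 0, 2, 0, 2, 1] ∨ A.HasType ![7, 2, 4, 2, 4, 7])
    {S : Fin 6 → OrientedCircle} (h : A.IsSextuple S)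
    {s : Fin 6 → ℤ} (hs : ∀ i, (S i).curvature = s i) :
    ∃ ε : ℤ, (ε = 1 ∨ ε = -1) ∧ ∀ i, s i ≠ 0 → A.chi₂Values (S i) = {ε} := by
  have hres := octResidues hint htype h hs
  obtain ⟨i, hi⟩ := hres.odd
  obtain ⟨ε, hε, e⟩ := exists_chi₂Values_eq hint hprim htype (h.mem_packing i) (by
    rw [hs]; exact_mod_cast (by omega : s i ≠ 0))
  have adj {j : Fin 6} (hij : OctAdj i j) (hj : s j ≠ 0) : A.chi₂Values (S j) = {ε} := by
    rw [← e, chi₂Values_eq_of_octAdj hint hprim htype h hs hij hi hj]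
  refine ⟨ε, hε, fun j hj => ?_⟩
  by_cases hij : OctAdj i j
  · exact adj hij hj
  by_cases hji : j = i
  · rw [hji, e]
  -- The circle opposite to `S i` is compared with `S i` through a common neighbour.
  have hj' : j = Fin.rev i := by
    by_contra hc; exact hij ⟨hji, hc⟩
  obtain ⟨k, hik, hjk, hk⟩ : ∃ k, OctAdj i k ∧ OctAdj j k ∧ s k ≠ 0 := by
    obtain ⟨k, h1, h2, h3, h4⟩ : ∃ k, OctAdj i k ∧ OctAdj (Fin.rev i) k ∧ OctAdj i (Fin.rev k) ∧
        OctAdj (Fin.rev i) (Fin.rev k) := by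
      clear hi e adj hij hji hj'; revert i; decide
    have hsum : s k ≠ 0 ∨ s (Fin.rev k) ≠ 0 := by
      rcases hres.res with h | h <;> have := (h k).2 <;> omega
    rcases hsum with h | h
    · exact ⟨k, h1, hj' ▸ h2, h⟩
    · exact ⟨_, h3, hj' ▸ h4, h⟩
  have hjo : s j % 2 = 1 := by
    rw [hj']
    rcases hres.res with h | h <;> have := (h i).2 <;> omega
  rw [chi₂Values_eq_of_octAdj hint hprim htype h hs hjk hjo hk, adj hik hk]

/-- The invariant is the same for all circles: consecutive sextuples share an odd circle. -/
theorem exists_isChi₂ (hint : A.IsIntegral) (hprim : A.IsPrimitive)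
    (htype : A.HasType ![1, 0, 2, 0, 2, 1] ∨ A.HasType ![7, 2, 4, 2, 4, 7]) :
    ∃ ε : ℤ, (ε = 1 ∨ ε = -1) ∧ A.IsChi₂ ε := by
  obtain ⟨s, hs⟩ := (isSextuple_base (A := A)).exists_curvature hint
  obtain ⟨ε, hε, e⟩ := exists_chi₂Values_eq_sextuple hint hprim htype isSextuple_base hs
  refine ⟨ε, hε, fun C hC hC0 => ?_⟩
  obtain ⟨S, hS, rfl⟩ := exists_isSextuple hC
  refine IsSextuple.induction
    (P := fun S => ∀ i, (S i).curvature ≠ 0 → A.chi₂Values (S i) = {ε}) ?_ ?_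
    isSextuple_base ?_ hS 0 hC0
  · intro S σ _ _ hP i
    exact hP (σ i)
  · intro S S' hS hS' hst hP i hi
    obtain ⟨s, hs⟩ := hS.exists_curvature hint
    obtain ⟨s', hs'⟩ := hS'.exists_curvature hint
    obtain ⟨ε', -, e'⟩ := exists_chi₂Values_eq_sextuple hint hprim htype hS' hs'
    have hf := (octResidues hint htype hS' hs').face_odd
    obtain ⟨j, hj, hj0⟩ : ∃ j, (j = 0 ∨ j = 1 ∨ j = 2) ∧ s' j ≠ 0 := by
      by_cases h0 : s' 0 = 0
      · by_cases h1 : s' 1 = 0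
        · exact ⟨2, by simp, by omega⟩
        · exact ⟨1, by simp, h1⟩
      · exact ⟨0, by simp, h0⟩
    have hS'j : (S j).curvature ≠ 0 := by
      rw [← hst.eq_of_mem hj, hs']; exact_mod_cast hj0
    have h1 := hP j hS'j
    rw [← hst.eq_of_mem hj, e' j hj0, Set.singleton_eq_singleton_iff] at h1
    rw [← h1]
    exact e' i fun h => hi (by rw [hs', h, Int.cast_zero])
  · intro i hi
    exact e i fun h => hi (by rw [hs, h, Int.cast_zero])

end OctahedralConfiguration

/-! ### The reciprocity obstruction -/

theorem octSymbol_sq {n ρ : ℤ} (hn : n ≠ 0) (h : IsCoprime ρ (n ^ 2)) :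
    octSymbol (n ^ 2) ρ = 1 := by
  have h' : IsCoprime ρ n := (IsCoprime.pow_right_iff (by norm_num)).1 h
  have h2 : n ^ 2 % 8 ≠ 2 := by
    rcases Int.even_or_odd n with ⟨m, rfl⟩ | hn
    · rw [show (m + m) ^ 2 = 4 * m ^ 2 by ring]; omega
    · have := Int.eight_dvd_sq_sub_one_of_odd hn; omega
  rw [octSymbol, if_neg h2]
  split_ifs
  · exact kroneckerSymbol_sq hn h'.neg_left
  · exact kroneckerSymbol_sq hn h'

namespace OctTuple

variable {s : Fin 6 → ℤ}

/-- The numbers represented at a circle whose curvature is divisible by `8` are `1` modulo `8`. -/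
theorem represents_emod_eight (h : OctTuple s) (h8 : s 0 % 8 = 0) {ρ : ℤ}
    (hρ : OctRepresents s ρ) (ho : ρ % 2 = 1) : ρ % 8 = 1 := by
  have hf := h.res.face_odd
  have res1 (i : Fin 6) (hi : s i % 2 = 1) : s i % 8 = 1 := by
    rcases h.res.res with h | h <;> have := (h 0).1 <;> have := (h i).1 <;> omega
  obtain ⟨ρ', hρ', h1⟩ : ∃ ρ', OctRepresents s ρ' ∧ ρ' % 8 = 1 := by
    rcases Int.emod_two_eq_zero_or_one (s 1) with h1 | h1
    · exact ⟨_, h.represents_add₂, by have := res1 2 (by omega); omega⟩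
    · exact ⟨_, h.represents_add₁, by have := res1 1 h1; omega⟩
  obtain ⟨X, Y, e⟩ := h.exists_mul_eq_of_even (by omega) hρ hρ' ho (by omega)
  obtain ⟨c, hc⟩ := Int.dvd_of_emod_eq_zero h8
  have e' : ρ * ρ' = X ^ 2 + 8 * (16 * c ^ 2 * Y ^ 2) := by rw [e, hc]; ring
  have hodd : (ρ * ρ') % 2 = 1 := by
    rw [Int.mul_emod, ho, show ρ' % 2 = 1 by omega]; rfl
  have hX : Odd X := by
    rw [← Int.odd_pow' (n := 2) (by norm_num), Int.odd_iff]; omega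
  have h3 := Int.eight_dvd_sq_sub_one_of_odd hX
  have h4 : (ρ * ρ') % 8 = ρ % 8 := by
    rw [Int.mul_emod, h1, mul_one, Int.emod_emod_of_dvd _ (dvd_refl 8)]
  omega

theorem octSymbol_two_mul_sq (h : OctTuple s) {n ρ : ℤ} (hn : n ≠ 0) (h0 : s 0 = 2 * n ^ 2)
    (hρ : OctRepresents s ρ) (hc : IsCoprime ρ (s 0)) : octSymbol (s 0) ρ = 1 := by
  have h' : IsCoprime ρ n :=
    (IsCoprime.pow_right_iff (m := 2) (by norm_num)).1 (h0 ▸ hc).of_mul_right_right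
  have ho : ρ % 2 = 1 :=
    Int.odd_iff.1 (Int.isCoprime_two_right.1 (h0 ▸ hc).of_mul_right_left)
  rcases Int.even_or_odd n with ⟨m, hm⟩ | hn2
  · have h8 : s 0 % 8 = 0 := by
      rw [h0, hm, show 2 * (m + m) ^ 2 = 8 * m ^ 2 by ring]; omega
    rw [octSymbol, if_neg (by omega), if_neg (by omega), h0]
    exact kroneckerSymbol_two_mul_sq hn h' (h.represents_emod_eight h8 hρ ho)
  · have := Int.eight_dvd_sq_sub_one_of_odd hn2
    rw [octSymbol, if_pos (by omega), h0, Int.mul_ediv_cancel_left _ (by norm_num)]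
    exact kroneckerSymbol_sq hn h'

/-- A circle of odd curvature that is tangent to a line has a square as curvature. -/
theorem exists_sq_of_zero (h : OctTuple s) (h0 : s 0 = 0) (h1 : s 1 % 2 = 1) :
    ∃ r, s 1 = r ^ 2 := by
  obtain ⟨B, hB, hdisc⟩ := h.curv.exists_middle
  have hnn := (h.curv.add_nonneg h.pos).1
  rw [h0] at hdisc hnn
  have hco : IsCoprime (s 1) (2 * s 2) := by
    refine Int.isCoprime_of_prime fun p hp h3 h4 => ?_
    have hpp := Nat.prime_iff_prime_int.1 hp
    rcases hpp.dvd_or_dvd h4 with h5 | h5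
    · have : p = 2 := (Nat.prime_dvd_prime_iff_eq hp Nat.prime_two).1 (by exact_mod_cast h5)
      subst this
      push_cast at h3
      omega
    · have hpB : (p : ℤ) ∣ B := by
        refine hpp.dvd_of_dvd_pow (n := 2) ?_
        rw [show B ^ 2 = s 1 * (2 * s 2) by linarith]
        exact h3.mul_right _
      exact h.not_dvd_coeff hB hpp (h0 ▸ dvd_zero _) (by rwa [h0, zero_add])
        (by rwa [h0, zero_add]) hpB
  obtain ⟨r, hr | hr⟩ := Int.sq_of_isCoprime (c := B) hco (by linarith)
  · exact ⟨r, hr⟩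
  · have := sq_nonneg r
    omega

end OctTuple

namespace OctahedralConfiguration

variable {A : OctahedralConfiguration}

theorem exists_sextuple_of_mem_curvatures (hint : A.IsIntegral) {k : ℤ} (hk : k ∈ A.curvatures) :
    ∃ (S : Fin 6 → OrientedCircle) (s : Fin 6 → ℤ), A.IsSextuple S ∧
      (∀ i, (S i).curvature = s i) ∧ s 0 = k := by
  obtain ⟨C, hC, hCk⟩ := hk
  obtain ⟨S, hS, rfl⟩ := exists_isSextuple hC
  obtain ⟨s, hs⟩ := hS.exists_curvature hint
  refine ⟨S, s, hS, hs, ?_⟩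
  have := (hs 0).symm.trans hCk
  exact_mod_cast this

theorem IsSextuple.mem_curvatures {S : Fin 6 → OrientedCircle} (h : A.IsSextuple S)
    {s : Fin 6 → ℤ} (hs : ∀ i, (S i).curvature = s i) (i : Fin 6) : s i ∈ A.curvatures :=
  ⟨S i, h.mem_packing i, hs i⟩

/-- If the curvature `n ^ 2` or `2 * n ^ 2` occurs, then the invariant is `1`. For `n ≠ 0` it is
computed at a circle of this curvature, for `n = 0` at an odd circle tangent to a line. -/
theorem eq_one_of_mem_curvatures (hint : A.IsIntegral) (hprim : A.IsPrimitive)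
    (htype : A.HasType ![1, 0, 2, 0, 2, 1] ∨ A.HasType ![7, 2, 4, 2, 4, 7]) {χ : ℤ}
    (hχ : A.IsChi₂ χ) {n : ℤ} (hn : n ^ 2 ∈ A.curvatures ∨ 2 * n ^ 2 ∈ A.curvatures) : χ = 1 := by
  have ne_zero (n : ℤ) (hn0 : n ≠ 0) (hn : n ^ 2 ∈ A.curvatures ∨ 2 * n ^ 2 ∈ A.curvatures) :
      χ = 1 := by
    have key (k : ℤ) (hk0 : k ≠ 0) (hk : k ∈ A.curvatures)
        (H : ∀ (s : Fin 6 → ℤ) (ρ : ℤ), OctTuple s → s 0 = k → OctRepresents s ρ →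
          IsCoprime ρ (s 0) → octSymbol (s 0) ρ = 1) : χ = 1 := by
      obtain ⟨S, s, hS, hs, rfl⟩ := exists_sextuple_of_mem_curvatures hint hk
      have htup := hS.octTuple hint hprim htype hs
      obtain ⟨ρ, hρ, hc⟩ := htup.exists_represents hk0
      have h1 := hχ (S 0) (hS.mem_packing 0) (by rw [hs]; exact_mod_cast hk0)
      rw [chi₂Values_eq hint hprim htype hS hs hk0 hρ hc, H s ρ htup rfl hρ hc,
        Set.singleton_eq_singleton_iff] at h1
      exact h1.symm
    rcases hn with hn | hn
    · exact key _ (pow_ne_zero 2 hn0) hn fun s ρ _ h0 _ hc => by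
        rw [h0] at hc ⊢
        exact octSymbol_sq hn0 hc
    · exact key _ (mul_ne_zero two_ne_zero (pow_ne_zero 2 hn0)) hn fun s ρ htup h0 hρ hc =>
        htup.octSymbol_two_mul_sq hn0 h0 hρ hc
  by_cases hn0 : n = 0
  · have h0 : (0 : ℤ) ∈ A.curvatures := by subst hn0; simpa using hn
    obtain ⟨S, s, hS, hs, h0⟩ := exists_sextuple_of_mem_curvatures hint h0
    have hf := (octResidues hint htype hS hs).face_odd
    obtain ⟨σ, hσ, hσ0, hσ1⟩ : ∃ σ, IsOctAut σ ∧ σ 0 = 0 ∧ s (σ 1) % 2 = 1 := by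
      rcases Int.emod_two_eq_zero_or_one (s 1) with h1 | h1
      · obtain ⟨σ, hσ, e0, e1, -⟩ := exists_octAut (i := 0) (j := 2) (k := 1) (by decide)
          (by decide) (by decide)
        exact ⟨σ, hσ, e0, by rw [e1]; omega⟩
      · exact ⟨1, isOctAut_one, rfl, h1⟩
    have hs' (i : Fin 6) : ((S ∘ σ) i).curvature = (s ∘ σ) i := hs (σ i)
    obtain ⟨r, hr⟩ := ((hS.comp hσ).octTuple hint hprim htype hs').exists_sq_of_zero
      (by rw [Function.comp, hσ0, h0]) hσ1
    have hmem := (hS.comp hσ).mem_curvatures hs' 1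
    refine ne_zero r ?_ (Or.inl (hr ▸ hmem))
    rintro rfl
    rw [Function.comp] at hr
    omega
  · exact ne_zero n hn0 hn

end OctahedralConfiguration

/-! ### Local solubility -/

theorem Int.Prime.exists_mul_sub_one {p : ℕ} (hp : p.Prime) {u : ℤ} (hu : ¬(p : ℤ) ∣ u) (j : ℕ) :
    ∃ v, (p : ℤ) ^ j ∣ u * v - 1 := by
  have h : IsCoprime ((p : ℤ) ^ j) u :=
    IsCoprime.pow_left ((Prime.coprime_iff_not_dvd (Nat.prime_iff_prime_int.1 hp)).2 hu)
  obtain ⟨x, y, e⟩ := h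
  exact ⟨y, -x, by linear_combination e⟩

/-- Hensel's lemma for a quadratic polynomial in one variable. -/
theorem Int.exists_quadratic_root {p : ℕ} (hp : p.Prime) {u v w n₀ : ℤ}
    (h0 : (p : ℤ) ∣ u * n₀ ^ 2 + v * n₀ + w) (hd : ¬(p : ℤ) ∣ 2 * u * n₀ + v) (j : ℕ) :
    ∃ n, (p : ℤ) ^ j ∣ u * n ^ 2 + v * n + w := by
  suffices H : ∃ n, (p : ℤ) ^ (j + 1) ∣ u * n ^ 2 + v * n + w ∧ (p : ℤ) ∣ n - n₀ by
    obtain ⟨n, hn, -⟩ := H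
    exact ⟨n, (pow_dvd_pow _ (Nat.le_succ j)).trans hn⟩
  induction j with
  | zero => exact ⟨n₀, by simpa using h0, by simp⟩
  | succ j ih =>
    obtain ⟨n, ⟨c, hc⟩, hn⟩ := ih
    have hd' : ¬(p : ℤ) ∣ 2 * u * n + v := fun h => hd (by
      rw [show 2 * u * n₀ + v = 2 * u * n + v - 2 * u * (n - n₀) by ring]
      exact h.sub (hn.mul_left _))
    obtain ⟨i, k, hk⟩ := Int.Prime.exists_mul_sub_one hp hd' 1
    rw [pow_one] at hk
    -- The Newton step.
    refine ⟨n - p ^ (j + 1) * (c * i), ⟨-c * k + u * p ^ j * (c * i) ^ 2, ?_⟩, ?_⟩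
    · have e : u * (n - p ^ (j + 1) * (c * i)) ^ 2 + v * (n - p ^ (j + 1) * (c * i)) + w =
          (u * n ^ 2 + v * n + w) - p ^ (j + 1) * c * ((2 * u * n + v) * i - 1) -
            p ^ (j + 1) * c + u * p ^ (j + 1) * p ^ (j + 1) * (c * i) ^ 2 := by ring
      rw [e, hc, hk]
      ring
    · rw [show n - p ^ (j + 1) * (c * i) - n₀ = n - n₀ - p * (p ^ j * (c * i)) by ring]
      exact hn.sub (Dvd.intro _ rfl)

/-- A nondegenerate binary quadratic form over a finite field of odd characteristic is universal. -/
theorem FiniteField.exists_binary_quadratic {K : Type*} [Field K] [Fintype K]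
    (hK : ringChar K ≠ 2) {α β γ : K} (hδ : α * γ - β ^ 2 ≠ 0) (r : K) :
    ∃ x y, α * x ^ 2 + 2 * β * x * y + γ * y ^ 2 = r := by
  have h2 : (2 : K) ≠ 0 := Ring.two_ne_zero hK
  have main (α β γ : K) (hδ : α * γ - β ^ 2 ≠ 0) (hα : α ≠ 0) :
      ∃ x y, α * x ^ 2 + 2 * β * x * y + γ * y ^ 2 = r := by
    obtain ⟨z, y, e⟩ := FiniteField.exists_root_sum_quadratic
      (f := Polynomial.X ^ 2 - Polynomial.C (α * r))
      (g := Polynomial.C (α * γ - β ^ 2) * Polynomial.X ^ 2)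
      (Polynomial.degree_X_pow_sub_C (by norm_num) _)
      (by rw [Polynomial.degree_C_mul hδ, Polynomial.degree_X_pow]; rfl)
      (FiniteField.odd_card_of_char_ne_two hK)
    simp only [Polynomial.eval_sub, Polynomial.eval_pow, Polynomial.eval_X, Polynomial.eval_C,
      Polynomial.eval_mul] at e
    refine ⟨(z - β * y) / α, y, mul_left_cancel₀ hα ?_⟩
    field_simp
    linear_combination e
  by_cases hα : α = 0
  · by_cases hγ : γ = 0
    · have hβ : β ≠ 0 := fun h => hδ (by rw [hα, h]; ring)
      exact ⟨1, r / (2 * β), by rw [hα, hγ]; field_simp; ring⟩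
    · obtain ⟨x, y, e⟩ := main γ β α (by rwa [mul_comm γ]) hγ
      exact ⟨y, x, by rw [← e]; ring⟩
  · exact main α β γ hδ hα

/-- At an odd prime that does not divide the curvature `a`, the form represents all units. -/
theorem octForm_exists_dvd_sub {p : ℕ} (hp : p.Prime) (hp2 : p ≠ 2) {a A B C r : ℤ}
    (hdisc : B ^ 2 + 2 * a ^ 2 = 2 * A * C) (ha : ¬(p : ℤ) ∣ a) (hr : ¬(p : ℤ) ∣ r) (j : ℕ) :
    ∃ x y, (p : ℤ) ^ j ∣ octForm A B C x y - r := by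
  have : Fact p.Prime := ⟨hp⟩
  have hpp := Nat.prime_iff_prime_int.1 hp
  have hp2' : ¬(p : ℤ) ∣ 2 := fun h =>
    hp2 ((Nat.prime_dvd_prime_iff_eq hp Nat.prime_two).1 (by exact_mod_cast h))
  have cast_ne {z : ℤ} (hz : ¬(p : ℤ) ∣ z) : (z : ZMod p) ≠ 0 := fun h =>
    hz ((ZMod.intCast_zmod_eq_zero_iff_dvd z p).1 h)
  obtain ⟨x, y, e⟩ := FiniteField.exists_binary_quadratic (K := ZMod p)
    (by rwa [ZMod.ringChar_zmod_n]) (α := A) (β := B) (γ := 2 * C) (by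
      have := cast_ne fun h : (p : ℤ) ∣ 2 * a ^ 2 => (hpp.dvd_or_dvd h).elim hp2' fun h =>
        ha (hpp.dvd_of_dvd_pow h)
      rw [show 2 * a ^ 2 = A * (2 * C) - B ^ 2 by linarith] at this
      exact_mod_cast this) r
  obtain ⟨x, rfl⟩ := ZMod.intCast_surjective x
  obtain ⟨y, rfl⟩ := ZMod.intCast_surjective y
  have hroot : (p : ℤ) ∣ octForm A B C x y - r := by
    rw [← ZMod.intCast_zmod_eq_zero_iff_dvd, octForm]
    push_cast
    rw [← e]; ring
  -- By Euler's identity one of the partial derivatives is a unit.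
  by_cases hx : (p : ℤ) ∣ 2 * A * x + 2 * B * y
  · have hy : ¬(p : ℤ) ∣ 2 * (2 * C) * y + 2 * B * x := by
      intro hy
      have h1 : (p : ℤ) ∣ 2 * r := by
        rw [show 2 * r = x * (2 * A * x + 2 * B * y) + y * (2 * (2 * C) * y + 2 * B * x) -
          2 * (octForm A B C x y - r) by rw [octForm]; ring]
        exact ((hx.mul_left _).add (hy.mul_left _)).sub (hroot.mul_left _)
      exact (hpp.dvd_or_dvd h1).elim hp2' hr
    obtain ⟨n, hn⟩ := Int.exists_quadratic_root hp (w := A * x ^ 2 - r) (by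
      rw [show 2 * C * y ^ 2 + 2 * B * x * y + (A * x ^ 2 - r) = octForm A B C x y - r by
        rw [octForm]; ring]
      exact hroot) hy j
    refine ⟨x, n, ?_⟩
    rwa [show octForm A B C x n - r = 2 * C * n ^ 2 + 2 * B * x * n + (A * x ^ 2 - r) by
      rw [octForm]; ring]
  · obtain ⟨n, hn⟩ := Int.exists_quadratic_root hp (w := 2 * C * y ^ 2 - r) (by
      rw [show A * x ^ 2 + 2 * B * y * x + (2 * C * y ^ 2 - r) = octForm A B C x y - r by
        rw [octForm]; ring]
      exact hroot) hx j
    refine ⟨n, y, ?_⟩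
    rwa [show octForm A B C n y - r = A * n ^ 2 + 2 * B * y * n + (2 * C * y ^ 2 - r) by
      rw [octForm]; ring]

theorem octForm_dvd_sub {m A B C x y x' y' : ℤ} (hx : m ∣ x - x') (hy : m ∣ y - y') :
    m ∣ octForm A B C x y - octForm A B C x' y' := by
  rw [show octForm A B C x y - octForm A B C x' y' = (x - x') * (A * (x + x') + 2 * B * y) +
    (y - y') * (2 * B * x' + 2 * C * (y + y')) by simp only [octForm]; ring]
  exact (hx.mul_right _).add (hy.mul_right _)

/-- The values of the form at the vectors that are obtained from `(1, 0)` by three elementary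
transformations. -/
def octFormElem (A B C n₁ m n₂ : ℤ) : ℤ :=
  octForm A B C (1 + 2 * m * n₂) (n₂ + n₁ * (1 + 2 * m * n₂))

theorem octFormElem_exists_of_left {p : ℕ} (hp : p.Prime) {A B C r x y m : ℤ} {j : ℕ}
    (hx : ¬(p : ℤ) ∣ x) (hm : (p : ℤ) ^ j ∣ 1 + 2 * m - x)
    (h : (p : ℤ) ^ j ∣ octForm A B C x y - r) :
    ∃ n₁ n₂, (p : ℤ) ^ j ∣ octFormElem A B C n₁ m n₂ - r := by
  obtain ⟨i, hi⟩ := Int.Prime.exists_mul_sub_one hp hx j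
  refine ⟨(y - 1) * i, 1, ?_⟩
  have h1 : (p : ℤ) ^ j ∣ 1 + 2 * m * 1 - x := by simpa using hm
  have h2 : (p : ℤ) ^ j ∣ 1 + (y - 1) * i * (1 + 2 * m * 1) - y := by
    rw [show 1 + (y - 1) * i * (1 + 2 * m * 1) - y =
      (y - 1) * (x * i - 1) + (y - 1) * i * (1 + 2 * m - x) by ring]
    exact (hi.mul_left _).add (hm.mul_left _)
  simpa [octFormElem] using (octForm_dvd_sub (A := A) (B := B) (C := C) h1 h2).add h

/-- At an odd prime that does not divide `a`, each unit is a value of the form at a vector obtained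
by three elementary transformations. -/
theorem octFormElem_exists {p : ℕ} (hp : p.Prime) (hp2 : p ≠ 2) {a A B C r : ℤ}
    (hdisc : B ^ 2 + 2 * a ^ 2 = 2 * A * C) (ha : ¬(p : ℤ) ∣ a) (hr : ¬(p : ℤ) ∣ r) {j : ℕ}
    (hj : j ≠ 0) : ∃ n₁ m n₂, (p : ℤ) ^ j ∣ octFormElem A B C n₁ m n₂ - r := by
  obtain ⟨x, y, h⟩ := octForm_exists_dvd_sub hp hp2 hdisc ha hr j
  have hpp := Nat.prime_iff_prime_int.1 hp
  have hp2' : ¬(p : ℤ) ∣ 2 := fun h =>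
    hp2 ((Nat.prime_dvd_prime_iff_eq hp Nat.prime_two).1 (by exact_mod_cast h))
  by_cases hx : (p : ℤ) ∣ x
  · have hy : ¬(p : ℤ) ∣ y := fun hy => hr (by
      rw [show r = x * (A * x + 2 * B * y) + y * (2 * C * y) - (octForm A B C x y - r) by
        rw [octForm]; ring]
      exact ((hx.mul_right _).add (hy.mul_right _)).sub ((dvd_pow_self _ hj).trans h))
    obtain ⟨i, hi⟩ := Int.Prime.exists_mul_sub_one hp
      (fun h => (hpp.dvd_or_dvd h).elim hp2' hy : ¬(p : ℤ) ∣ 2 * y) j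
    refine ⟨0, i * (x - 1), y, ?_⟩
    have h1 : (p : ℤ) ^ j ∣ 1 + 2 * (i * (x - 1)) * y - x := by
      rw [show 1 + 2 * (i * (x - 1)) * y - x = (x - 1) * (2 * y * i - 1) by ring]
      exact hi.mul_left _
    have h2 : (p : ℤ) ^ j ∣ y + 0 * (1 + 2 * (i * (x - 1)) * y) - y := by simp
    simpa [octFormElem] using (octForm_dvd_sub (A := A) (B := B) (C := C) h1 h2).add h
  · obtain ⟨i, hi⟩ := Int.Prime.exists_mul_sub_one hp hp2' j
    obtain ⟨n₁, n₂, h'⟩ := octFormElem_exists_of_left hp (m := i * (x - 1)) hx (by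
      rw [show 1 + 2 * (i * (x - 1)) - x = (x - 1) * (2 * i - 1) by ring]
      exact hi.mul_left _) h
    exact ⟨n₁, _, n₂, h'⟩

theorem octFormElem_exists_two {A B C r : ℤ} (hA : A % 2 = 1) (hr : A % 8 = r % 8) (j : ℕ) :
    ∃ n₁ m n₂, (2 : ℤ) ^ j ∣ octFormElem A B C n₁ m n₂ - r := by
  obtain ⟨w, hw⟩ : (8 : ℤ) ∣ A - r := by omega
  -- For `x = 2 n + 1` the equation `A x ^ 2 = r` becomes `A n ^ 2 + A n + 2 w = 0`.
  obtain ⟨n, hn⟩ := Int.exists_quadratic_root Nat.prime_two (u := A) (v := A) (w := 2 * w) (n₀ := 0)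
    (by simp) (by push_cast; omega) j
  obtain ⟨n₁, n₂, h⟩ := octFormElem_exists_of_left (A := A) (B := B) (C := C) (r := r) (y := 0)
    Nat.prime_two (x := 1 + 2 * n) (m := n) (j := j) (by push_cast; omega) (by simp) (by
      rw [show octForm A B C (1 + 2 * n) 0 - r = 4 * (A * n ^ 2 + A * n + 2 * w) by
        rw [octForm]; linear_combination hw]
      exact hn.mul_left 4)
  exact ⟨n₁, n, n₂, by exact_mod_cast h⟩

/-! ### A polynomial family of curvatures -/

/-- Rotation about the first two circles, in terms of the curvatures `a, b, c` of a face and the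
middle coefficient `B` of the form. -/
def octRotate (n : ℤ) : ℤ × ℤ × ℤ × ℤ → ℤ × ℤ × ℤ × ℤ
  | (a, b, c, B) => (a, b, c + 2 * B * n + 2 * (a + b) * n ^ 2, B + 2 * (a + b) * n)

/-- Interchange of the last two circles of a face. -/
def octSwap : ℤ × ℤ × ℤ × ℤ → ℤ × ℤ × ℤ × ℤ
  | (a, b, c, B) => (a, c, b, B)

/-- Interchange of the first two circles of a face. -/
def octSwap' : ℤ × ℤ × ℤ × ℤ → ℤ × ℤ × ℤ × ℤ
  | (a, b, c, B) => (b, a, c, B)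

/-- A family of faces, obtained by rotating a face about its edges `ab`, `ac`, `ab`, `bc`, `ab`. -/
def octFamily (q : ℤ × ℤ × ℤ × ℤ) (n₁ m₁ n₂ m₂ n₃ : ℤ) : ℤ × ℤ × ℤ × ℤ :=
  octRotate n₃ (octSwap' (octSwap (octRotate m₂ (octSwap (octSwap'
    (octRotate n₂ (octSwap (octRotate m₁ (octSwap (octRotate n₁ q))))))))))

theorem octFamily_left (a b c B n₁ m₁ n₂ : ℤ) :
    (octFamily (a, b, c, B) n₁ m₁ n₂ 0 0).2.2.1 = octFormElem (a + c) B (a + b) n₁ m₁ n₂ - a := by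
  simp only [octFamily, octRotate, octSwap, octSwap', octFormElem, octForm]
  ring

theorem octFamily_right (a b c B n₂ m₂ n₃ : ℤ) :
    (octFamily (a, b, c, B) 0 0 n₂ m₂ n₃).2.2.1 = octFormElem (b + c) B (a + b) n₂ m₂ n₃ - b := by
  simp only [octFamily, octRotate, octSwap, octSwap', octFormElem, octForm]
  ring

theorem octFamily_dvd_sub {m : ℤ} (q : ℤ × ℤ × ℤ × ℤ) {n₁ m₁ n₂ m₂ n₃ n₁' m₁' n₂' m₂' n₃' : ℤ}
    (h₁ : m ∣ n₁ - n₁') (h₂ : m ∣ m₁ - m₁') (h₃ : m ∣ n₂ - n₂') (h₄ : m ∣ m₂ - m₂')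
    (h₅ : m ∣ n₃ - n₃') :
    m ∣ (octFamily q n₁ m₁ n₂ m₂ n₃).2.2.1 - (octFamily q n₁' m₁' n₂' m₂' n₃').2.2.1 := by
  have conv {x y : ℤ} (h : m ∣ x - y) : x ≡ y [ZMOD m] := (Int.modEq_iff_dvd.2 h).symm
  have e₁ := conv h₁
  have e₂ := conv h₂
  have e₃ := conv h₃
  have e₄ := conv h₄
  have e₅ := conv h₅
  refine Int.modEq_iff_dvd.1 (Int.ModEq.symm ?_)
  obtain ⟨a, b, c, B⟩ := q
  simp only [octFamily, octRotate, octSwap, octSwap']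
  gcongr

namespace OctahedralConfiguration

variable {A : OctahedralConfiguration}

/-- The faces of a packing, given by their curvatures and by the middle coefficient. -/
def faces (A : OctahedralConfiguration) : Set (ℤ × ℤ × ℤ × ℤ) :=
  {q | ∃ (S : Fin 6 → OrientedCircle) (s : Fin 6 → ℤ), A.IsSextuple S ∧
    (∀ i, (S i).curvature = s i) ∧ s 0 = q.1 ∧ s 1 = q.2.1 ∧ s 2 = q.2.2.1 ∧
    2 * q.2.2.2 = -2 * s 0 - 2 * s 1 - s 2 + s 3}

theorem octRotate_mem_faces (hint : A.IsIntegral) {q : ℤ × ℤ × ℤ × ℤ} (hq : q ∈ A.faces) (n : ℤ) :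
    octRotate n q ∈ A.faces := by
  obtain ⟨a, b, c, B⟩ := q
  obtain ⟨S, s, hS, hs, rfl, rfl, rfl, hB⟩ := hq
  obtain ⟨T, t, hT, ht, e0, e1, e2, e3⟩ := hS.exists_rotate hint hs hB n
  have t0 : t 0 = s 0 := by
    have := (ht 0).symm.trans ((congrArg _ e0).trans (hs 0))
    exact_mod_cast this
  have t1 : t 1 = s 1 := by
    have := (ht 1).symm.trans ((congrArg _ e1).trans (hs 1))
    exact_mod_cast this
  refine ⟨T, t, hT, ht, t0, t1, e2, ?_⟩
  change 2 * (B + 2 * (s 0 + s 1) * n) = _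
  rw [t0, t1, e2, e3]
  ring

theorem octSwap_mem_faces {q : ℤ × ℤ × ℤ × ℤ} (hq : q ∈ A.faces) : octSwap q ∈ A.faces := by
  obtain ⟨a, b, c, B⟩ := q
  obtain ⟨S, s, hS, hs, rfl, rfl, rfl, hB⟩ := hq
  obtain ⟨σ, hσ, e0, e1, e2⟩ := exists_octAut (i := 0) (j := 2) (k := 1) (by decide) (by decide)
    (by decide)
  have hc := hS.isOctFrame.octCurvatures hs
  have e3 : σ 3 = 4 := by rw [show (3 : Fin 6) = Fin.rev 2 from rfl, hσ.rev, e2]; rfl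
  refine ⟨S ∘ σ, s ∘ σ, hS.comp hσ, fun i => hs _, ?_, ?_, ?_, ?_⟩ <;>
    simp only [Function.comp, e0, e1, e2, e3, octSwap]
  have := hc.sum₁
  have := hc.sum₂
  change 2 * B = _ at hB
  omega

theorem octSwap'_mem_faces {q : ℤ × ℤ × ℤ × ℤ} (hq : q ∈ A.faces) : octSwap' q ∈ A.faces := by
  obtain ⟨a, b, c, B⟩ := q
  obtain ⟨S, s, hS, hs, rfl, rfl, rfl, hB⟩ := hq
  obtain ⟨σ, hσ, e0, e1, e2⟩ := exists_octAut (i := 1) (j := 0) (k := 2) (by decide) (by decide)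
    (by decide)
  have e3 : σ 3 = 3 := by rw [show (3 : Fin 6) = Fin.rev 2 from rfl, hσ.rev, e2]
  refine ⟨S ∘ σ, s ∘ σ, hS.comp hσ, fun i => hs _, ?_, ?_, ?_, ?_⟩ <;>
    simp only [Function.comp, e0, e1, e2, e3, octSwap']
  change 2 * B = _ at hB
  omega

theorem octFamily_mem_faces (hint : A.IsIntegral) {q : ℤ × ℤ × ℤ × ℤ} (hq : q ∈ A.faces)
    (n₁ m₁ n₂ m₂ n₃ : ℤ) : octFamily q n₁ m₁ n₂ m₂ n₃ ∈ A.faces :=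
  octRotate_mem_faces hint (octSwap'_mem_faces (octSwap_mem_faces (octRotate_mem_faces hint
    (octSwap_mem_faces (octSwap'_mem_faces (octRotate_mem_faces hint (octSwap_mem_faces
      (octRotate_mem_faces hint (octSwap_mem_faces (octRotate_mem_faces hint hq n₁)) m₁)) n₂)))
        m₂))) n₃

/-- An integer that the curvatures `c` of a polynomial family of faces approximate at each prime
satisfies all the modular restrictions. -/
theorem admissible_of_local (hint : A.IsIntegral) {q : ℤ × ℤ × ℤ × ℤ} (hq : q ∈ A.faces) {t : ℤ}
    (h : ∀ p j : ℕ, p.Prime → j ≠ 0 → ∃ n₁ m₁ n₂ m₂ n₃,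
      (p : ℤ) ^ j ∣ (octFamily q n₁ m₁ n₂ m₂ n₃).2.2.1 - t) : A.Admissible t := by
  have key (m : ℕ) (hm : m ≠ 0) : ∃ n₁ m₁ n₂ m₂ n₃,
      (m : ℤ) ∣ (octFamily q n₁ m₁ n₂ m₂ n₃).2.2.1 - t := by
    induction m using Nat.recOnPosPrimePosCoprime with
    | prime_pow p j hp hj =>
      obtain ⟨n₁, m₁, n₂, m₂, n₃, h⟩ := h p j hp hj.ne'
      exact ⟨n₁, m₁, n₂, m₂, n₃, by exact_mod_cast h⟩
    | zero => exact absurd rfl hm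
    | one => exact ⟨0, 0, 0, 0, 0, by simp⟩
    | coprime a b ha hb hab iha ihb =>
      obtain ⟨x₁, x₂, x₃, x₄, x₅, hx⟩ := iha (by omega)
      obtain ⟨y₁, y₂, y₃, y₄, y₅, hy⟩ := ihb (by omega)
      have hco : IsCoprime (a : ℤ) (b : ℤ) := Nat.isCoprime_iff_coprime.2 hab
      obtain ⟨z₁, u₁, v₁⟩ := Int.exists_dvd_sub_dvd_sub hco x₁ y₁
      obtain ⟨z₂, u₂, v₂⟩ := Int.exists_dvd_sub_dvd_sub hco x₂ y₂
      obtain ⟨z₃, u₃, v₃⟩ := Int.exists_dvd_sub_dvd_sub hco x₃ y₃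
      obtain ⟨z₄, u₄, v₄⟩ := Int.exists_dvd_sub_dvd_sub hco x₄ y₄
      obtain ⟨z₅, u₅, v₅⟩ := Int.exists_dvd_sub_dvd_sub hco x₅ y₅
      refine ⟨z₁, z₂, z₃, z₄, z₅, ?_⟩
      rw [Nat.cast_mul]
      refine hco.mul_dvd ?_ ?_
      · simpa using (octFamily_dvd_sub q u₁ u₂ u₃ u₄ u₅).add hx
      · simpa using (octFamily_dvd_sub q v₁ v₂ v₃ v₄ v₅).add hy
  intro m hm
  obtain ⟨n₁, m₁, n₂, m₂, n₃, hd⟩ := key m hm.ne'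
  obtain ⟨S, s, hS, hs, -, -, h2, -⟩ := octFamily_mem_faces hint hq n₁ m₁ n₂ m₂ n₃
  exact ⟨_, h2 ▸ hS.mem_curvatures hs 2, (Int.modEq_iff_dvd.2 hd).symm⟩

/-- The admissible integers `2 * k ^ 2`. At each prime one of the circles of curvature `a` and `b`
has a neighbour of curvature close to `2 * k ^ 2`: for the prime `2` and for the odd primes that
divide neither `a` nor `2 * k ^ 2 + a` the first one, for the remaining primes the second one. -/
theorem admissible_two_mul_sq (hint : A.IsIntegral) {a b c B : ℤ} (hq : (a, b, c, B) ∈ A.faces)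
    (ha : a % 2 = 1) (hab : IsCoprime a b) (hc : c % 8 = 2) {k : ℤ} (hk : k % 2 = 1)
    (hdvd : ∀ p : ℕ, p.Prime → p ≠ 2 → (p : ℤ) ∣ a * b * (a - b) → (p : ℤ) ∣ k) :
    A.Admissible (2 * k ^ 2) := by
  have hdisc : B ^ 2 + 2 * a ^ 2 = 2 * (a + c) * (a + b) := by
    obtain ⟨S, s, hS, hs, rfl, rfl, rfl, hB⟩ := hq
    obtain ⟨B', hB', h⟩ := (hS.isOctFrame.octCurvatures hs).exists_middle
    have : B = B' := by change 2 * B = _ at hB; omega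
    exact this ▸ h
  have hdisc' : B ^ 2 + 2 * b ^ 2 = 2 * (b + c) * (a + b) := by linear_combination hdisc
  have hk8 := Int.eight_dvd_sq_sub_one_of_odd (Int.odd_iff.2 hk)
  refine admissible_of_local hint hq fun p j hp hj => ?_
  by_cases hp2 : p = 2
  · subst hp2
    obtain ⟨n₁, m, n₂, h⟩ := octFormElem_exists_two (A := a + c) (B := B) (C := a + b)
      (r := 2 * k ^ 2 + a) (by omega) (by omega) j
    refine ⟨n₁, m, n₂, 0, 0, ?_⟩
    rw [octFamily_left, show ∀ x, x - a - 2 * k ^ 2 = x - (2 * k ^ 2 + a) by intro x; ring]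
    exact_mod_cast h
  have hpp := Nat.prime_iff_prime_int.1 hp
  by_cases hgood : ¬(p : ℤ) ∣ a ∧ ¬(p : ℤ) ∣ 2 * k ^ 2 + a
  · obtain ⟨n₁, m, n₂, h⟩ := octFormElem_exists hp hp2 hdisc hgood.1 hgood.2 hj
    refine ⟨n₁, m, n₂, 0, 0, ?_⟩
    rwa [octFamily_left, show ∀ x, x - a - 2 * k ^ 2 = x - (2 * k ^ 2 + a) by intro x; ring]
  · have hb : ¬(p : ℤ) ∣ b ∧ ¬(p : ℤ) ∣ 2 * k ^ 2 + b := by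
      have ht (hd : (p : ℤ) ∣ a * b * (a - b)) : (p : ℤ) ∣ 2 * k ^ 2 :=
        ((hdvd p hp hp2 hd).pow (by norm_num)).mul_left 2
      by_cases hpa : (p : ℤ) ∣ a
      · have hpb : ¬(p : ℤ) ∣ b := fun hpb => hpp.not_isUnit (hab.isUnit_of_dvd' hpa hpb)
        exact ⟨hpb, fun h => hpb ((dvd_add_right (ht ((hpa.mul_right _).mul_right _))).1 h)⟩
      · have hta : (p : ℤ) ∣ 2 * k ^ 2 + a := by tauto
        have hn : ¬(p : ℤ) ∣ a * b * (a - b) := fun h => hpa ((dvd_add_right (ht h)).1 hta)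
        refine ⟨fun h => hn ((h.mul_left _).mul_right _), fun h => hn (Dvd.dvd.mul_left ?_ _)⟩
        simpa using hta.sub h
    obtain ⟨n₁, m, n₂, h⟩ := octFormElem_exists hp hp2 hdisc' hb.1 hb.2 hj
    refine ⟨0, 0, n₁, m, n₂, ?_⟩
    rwa [octFamily_right, show ∀ x, x - b - 2 * k ^ 2 = x - (2 * k ^ 2 + b) by intro x; ring]

theorem exists_face (hint : A.IsIntegral) (hprim : A.IsPrimitive)
    (htype : A.HasType ![1, 0, 2, 0, 2, 1] ∨ A.HasType ![7, 2, 4, 2, 4, 7])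
    (h0 : (0 : ℤ) ∉ A.curvatures) : ∃ a b c B, (a, b, c, B) ∈ A.faces ∧ a % 2 = 1 ∧ b % 2 = 0 ∧
      b ≠ 0 ∧ IsCoprime a b ∧ c % 8 = 2 := by
  obtain ⟨s, hs⟩ := (isSextuple_base (A := A)).exists_curvature hint
  have hres := octResidues hint htype isSextuple_base hs
  obtain ⟨i, hi⟩ := hres.odd
  obtain ⟨j, k, hij, hjk, hik⟩ : ∃ j k, OctAdj i j ∧ OctAdj j k ∧ OctAdj i k := by
    clear hi; revert i; decide
  have ne {S : Fin 6 → OrientedCircle} (hS : A.IsSextuple S) {s : Fin 6 → ℤ}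
      (hs : ∀ i, (S i).curvature = s i) (i : Fin 6) : s i ≠ 0 :=
    fun h => h0 (h ▸ hS.mem_curvatures hs i)
  obtain ⟨T, t, hT, ht, Ti, -, par, cop⟩ := isSextuple_base.exists_coprime_neighbour hint hprim
    htype hs hij hjk hik (ne isSextuple_base hs i) (ne isSextuple_base hs j)
  have ti : t i = s i := by
    have := (ht i).symm.trans ((congrArg _ Ti).trans (hs i))
    exact_mod_cast this
  have tres := octResidues hint htype hT ht
  have hik2 := tres.adj i k hik
  have hij2 := tres.adj i j hij
  have hco : IsCoprime (t i) (t k) := by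
    refine Int.isCoprime_of_prime fun p hp hpi => ?_
    rw [ti] at hpi
    refine cop p hp ?_ (Or.inl hpi)
    rintro rfl
    push_cast at hpi
    omega
  obtain ⟨l, hil, hkl, hl⟩ : ∃ l, OctAdj i l ∧ OctAdj k l ∧ t l % 8 = 2 := by
    have hrev : OctAdj i (Fin.rev j) ∧ OctAdj k (Fin.rev j) ∧ OctAdj k j := by
      clear hi hik2 hij2 hco par cop Ti ti; revert i j k; decide
    have : t j % 8 = 2 ∨ t (Fin.rev j) % 8 = 2 := by
      rcases tres.res with h | h <;> have h1 := h j <;> have h2 := (h (Fin.rev j)).1 <;> omega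
    rcases this with h | h
    · exact ⟨j, hij, hrev.2.2, h⟩
    · exact ⟨_, hrev.1, hrev.2.1, h⟩
  obtain ⟨σ, hσ, rfl, rfl, rfl⟩ := exists_octAut hik hkl hil
  have hs' (i : Fin 6) : ((T ∘ σ) i).curvature = (t ∘ σ) i := ht (σ i)
  obtain ⟨B, hB, -⟩ := ((hT.comp hσ).isOctFrame.octCurvatures hs').exists_middle
  exact ⟨_, _, _, B, ⟨T ∘ σ, t ∘ σ, hT.comp hσ, hs', rfl, rfl, rfl, hB⟩, by omega, by omega,
    ne hT ht _, hco, hl⟩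

/-- Infinitely many integers `2 * k ^ 2` satisfy the modular restrictions. -/
theorem exists_admissible_two_mul_sq (hint : A.IsIntegral) (hprim : A.IsPrimitive)
    (htype : A.HasType ![1, 0, 2, 0, 2, 1] ∨ A.HasType ![7, 2, 4, 2, 4, 7])
    (h0 : (0 : ℤ) ∉ A.curvatures) (N : ℤ) : ∃ k : ℤ, N ≤ 2 * k ^ 2 ∧ A.Admissible (2 * k ^ 2) := by
  obtain ⟨a, b, c, B, hq, ha, hb, hb0, hab, hc⟩ := exists_face hint hprim htype h0
  have ha0 : a ≠ 0 := by omega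
  have hab0 : a - b ≠ 0 := by omega
  obtain ⟨v, β, hβ, e⟩ := Int.exists_eq_two_pow_mul (mul_ne_zero (mul_ne_zero ha0 hb0) hab0)
  refine ⟨β * (2 * N + 1), ?_, admissible_two_mul_sq hint hq ha hab hc ?_ fun p hp hp2 hd => ?_⟩
  · have h1 : 0 < β ^ 2 := by
      have : β ≠ 0 := by omega
      positivity
    have h2 : 0 ≤ (2 * N + 1) ^ 2 := sq_nonneg _
    have h3 : (2 * N + 1) ^ 2 ≤ (β * (2 * N + 1)) ^ 2 := by
      rw [mul_pow]; nlinarith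
    have h4 : N ≤ 2 * (2 * N + 1) ^ 2 := by nlinarith [sq_nonneg (N + 1), sq_nonneg N]
    linarith
  · rw [Int.mul_emod, hβ, show (2 * N + 1) % 2 = 1 by omega]; rfl
  · have hpp := Nat.prime_iff_prime_int.1 hp
    rw [e] at hd
    rcases hpp.dvd_or_dvd hd with h | h
    · have h2 := hpp.dvd_of_dvd_pow h
      exact (hp2 ((Nat.prime_dvd_prime_iff_eq hp Nat.prime_two).1 (by exact_mod_cast h2))).elim
    · exact h.mul_right _

end OctahedralConfiguration

theorem mainTheorem2 (A : OctahedralConfiguration) (hint : A.IsIntegral) (hprim : A.IsPrimitive)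
    (htype : A.HasType ![1, 0, 2, 0, 2, 1] ∨ A.HasType ![7, 2, 4, 2, 4, 7]) :
    ∃ χ : ℤ, (χ = 1 ∨ χ = -1) ∧ A.IsChi₂ χ ∧
      (χ = -1 →
        (∀ n : ℤ, n ^ 2 ∉ A.curvatures ∧ 2 * n ^ 2 ∉ A.curvatures) ∧ ¬ A.LocalGlobal) := by
  obtain ⟨χ, hχ, hA⟩ := OctahedralConfiguration.exists_isChi₂ hint hprim htype
  refine ⟨χ, hχ, hA, fun hneg => ?_⟩
  have key (n : ℤ) : n ^ 2 ∉ A.curvatures ∧ 2 * n ^ 2 ∉ A.curvatures := by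
    rw [← not_or]
    intro hn
    have := OctahedralConfiguration.eq_one_of_mem_curvatures hint hprim htype hA hn
    omega
  refine ⟨key, fun ⟨N, hN⟩ => ?_⟩
  obtain ⟨k, hk, hadm⟩ := OctahedralConfiguration.exists_admissible_two_mul_sq hint hprim htype
    (by simpa using (key 0).1) N
  exact (key k).2 (hN _ hk hadm)
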